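/- Let $d\ge 1$, and let $P$ be a real polynomial on $\mathbb R^d$ of degree $m\ge 2$ that is positive-elliptic (its leading homogeneous part $P_m$ satisfies $P_m(x)>0$ for $x\ne0$) and satisfies $P\ge 0$ on $\mathbb R^d$ (for instance, $P=P_m$ homogeneous). For $z\in\mathbb C$ put $L(z;x,\xi)=|\xi|^2+(P(x)-z)^2$, $c_{\alpha,\beta}=\frac{(-1)^{|\beta|}}{2^{|\alpha|+|\beta|}\alpha!\beta!}$, $\{a,b\}_n=\sum_{|\alpha|+|\beta|=n}c_{\alpha,\beta}\,\partial_\xi^\alpha\partial_x^\beta a\;\partial_\xi^\beta\partial_x^\alpha b$, and $$K_0=\frac1L,\qquad K_2=-K_0\{L,K_0\}_2,\qquad K_4=-K_0\bigl(\{L,K_0\}_4+\{L,K_2\}_2\bigr).$$ Let $r_0>0$, $\pi/2<\theta_0<\pi$, and let $\Gamma$ be the contour that comes in from infinity along $\arg z=\theta_0$, $|z|\ge r_0$, follows the arc $z=r_0e^{i\theta}$, $\theta_0\le\theta\le2\pi-\theta_0$, and goes out to infinity along $\arg z=-\theta_0$; write $\oint_\Gamma=\frac1{2i\pi}\int_\Gamma$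 and $\Omega=\{|z|\le r_0\}\cup\{|\arg z|\le\theta_0\}$. Let $\mu>d(m+1)/m$. For $f$ holomorphic in a neighbourhood of $\Omega$ with $|f(z)|\le C(1+|z|)^{-\mu}$ on $\Omega$, put $$C_4^{(d)}(f)=-2\,(2\pi)^{-d}\int_{\mathbb R^d}\oint_\Gamma (P(x)-z)\Bigl(\int_{\mathbb R^d}K_4(z;x,\xi)\,d\xi\Bigr)f(z)\,dz\,dx .$$ (a) For $d=5$ and $d=7$ and every such $f$, the integrals over $\xi\in\mathbb R^d$ (for $z\in\Gamma$), over $z\in\Gamma$ and over $x\in\mathbb R^d$ that define $C_4^{(d)}(f)$ converge absolutely, and $$C_4^{(d)}(f)=(2\pi)^{-d}\int_{\mathbb R^d}\sum_k A_k(x)\,f^{(k)}(P(x))\,dx ,$$ the integral being absolutely convergent, where for $d=5$ $$A_0=-\tfrac{\pi^3}{96}\sum_{j,k}\partial_j^2\partial_k^2P,\quad A_1=-\tfrac{\pi^3}{160}(\Delta P)^2,\quad A_2=\tfrac{\pi^3}{80}|\nabla P|^2\Delta P+\tfrac{\pi^3}{240}\sum_{j,k}(\partial_j\partial_kP)(\partial_jP)(\partial_kP),$$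 and $A_k=0$ for $k\geq 3$; and for $d=7$ $$A_0=\tfrac{\pi^4}{360}|\nabla P|^2\Delta P+\tfrac{\pi^4}{180}\sum_{j,k}(\partial_j\partial_kP)(\partial_jP)(\partial_kP),\quad A_1=-\tfrac{\pi^4}{60}|\nabla P|^4,$$ and $A_k=0$ for $k\geq 2$. (b) Let $t>r_0$ and $f(\lambda)=(\lambda+t)^{-\mu}$ (principal branch; for given $t>0$ any $r_0\in(0,t)$ is allowed). Then $f$ satisfies the hypotheses above, and $C_4^{(d)}(f)\neq0$ in each of the following cases: 1. $d\in\{5,7\}$ and $P(x)=\sum_{j}\alpha_jx_j^m$ with all $\alpha_j>0$; 2. $d\in\{5,7\}$ and $P(x)=\sum_{j,k}\alpha_{j,k}x_jx_k$ is a positive definite quadratic form; 3. $d=7$ and $P$ is convex; 4. $d=5$, $P$ is convex, and everywhere on $\mathbb R^5$ $$\sum_{j<k}\partial_j^2\partial_k^2P\le 2\sum_j\partial_j^4P,\qquad \sum_{j\ne k}(\partial_j\partial_kP)^2\le 11\pi\sum_j(\partial_j^2P)^2 .$$ -/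

import Mathlib

open MeasureTheory

namespace QuadraticPencil

/-! ### Polynomials -/

/-- `P` is a positive-elliptic polynomial of degree `m ≥ 2` on `ℝ^d`: its leading homogeneous part
is positive away from the origin. -/
structure IsPositiveElliptic {d : ℕ} (P : MvPolynomial (Fin d) ℝ) (m : ℕ) : Prop where
  two_le : 2 ≤ m
  totalDegree_eq : P.totalDegree = m
  leading_pos : ∀ x : Fin d → ℝ, x ≠ 0 →
    0 < MvPolynomial.eval x (MvPolynomial.homogeneousComponent m P)

/-- First partial derivative `∂_j P`, evaluated at `x`. -/
noncomputable def D1 {d : ℕ} (P : MvPolynomial (Fin d) ℝ) (j : Fin d) (x : Fin d → ℝ) : ℝ :=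
  MvPolynomial.eval x (MvPolynomial.pderiv j P)

/-- Second partial derivative `∂_j ∂_k P`, evaluated at `x`. -/
noncomputable def D2 {d : ℕ} (P : MvPolynomial (Fin d) ℝ) (j k : Fin d) (x : Fin d → ℝ) : ℝ :=
  MvPolynomial.eval x (MvPolynomial.pderiv j (MvPolynomial.pderiv k P))

/-- Fourth partial derivative `∂_j² ∂_k² P`, evaluated at `x` (it is `∂_j⁴ P` for `k = j`). -/
noncomputable def D22 {d : ℕ} (P : MvPolynomial (Fin d) ℝ) (j k : Fin d) (x : Fin d → ℝ) : ℝ :=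
  MvPolynomial.eval x (MvPolynomial.pderiv j (MvPolynomial.pderiv j
    (MvPolynomial.pderiv k (MvPolynomial.pderiv k P))))

/-- `|∇P(x)|²`. -/
noncomputable def gradSq {d : ℕ} (P : MvPolynomial (Fin d) ℝ) (x : Fin d → ℝ) : ℝ :=
  ∑ j, D1 P j x ^ 2

/-- `ΔP(x)`. -/
noncomputable def lap {d : ℕ} (P : MvPolynomial (Fin d) ℝ) (x : Fin d → ℝ) : ℝ :=
  ∑ j, D2 P j j x

/-- `D²P(x) ∇P(x) · ∇P(x)`. -/
noncomputable def hessGrad {d : ℕ} (P : MvPolynomial (Fin d) ℝ) (x : Fin d → ℝ) : ℝ :=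
  ∑ j, ∑ k, D2 P j k x * D1 P j x * D1 P k x

/-- `Δ²P(x) = ∑_{j,k} ∂_j² ∂_k² P(x)`. -/
noncomputable def bilap {d : ℕ} (P : MvPolynomial (Fin d) ℝ) (x : Fin d → ℝ) : ℝ :=
  ∑ j, ∑ k, D22 P j k x

/-! ### Symbols on phase space and the parametrix of `-ħ²Δ + (P - z)²` -/

/-- Functions of `(x, ξ) ∈ ℝ^d × ℝ^d`. -/
abbrev Symb (d : ℕ) : Type := (Fin d → ℝ) → (Fin d → ℝ) → ℂ

/-- `∂g/∂y_j`. -/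
noncomputable def partialD {d : ℕ} (j : Fin d) (g : (Fin d → ℝ) → ℂ) : (Fin d → ℝ) → ℂ :=
  fun y => lineDeriv ℝ g y (Pi.single j 1)

/-- `∂^α g = ∂_1^{α_1} ⋯ ∂_d^{α_d} g` for a multi-index `α`. -/
noncomputable def multiD {d : ℕ} (α : Fin d → ℕ) (g : (Fin d → ℝ) → ℂ) : (Fin d → ℝ) → ℂ :=
  (List.finRange d).foldr (fun j h => (partialD j)^[α j] h) g

/-- `∂_x^α a`. -/
noncomputable def multiDx {d : ℕ} (α : Fin d → ℕ) (a : Symb d) : Symb d :=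
  fun x ξ => multiD α (fun y => a y ξ) x

/-- `∂_ξ^α a`. -/
noncomputable def multiDxi {d : ℕ} (α : Fin d → ℕ) (a : Symb d) : Symb d :=
  fun x ξ => multiD α (a x) ξ

/-- `∑_{|α|+|β|=n} Γ(α,β) (∂_ξ^α ∂_x^β a) (∂_ξ^β ∂_x^α b)`
with `Γ(α,β) = (-1)^{|β|} / (2^n α! β!)`. -/
noncomputable def moyal {d : ℕ} (n : ℕ) (a b : Symb d) : Symb d := fun x ξ =>
  ∑ p ∈ Finset.HasAntidiagonal.antidiagonal n,
    ∑ α ∈ Finset.piAntidiag (Finset.univ : Finset (Fin d)) p.1,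
      ∑ β ∈ Finset.piAntidiag (Finset.univ : Finset (Fin d)) p.2,
        ((-1 : ℂ) ^ p.2 /
            ((2 : ℂ) ^ n * (∏ j, ((α j).factorial : ℂ)) * (∏ j, ((β j).factorial : ℂ)))) *
          multiDxi α (multiDx β a) x ξ * multiDxi β (multiDx α b) x ξ

/-- The symbol `L(z; x, ξ) = |ξ|² + (P(x) - z)²`. -/
noncomputable def symbL {d : ℕ} (P : MvPolynomial (Fin d) ℝ) (z : ℂ) : Symb d :=
  fun x ξ => (∑ j, (ξ j : ℂ) ^ 2) + ((MvPolynomial.eval x P : ℝ) - z) ^ 2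

/-- `K_0 = 1 / L`. -/
noncomputable def K0 {d : ℕ} (P : MvPolynomial (Fin d) ℝ) (z : ℂ) : Symb d :=
  fun x ξ => 1 / symbL P z x ξ

/-- `K_2`, the first step of the recursion for the parametrix. -/
noncomputable def K2 {d : ℕ} (P : MvPolynomial (Fin d) ℝ) (z : ℂ) : Symb d :=
  fun x ξ => -K0 P z x ξ * moyal 2 (symbL P z) (K0 P z) x ξ

/-- `K_4`, the second step of the recursion for the parametrix. -/
noncomputable def K4 {d : ℕ} (P : MvPolynomial (Fin d) ℝ) (z : ℂ) : Symb d :=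
  fun x ξ => -K0 P z x ξ *
    (moyal 4 (symbL P z) (K0 P z) x ξ + moyal 2 (symbL P z) (K2 P z) x ξ)

/-! ### The contour -/

/-- The contour `Γ`: the two rays `arg z = ±θ₀`, `|z| ≥ r₀`, joined by the arc of `|z| = r₀` that
passes through `-r₀`. -/
def contour (r₀ θ₀ : ℝ) : Set ℂ :=
  {z | ∃ r : ℝ, r₀ ≤ r ∧
      (z = r * Complex.exp (θ₀ * Complex.I) ∨ z = r * Complex.exp (-θ₀ * Complex.I))} ∪
    {z | ∃ θ : ℝ, θ₀ ≤ θ ∧ θ ≤ 2 * Real.pi - θ₀ ∧ z = r₀ * Complex.exp (θ * Complex.I)}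

/-- The closed region on and to the right of `Γ`. -/
def region (r₀ θ₀ : ℝ) : Set ℂ := {z | ‖z‖ ≤ r₀ ∨ |z.arg| ≤ θ₀}

/-- The three pieces of the contour integral of `F` converge absolutely. -/
def ContourIntegrable (r₀ θ₀ : ℝ) (F : ℂ → ℂ) : Prop :=
  IntegrableOn (fun r : ℝ => F (r * Complex.exp (θ₀ * Complex.I))) (Set.Ioi r₀) ∧
  IntervalIntegrable (fun θ : ℝ => F (r₀ * Complex.exp (θ * Complex.I))) volume
    θ₀ (2 * Real.pi - θ₀) ∧
  IntegrableOn (fun r : ℝ => F (r * Complex.exp (-θ₀ * Complex.I))) (Set.Ioi r₀)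

/-- `∮_Γ F(z) dz = (1 / 2iπ) ∫_Γ F(z) dz`, where `Γ` comes in along `arg z = θ₀`, follows the arc
through `-r₀`, and goes out along `arg z = -θ₀` (the region is on its left). -/
noncomputable def contourInt (r₀ θ₀ : ℝ) (F : ℂ → ℂ) : ℂ :=
  (1 / (2 * Complex.I * Real.pi)) *
    (-(∫ r in Set.Ioi r₀,
          F (r * Complex.exp (θ₀ * Complex.I)) * Complex.exp (θ₀ * Complex.I)) +
      (∫ θ in θ₀..(2 * Real.pi - θ₀),
          F (r₀ * Complex.exp (θ * Complex.I)) *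
            (Complex.I * r₀ * Complex.exp (θ * Complex.I))) +
      ∫ r in Set.Ioi r₀,
          F (r * Complex.exp (-θ₀ * Complex.I)) * Complex.exp (-θ₀ * Complex.I))

/-- `f` is holomorphic near the closed region to the right of `Γ`, with
`|f(z)| ≤ C (1 + |z|)^{-μ}` there. -/
def Admissible (r₀ θ₀ μ : ℝ) (f : ℂ → ℂ) : Prop :=
  AnalyticOnNhd ℂ f (region r₀ θ₀) ∧
    ∃ C : ℝ, ∀ z ∈ region r₀ θ₀, ‖f z‖ ≤ C * (1 + ‖z‖) ^ (-μ)

/-! ### The coefficient `C_4^{(d)}(f)` -/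

/-- The integrand `(P(x) - z) (∫ K_4(z; x, ξ) dξ) f(z)` of the contour integral. -/
noncomputable def C4integrand {d : ℕ} (P : MvPolynomial (Fin d) ℝ) (f : ℂ → ℂ) (x : Fin d → ℝ)
    (z : ℂ) : ℂ :=
  ((MvPolynomial.eval x P : ℝ) - z) * (∫ ξ : Fin d → ℝ, K4 P z x ξ) * f z

/-- `-2 ∮_Γ (P(x) - z) (∫ K_4(z; x, ξ) dξ) f(z) dz`. -/
noncomputable def C4density {d : ℕ} (P : MvPolynomial (Fin d) ℝ) (r₀ θ₀ : ℝ) (f : ℂ → ℂ)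
    (x : Fin d → ℝ) : ℂ :=
  -2 * contourInt r₀ θ₀ (C4integrand P f x)

/-- `C_4^{(d)}(f) = -2 ∫ ∮_Γ (P(x) - z) (∫ K_4(z; x, ξ) dξ) f(z) dz (2π)^{-d} dx`. -/
noncomputable def C4 {d : ℕ} (P : MvPolynomial (Fin d) ℝ) (r₀ θ₀ : ℝ) (f : ℂ → ℂ) : ℂ :=
  ∫ x : Fin d → ℝ, C4density P r₀ θ₀ f x * ((2 * Real.pi : ℝ) : ℂ) ^ (-(d : ℤ))

/-- All the integrals in the definition of `C_4^{(d)}(f)` converge absolutely, so does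
`∫ G(x) (2π)^{-d} dx`, and the latter is equal to `C_4^{(d)}(f)`. -/
def HasC4Formula {d : ℕ} (P : MvPolynomial (Fin d) ℝ) (r₀ θ₀ : ℝ) (f : ℂ → ℂ)
    (G : (Fin d → ℝ) → ℂ) : Prop :=
  (∀ x, ∀ z ∈ contour r₀ θ₀, Integrable (K4 P z x)) ∧
  (∀ x, ContourIntegrable r₀ θ₀ (C4integrand P f x)) ∧
  Integrable (C4density P r₀ θ₀ f) ∧
  Integrable G ∧
  C4 P r₀ θ₀ f = ∫ x : Fin d → ℝ, G x * ((2 * Real.pi : ℝ) : ℂ) ^ (-(d : ℤ))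

/-- `f^{(k)}(P(x))`. -/
noncomputable def fk {d : ℕ} (P : MvPolynomial (Fin d) ℝ) (f : ℂ → ℂ) (k : ℕ) (x : Fin d → ℝ) : ℂ :=
  iteratedDeriv k f ((MvPolynomial.eval x P : ℝ) : ℂ)

/-- `f(λ) = (λ + t)^{-μ}` (principal branch). -/
noncomputable def powF (t μ : ℝ) : ℂ → ℂ := fun z => (z + (t : ℂ)) ^ (-(μ : ℂ))

/-! ### Classes of polynomials -/

/-- `P(x) = ∑_j α_j x_j^m` with all `α_j > 0`. -/
def IsSumOfPowers {d : ℕ} (P : MvPolynomial (Fin d) ℝ) (m : ℕ) : Prop :=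
  ∃ α : Fin d → ℝ, (∀ j, 0 < α j) ∧
    P = ∑ j, MvPolynomial.C (α j) * MvPolynomial.X j ^ m

/-- `P(x) = ∑_{j,k} α_{j,k} x_j x_k` is a positive definite quadratic form. -/
def IsPosDefQuadratic {d : ℕ} (P : MvPolynomial (Fin d) ℝ) : Prop :=
  ∃ A : Fin d → Fin d → ℝ,
    (∀ x : Fin d → ℝ, x ≠ 0 → 0 < ∑ j, ∑ k, A j k * x j * x k) ∧
    P = ∑ j, ∑ k, MvPolynomial.C (A j k) * MvPolynomial.X j * MvPolynomial.X k

/-- `P` is convex on `ℝ^d`. -/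
def IsConvexPoly {d : ℕ} (P : MvPolynomial (Fin d) ℝ) : Prop :=
  ConvexOn ℝ Set.univ (fun x : Fin d → ℝ => MvPolynomial.eval x P)

/-- `∑_{j<k} ∂_j²∂_k² P ≤ 2 ∑_j ∂_j⁴ P` and `∑_{j≠k} (∂²_{j,k} P)² ≤ 11 π ∑_j (∂_j² P)²` on `ℝ^d`. -/
def DerivInequalities {d : ℕ} (P : MvPolynomial (Fin d) ℝ) : Prop :=
  ∀ x : Fin d → ℝ,
    (∑ j, ∑ k ∈ Finset.univ.filter (fun k => j < k), D22 P j k x) ≤ 2 * ∑ j, D22 P j j x ∧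
    (∑ j, ∑ k ∈ Finset.univ.filter (fun k => j ≠ k), D2 P j k x ^ 2) ≤
      11 * Real.pi * ∑ j, D2 P j j x ^ 2

end QuadraticPencil

namespace QuadraticPencil

open scoped ContDiff

/-! ### Partial derivatives of smooth functions -/

section Smooth

variable {d : ℕ}

/-! Put `V = (P - z)²` and `Q = P(x) - z`. Since `L = |ξ|² + V` splits into a quadratic in `ξ` and a
function of `x`, almost every term of its Moyal products disappears: `{L, b}₂ = Δ_x b / 4 + ∑ ∂_j∂_k
V ∂_{ξ_j}∂_{ξ_k} b / 8`, and `{L, b}₄` keeps only the fourth derivatives of `V` (`moyal_two_symbL`,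
`moyal_four_symbL`). Hence `K_4` is a finite sum of terms "polynomial in `ξ` over a power of `L`",
with coefficients made of derivatives of `V` (`K4_explicit`).

On the contour `Re Q > 0`, so `L` has no zero. Integration by parts in `ξ` reduces every moment to
`I_n(Q) = ∫ (|ξ|² + Q²)^{-n} dξ`. These satisfy `I_{n+1} = (1 - d / 2n) I_n / Q²`, and `I_4(Q) =
Q^{d-8} I_4(1)`. For `d = 5` and `d = 7` all exponents are integers, so `Q ∫ K_4 dξ` is a Laurent
polynomial in `Q` whose coefficients are polynomials in derivatives of `P` (`mul_integral_K4_five`,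
`mul_integral_K4_seven`).

Cauchy's formula `contourInt_inv_pow_mul` turns `Q^{-(k+1)}` into `(-1)^{k+1} f^{(k)}(P(x)) / k!`,
whereas nonnegative powers of `Q` contribute nothing. This gives a density in `x` which is not yet
the one in the statement; the two differ by divergences. As `f^{(k+1)}(P) ∇P = ∇(f^{(k)}(P))`,
integration by parts in `x` (`Setting.fkInt_divergence`) relates the integrals. Ellipticity makes `1
+ P` at least a multiple of `(1 + |x|)^m`, so the assumption on `μ` gives integrability and kills
the boundary terms.

The same relations bring the total to a form whose sign can be read off. Up to a positive constant
it is, for `d = 5`, `∫ f''(P) (ΔP |∇P|² / 480 + D²P∇P·∇P / 240) - ∫ f'(P) (ΔP)² / 60`, and for `d =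
7`, `-∫ f'(P) |∇P|⁴`. For `f(λ) = (λ + t)^{-μ}` one has `f' < 0 < f''` on `[0, ∞)`. Thus the second
expression is positive, and the first one is positive when `P` is convex; sums of powers and
positive quadratic forms are convex. Strictness holds because no `∂_j²P` vanishes identically: `P`
would otherwise be affine along an axis, against its growth. -/

lemma partialD_eq_fderiv {g : (Fin d → ℝ) → ℂ} (hg : ContDiff ℝ ∞ g) (j : Fin d) :
    partialD j g = fun y => fderiv ℝ g y (Pi.single j 1) := by
  funext y
  exact ((hg.differentiable (by simp)) y).lineDeriv_eq_fderiv

lemma contDiff_partialD {g : (Fin d → ℝ) → ℂ} (hg : ContDiff ℝ ∞ g) (j : Fin d) :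
    ContDiff ℝ ∞ (partialD j g) := by
  rw [partialD_eq_fderiv hg]
  exact (hg.fderiv_right (m := ∞) (by simp)).clm_apply contDiff_const

lemma partialD_comm {g : (Fin d → ℝ) → ℂ} (hg : ContDiff ℝ ∞ g) (j k : Fin d) :
    partialD j (partialD k g) = partialD k (partialD j g) := by
  have h1 : Differentiable ℝ (fderiv ℝ g) :=
    (hg.fderiv_right (m := ∞) (by simp)).differentiable (by simp)
  have key : ∀ a b : Fin d, partialD a (partialD b g) =
      fun y => fderiv ℝ (fderiv ℝ g) y (Pi.single a 1) (Pi.single b 1) := by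
    intro a b
    rw [partialD_eq_fderiv (contDiff_partialD hg b), partialD_eq_fderiv hg]
    funext y
    rw [fderiv_clm_apply (h1 y) (differentiableAt_const _)]
    simp
  rw [key, key]
  funext y
  have := (hg.contDiffAt (x := y)).isSymmSndFDerivAt
    (by simp only [minSmoothness_of_isRCLikeNormedField]; exact WithTop.coe_le_coe.2 le_top)
  exact this.eq _ _

lemma contDiff_iterate_partialD {g : (Fin d → ℝ) → ℂ} (hg : ContDiff ℝ ∞ g) (j : Fin d) (n : ℕ) :
    ContDiff ℝ ∞ ((partialD j)^[n] g) := by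
  induction n with
  | zero => exact hg
  | succ n ih => rw [Function.iterate_succ_apply']; exact contDiff_partialD ih j

lemma iterate_partialD_comm {g : (Fin d → ℝ) → ℂ} (hg : ContDiff ℝ ∞ g) (j k : Fin d) (n : ℕ) :
    (partialD j)^[n] (partialD k g) = partialD k ((partialD j)^[n] g) := by
  induction n with
  | zero => rfl
  | succ n ih =>
    rw [Function.iterate_succ_apply', Function.iterate_succ_apply', ih,
      partialD_comm (contDiff_iterate_partialD hg j n)]

/-- The partial derivatives of `multiD` taken along a list of directions. -/
noncomputable def listD (l : List (Fin d)) (α : Fin d → ℕ) (g : (Fin d → ℝ) → ℂ) :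
    (Fin d → ℝ) → ℂ :=
  l.foldr (fun j h => (partialD j)^[α j] h) g

lemma contDiff_listD {g : (Fin d → ℝ) → ℂ} (hg : ContDiff ℝ ∞ g) (l : List (Fin d))
    (α : Fin d → ℕ) : ContDiff ℝ ∞ (listD l α g) := by
  induction l with
  | nil => exact hg
  | cons i l ih => exact contDiff_iterate_partialD ih i _

lemma listD_add_single_of_notMem {g : (Fin d → ℝ) → ℂ} (l : List (Fin d)) (α : Fin d → ℕ)
    {j : Fin d} (hj : j ∉ l) : listD l (α + Pi.single j 1) g = listD l α g := by
  induction l with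
  | nil => rfl
  | cons i l ih =>
    simp only [List.mem_cons, not_or] at hj
    have hi : (α + Pi.single j 1 : Fin d → ℕ) i = α i := by simp [Ne.symm hj.1]
    change (partialD i)^[(α + Pi.single j 1 : Fin d → ℕ) i] (listD l (α + Pi.single j 1) g) =
      (partialD i)^[α i] (listD l α g)
    rw [hi, ih hj.2]

/-- Without repetition in the list, the extra derivative is created at exactly one place, and
partial derivatives of a smooth function commute, so it can be pulled out through the others. -/
lemma listD_add_single {g : (Fin d → ℝ) → ℂ} (hg : ContDiff ℝ ∞ g) (l : List (Fin d))
    (α : Fin d → ℕ) {j : Fin d} (hj : j ∈ l) (hl : l.Nodup) :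
    listD l (α + Pi.single j 1) g = partialD j (listD l α g) := by
  induction l with
  | nil => simp at hj
  | cons i l ih =>
    rw [List.nodup_cons] at hl
    change (partialD i)^[(α + Pi.single j 1 : Fin d → ℕ) i] (listD l (α + Pi.single j 1) g) =
      partialD j ((partialD i)^[α i] (listD l α g))
    by_cases h : j = i
    · subst h
      rw [listD_add_single_of_notMem l α hl.1]
      simp [Function.iterate_succ_apply']
    · have hjl : j ∈ l := by simpa [h] using hj
      have hi : (α + Pi.single j 1 : Fin d → ℕ) i = α i := by simp [Ne.symm h]
      rw [hi, ih hjl hl.2, iterate_partialD_comm (contDiff_listD hg l α)]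

lemma multiD_add_single {g : (Fin d → ℝ) → ℂ} (hg : ContDiff ℝ ∞ g) (α : Fin d → ℕ) (j : Fin d) :
    multiD (α + Pi.single j 1) g = partialD j (multiD α g) :=
  listD_add_single hg _ α (List.mem_finRange j) (List.nodup_finRange d)

@[simp] lemma multiD_zero (g : (Fin d → ℝ) → ℂ) : multiD 0 g = g := by
  unfold multiD
  induction List.finRange d with
  | nil => rfl
  | cons i l ih => simp

lemma multiD_single_add {g : (Fin d → ℝ) → ℂ} (hg : ContDiff ℝ ∞ g) (α : Fin d → ℕ) (j : Fin d) :
    multiD (Pi.single j 1 + α) g = partialD j (multiD α g) := by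
  rw [add_comm, multiD_add_single hg]

lemma multiD_single {g : (Fin d → ℝ) → ℂ} (hg : ContDiff ℝ ∞ g) (j : Fin d) :
    multiD (Pi.single j 1) g = partialD j g := by
  simpa using multiD_add_single hg 0 j

/-- Every `multiD β` sends a constant to some constant; one direction of `α` is split off, and its
derivative, taken last, kills that constant. -/
lemma multiD_const {α : Fin d → ℕ} (hα : α ≠ 0) (c : ℂ) :
    multiD α (fun _ : Fin d → ℝ => c) = 0 := by
  obtain ⟨j, hj⟩ : ∃ j, α j ≠ 0 := by
    by_contra! h
    exact hα (funext h)
  have h1 : α = (α - Pi.single j 1) + Pi.single j 1 := by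
    funext i
    rcases eq_or_ne i j with rfl | h
    · simp; omega
    · simp [h]
  have h2 : ∀ β : Fin d → ℕ, ∃ c' : ℂ, multiD β (fun _ : Fin d → ℝ => c) = fun _ => c' := by
    intro β
    unfold multiD
    induction List.finRange d with
    | nil => exact ⟨c, rfl⟩
    | cons i l ih =>
      obtain ⟨c', hc'⟩ := ih
      rw [List.foldr_cons, hc']
      induction β i with
      | zero => exact ⟨c', rfl⟩
      | succ n ih2 =>
        obtain ⟨c2, h⟩ := ih2
        rw [Function.iterate_succ_apply', h]
        refine ⟨0, ?_⟩
        rw [partialD_eq_fderiv contDiff_const]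
        simp
  obtain ⟨c', hc'⟩ := h2 (α - Pi.single j 1)
  rw [h1, multiD_add_single contDiff_const, hc', partialD_eq_fderiv contDiff_const]
  funext y
  simp

end Smooth

/-! ### Sums over multi-indices -/

section Multi

variable {d : ℕ}

/-- A sum over multi-indices of order `n`, weighted by `1 / β!`, as a linear functional of
`(∑ X_j)^n`. -/
lemma sum_piAntidiag_eq_linear (Φ : (Fin d → ℕ) → ℂ) (n : ℕ) :
    ∑ β ∈ Finset.piAntidiag (Finset.univ : Finset (Fin d)) n,
      (∏ j, ((β j).factorial : ℂ))⁻¹ * Φ β =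
    (n.factorial : ℂ)⁻¹ *
      (MvPolynomial.basisMonomials (Fin d) ℂ).constr ℂ (fun β => Φ β)
        ((∑ j, MvPolynomial.X j) ^ n) := by
  rw [Finset.sum_pow_eq_sum_piAntidiag, map_sum, Finset.mul_sum]
  refine Finset.sum_congr rfl fun β hβ => ?_
  rw [Finset.mem_piAntidiag] at hβ
  have h1 : (∏ j, (MvPolynomial.X j : MvPolynomial (Fin d) ℂ) ^ β j) =
      MvPolynomial.basisMonomials (Fin d) ℂ (Finsupp.equivFunOnFinite.symm β) := by
    rw [MvPolynomial.coe_basisMonomials]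
    beta_reduce
    rw [MvPolynomial.monomial_eq]
    simp [Finsupp.prod_fintype]
  have h2 : (∏ j, ((β j).factorial : ℂ)) * (Nat.multinomial Finset.univ β : ℂ) =
      (n.factorial : ℂ) := by
    have := Nat.multinomial_spec Finset.univ β
    rw [hβ.1] at this
    exact_mod_cast this
  have h3 : (∏ j, ((β j).factorial : ℂ)) ≠ 0 :=
    Finset.prod_ne_zero_iff.2 fun j _ => by exact_mod_cast (β j).factorial_ne_zero
  have h4 : (n.factorial : ℂ) ≠ 0 := by exact_mod_cast n.factorial_ne_zero
  rw [h1, ← nsmul_eq_mul, map_nsmul, Module.Basis.constr_basis, nsmul_eq_mul]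
  simp only [Finsupp.coe_equivFunOnFinite_symm]
  rw [← h2]
  have h5 : (Nat.multinomial Finset.univ β : ℂ) ≠ 0 := by
    intro h; rw [h, mul_zero] at h2; exact h4 h2.symm
  field_simp

lemma constr_prod_X (Φ : (Fin d → ℕ) → ℂ) (β : Fin d →₀ ℕ) :
    (MvPolynomial.basisMonomials (Fin d) ℂ).constr ℂ (fun β => Φ β)
        (MvPolynomial.monomial β 1) = Φ β := by
  have := Module.Basis.constr_basis (MvPolynomial.basisMonomials (Fin d) ℂ) ℂ
    (fun β => Φ β) β
  simpa using this

/-- By the multinomial theorem, weights `1 / β!` on multi-indices amount to weights `1 / n!` on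
ordered tuples of directions. The tuple form needs no case distinction on coinciding indices, and
the explicit computations use it throughout. -/
lemma sum_piAntidiag_two (Φ : (Fin d → ℕ) → ℂ) :
    ∑ β ∈ Finset.piAntidiag (Finset.univ : Finset (Fin d)) 2,
      (∏ j, ((β j).factorial : ℂ))⁻¹ * Φ β =
    (1 / 2) * ∑ j, ∑ k, Φ (Pi.single j 1 + Pi.single k 1) := by
  rw [sum_piAntidiag_eq_linear, pow_two, Finset.sum_mul_sum, map_sum]
  congr 1
  · norm_num
  refine Finset.sum_congr rfl fun j _ => ?_
  rw [map_sum]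
  refine Finset.sum_congr rfl fun k _ => ?_
  rw [MvPolynomial.X, MvPolynomial.X, MvPolynomial.monomial_mul, one_mul, constr_prod_X]
  simp [Finsupp.single_eq_pi_single]

lemma sum_piAntidiag_four (Φ : (Fin d → ℕ) → ℂ) :
    ∑ β ∈ Finset.piAntidiag (Finset.univ : Finset (Fin d)) 4,
      (∏ j, ((β j).factorial : ℂ))⁻¹ * Φ β =
    (1 / 24) * ∑ j, ∑ k, ∑ l, ∑ m,
      Φ (Pi.single j 1 + (Pi.single k 1 + (Pi.single l 1 + Pi.single m 1))) := by
  rw [sum_piAntidiag_eq_linear]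
  have h : (∑ j, (MvPolynomial.X j : MvPolynomial (Fin d) ℂ)) ^ 4 =
      ∑ j, ∑ k, ∑ l, ∑ m, MvPolynomial.X j * (MvPolynomial.X k * (MvPolynomial.X l *
        MvPolynomial.X m)) := by
    simp_rw [← Finset.mul_sum, ← Finset.sum_mul]
    ring
  rw [h]
  simp only [map_sum]
  congr 1
  · norm_num [Nat.factorial]
  refine Finset.sum_congr rfl fun j _ => Finset.sum_congr rfl fun k _ =>
    Finset.sum_congr rfl fun l _ => Finset.sum_congr rfl fun m _ => ?_
  simp only [MvPolynomial.X, MvPolynomial.monomial_mul, one_mul]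
  rw [constr_prod_X]
  simp [Finsupp.single_eq_pi_single]

end Multi

end QuadraticPencil

namespace QuadraticPencil

open scoped ContDiff

/-! ### Rational symbols -/

section Rational

variable {d : ℕ}

/-- A complex polynomial as a function on `ℝ^d`. -/
noncomputable def pe (p : MvPolynomial (Fin d) ℂ) : (Fin d → ℝ) → ℂ :=
  fun y => MvPolynomial.eval (fun j => (y j : ℂ)) p

@[simp] lemma pe_C (c : ℂ) (y : Fin d → ℝ) : pe (MvPolynomial.C c) y = c := by simp [pe]
@[simp] lemma pe_X (j : Fin d) (y : Fin d → ℝ) : pe (MvPolynomial.X j) y = y j := by simp [pe]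
@[simp] lemma pe_zero (y : Fin d → ℝ) : pe (0 : MvPolynomial (Fin d) ℂ) y = 0 := by simp [pe]
@[simp] lemma pe_one (y : Fin d → ℝ) : pe (1 : MvPolynomial (Fin d) ℂ) y = 1 := by simp [pe]
@[simp] lemma pe_ofNat (n : ℕ) [n.AtLeastTwo] (y : Fin d → ℝ) :
    pe (ofNat(n) : MvPolynomial (Fin d) ℂ) y = ofNat(n) := by
  simp [pe]
@[simp] lemma pe_add (p q : MvPolynomial (Fin d) ℂ) (y : Fin d → ℝ) :
    pe (p + q) y = pe p y + pe q y := by simp [pe]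
@[simp] lemma pe_sub (p q : MvPolynomial (Fin d) ℂ) (y : Fin d → ℝ) :
    pe (p - q) y = pe p y - pe q y := by simp [pe]
@[simp] lemma pe_mul (p q : MvPolynomial (Fin d) ℂ) (y : Fin d → ℝ) :
    pe (p * q) y = pe p y * pe q y := by simp [pe]
@[simp] lemma pe_pow (p : MvPolynomial (Fin d) ℂ) (n : ℕ) (y : Fin d → ℝ) :
    pe (p ^ n) y = pe p y ^ n := by simp [pe]
@[simp] lemma pe_sum {ι : Type*} (s : Finset ι) (p : ι → MvPolynomial (Fin d) ℂ)
    (y : Fin d → ℝ) : pe (∑ i ∈ s, p i) y = ∑ i ∈ s, pe (p i) y := by simp [pe]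

lemma contDiff_pe (p : MvPolynomial (Fin d) ℂ) : ContDiff ℝ ∞ (pe p) := by
  induction p using MvPolynomial.induction_on with
  | C a => simpa [funext (pe_C a)] using contDiff_const
  | add p q hp hq => simpa [funext (pe_add p q)] using hp.add hq
  | mul_X p j hp =>
    have hX : ContDiff ℝ ∞ (fun y : Fin d → ℝ => (y j : ℂ)) :=
      Complex.ofRealCLM.contDiff.comp (contDiff_apply ℝ ℝ j)
    simpa [funext (pe_mul p (MvPolynomial.X j))] using hp.mul hX

lemma hasLineDerivAt_pe (p : MvPolynomial (Fin d) ℂ) (j : Fin d) (y : Fin d → ℝ) :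
    HasLineDerivAt ℝ (pe p) (pe (MvPolynomial.pderiv j p) y) y (Pi.single j 1) := by
  unfold HasLineDerivAt
  induction p using MvPolynomial.induction_on with
  | C a => simpa using hasDerivAt_const (0 : ℝ) a
  | add p q hp hq => simpa using hp.fun_add hq
  | mul_X p k hp =>
    have hX : HasDerivAt (fun t : ℝ => ((y + t • Pi.single j (1 : ℝ) : Fin d → ℝ) k : ℂ))
        (pe (MvPolynomial.pderiv j (MvPolynomial.X k)) y) 0 := by
      have h0 : HasDerivAt (fun t : ℝ => y k + t * (Pi.single j (1 : ℝ) : Fin d → ℝ) k)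
          ((Pi.single j (1 : ℝ) : Fin d → ℝ) k) 0 := by
        simpa using ((hasDerivAt_id (0 : ℝ)).mul_const
          ((Pi.single j (1 : ℝ) : Fin d → ℝ) k)).const_add (y k)
      have h1 := h0.ofReal_comp
      simp only [Pi.add_apply, Pi.smul_apply, smul_eq_mul]
      refine h1.congr_deriv ?_
      rcases eq_or_ne j k with rfl | h
      · simp
      · simp [MvPolynomial.pderiv_X_of_ne h.symm, Pi.single_eq_of_ne h.symm]
    have h2 := hp.fun_mul hX
    rw [MvPolynomial.pderiv_mul, pe_add, pe_mul, pe_mul, pe_X]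
    simp only [pe_mul, pe_X]
    simpa only [zero_smul, add_zero] using h2

lemma partialD_pe (p : MvPolynomial (Fin d) ℂ) (j : Fin d) :
    partialD j (pe p) = pe (MvPolynomial.pderiv j p) :=
  funext fun y => (hasLineDerivAt_pe p j y).lineDeriv

lemma partialD_sub {f g : (Fin d → ℝ) → ℂ} (hf : ContDiff ℝ ∞ f) (hg : ContDiff ℝ ∞ g)
    (j : Fin d) : partialD j (fun y => f y - g y) = fun y => partialD j f y - partialD j g y := by
  rw [partialD_eq_fderiv (hf.sub hg), partialD_eq_fderiv hf, partialD_eq_fderiv hg]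
  funext y
  rw [fderiv_fun_sub (hf.differentiable (by simp) y) (hg.differentiable (by simp) y)]
  rfl

lemma partialD_const_mul {f : (Fin d → ℝ) → ℂ} (hf : ContDiff ℝ ∞ f) (c : ℂ)
    (j : Fin d) : partialD j (fun y => c * f y) = fun y => c * partialD j f y := by
  rw [partialD_eq_fderiv (contDiff_const.mul hf), partialD_eq_fderiv hf]
  funext y
  rw [fderiv_const_mul (hf.differentiable (by simp) y)]
  rfl

/-- The rational function `p / D^n`. -/
noncomputable def ratF (p D : MvPolynomial (Fin d) ℂ) (n : ℕ) : (Fin d → ℝ) → ℂ :=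
  fun y => pe p y * (pe D y)⁻¹ ^ n

variable {D : MvPolynomial (Fin d) ℂ}

lemma contDiff_ratF (hD : ∀ y, pe D y ≠ 0) (p : MvPolynomial (Fin d) ℂ) (n : ℕ) :
    ContDiff ℝ ∞ (ratF p D n) :=
  (contDiff_pe p).mul (((contDiff_pe D).inv hD).pow n)

lemma hasLineDerivAt_ratF (hD : ∀ y, pe D y ≠ 0) (p : MvPolynomial (Fin d) ℂ) (n : ℕ) (j : Fin d)
    (y : Fin d → ℝ) :
    HasLineDerivAt ℝ (ratF p D n) (ratF (MvPolynomial.pderiv j p) D n y -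
      n * ratF (p * MvPolynomial.pderiv j D) D (n + 1) y) y (Pi.single j 1) := by
  have h1 : HasDerivAt _ _ _ := hasLineDerivAt_pe p j y
  have h2 : HasDerivAt _ _ _ := hasLineDerivAt_pe D j y
  have h0 : pe D (y + (0 : ℝ) • Pi.single j 1) ≠ 0 := hD _
  have h3 := h1.mul ((h2.inv h0).pow n)
  refine HasDerivAt.congr_deriv h3 ?_
  simp only [zero_smul, add_zero, ratF, pe_mul, Pi.inv_apply, Pi.pow_apply]
  have hy := hD y
  rcases n with _ | n
  · simp
  · simp only [Nat.add_sub_cancel]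
    simp only [div_eq_mul_inv, ← inv_pow]
    push_cast
    ring

lemma partialD_ratF (hD : ∀ y, pe D y ≠ 0) (p : MvPolynomial (Fin d) ℂ) (n : ℕ) (j : Fin d) :
    partialD j (ratF p D n) = fun y => ratF (MvPolynomial.pderiv j p) D n y -
      n * ratF (p * MvPolynomial.pderiv j D) D (n + 1) y :=
  funext fun y => (hasLineDerivAt_ratF hD p n j y).lineDeriv

/-- The quotient rule applied twice. Laplacians and Hessians of `K_0` and `K_2` in either variable
are all contractions of this one formula. -/
lemma partialD_partialD_ratF (hD : ∀ y, pe D y ≠ 0) (p : MvPolynomial (Fin d) ℂ) (n : ℕ)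
    (j k : Fin d) (y : Fin d → ℝ) :
    partialD j (partialD k (ratF p D n)) y =
      pe (MvPolynomial.pderiv j (MvPolynomial.pderiv k p)) y * (pe D y)⁻¹ ^ n -
      n * (pe (MvPolynomial.pderiv k p) y * pe (MvPolynomial.pderiv j D) y +
        pe (MvPolynomial.pderiv j p) y * pe (MvPolynomial.pderiv k D) y +
        pe p y * pe (MvPolynomial.pderiv j (MvPolynomial.pderiv k D)) y) *
          (pe D y)⁻¹ ^ (n + 1) +
      n * (n + 1) * (pe p y * pe (MvPolynomial.pderiv j D) y * pe (MvPolynomial.pderiv k D) y) *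
        (pe D y)⁻¹ ^ (n + 2) := by
  rw [partialD_ratF hD, partialD_sub (contDiff_ratF hD _ _)
    (contDiff_const.mul (contDiff_ratF hD _ _)), partialD_const_mul (contDiff_ratF hD _ _),
    partialD_ratF hD, partialD_ratF hD]
  simp only [ratF, MvPolynomial.pderiv_mul, pe_mul, pe_add]
  push_cast
  ring

end Rational

/-! ### Moyal products with `L` -/

section MoyalL

variable {d : ℕ} (P : MvPolynomial (Fin d) ℝ) (z : ℂ)

/-- The polynomial `P - z`. -/
noncomputable def polyQ : MvPolynomial (Fin d) ℂ :=
  MvPolynomial.map Complex.ofRealHom P - MvPolynomial.C z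

/-- The polynomial `(P - z)²`. -/
noncomputable def polyV : MvPolynomial (Fin d) ℂ := polyQ P z ^ 2

/-- `|ξ|² + w` as a polynomial in `ξ`. -/
noncomputable def polyXi (d : ℕ) (w : ℂ) : MvPolynomial (Fin d) ℂ :=
  ∑ j, MvPolynomial.X j ^ 2 + MvPolynomial.C w

lemma pe_map (x : Fin d → ℝ) :
    pe (MvPolynomial.map Complex.ofRealHom P) x = (MvPolynomial.eval x P : ℝ) := by
  unfold pe
  rw [MvPolynomial.eval_map]
  have := MvPolynomial.eval₂_comp_left Complex.ofRealHom (RingHom.id ℝ) x P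
  simp only [RingHom.comp_id] at this
  exact this.symm

lemma pe_polyQ (x : Fin d → ℝ) : pe (polyQ P z) x = (MvPolynomial.eval x P : ℝ) - z := by
  simp [polyQ, pe_map]

lemma pe_polyV (x : Fin d → ℝ) : pe (polyV P z) x = ((MvPolynomial.eval x P : ℝ) - z) ^ 2 := by
  simp [polyV, pe_polyQ]

lemma pe_polyXi (w : ℂ) (ξ : Fin d → ℝ) : pe (polyXi d w) ξ = ∑ j, (ξ j : ℂ) ^ 2 + w := by
  simp [polyXi]

lemma symbL_eq_xi (x ξ : Fin d → ℝ) : symbL P z x ξ = pe (polyXi d (pe (polyV P z) x)) ξ := by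
  simp [symbL, pe_polyXi, pe_polyV]

lemma symbL_eq_x (x ξ : Fin d → ℝ) :
    symbL P z x ξ = pe (polyV P z + MvPolynomial.C (∑ j, (ξ j : ℂ) ^ 2)) x := by
  simp [symbL, pe_polyV, add_comm]

/-- For fixed `ξ`, `|ξ|²` is a constant in `x` and disappears at the first derivative. -/
lemma multiDx_symbL {β : Fin d → ℕ} (hβ : β ≠ 0) (x ξ : Fin d → ℝ) :
    multiDx β (symbL P z) x ξ = multiD β (pe (polyV P z)) x := by
  obtain ⟨j, hj⟩ : ∃ j, β j ≠ 0 := by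
    by_contra! h
    exact hβ (funext h)
  have h1 : β = (β - Pi.single j 1) + Pi.single j 1 := by
    funext i
    rcases eq_or_ne i j with rfl | h
    · simp; omega
    · simp [h]
  -- One derivative in direction `j` is moved to the innermost place, where it acts on the
  -- polynomial itself and removes the constant.
  have h2 : ∀ (g : (Fin d → ℝ) → ℂ) (α : Fin d → ℕ), ContDiff ℝ ∞ g →
      multiD (α + Pi.single j 1) g = multiD α (partialD j g) := by
    intro g α hg
    rw [multiD_add_single hg]
    unfold multiD
    induction List.finRange d with
    | nil => rfl
    | cons i l ih =>
      rw [List.foldr_cons, List.foldr_cons, ← ih]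
      exact (iterate_partialD_comm (contDiff_listD hg l α) _ _ _).symm
  unfold multiDx
  rw [funext fun y => symbL_eq_x P z y ξ, h1, h2 _ _ (contDiff_pe _), h2 _ _ (contDiff_pe _), partialD_pe, partialD_pe]
  simp

lemma multiDxi_multiDx_symbL {α β : Fin d → ℕ} (hα : α ≠ 0) (hβ : β ≠ 0) (x ξ : Fin d → ℝ) :
    multiDxi α (multiDx β (symbL P z)) x ξ = 0 := by
  unfold multiDxi
  rw [show (multiDx β (symbL P z)) x = fun _ => multiD β (pe (polyV P z)) x from
    funext fun η => multiDx_symbL P z hβ x η, multiD_const hα]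
  rfl

lemma multiDx_zero (b : Symb d) : multiDx 0 b = b := by
  funext x ξ; simp [multiDx]

lemma multiDxi_zero (b : Symb d) : multiDxi 0 b = b := by
  funext x ξ; simp [multiDxi]

lemma multiDxi_symbL (α : Fin d → ℕ) (x ξ : Fin d → ℝ) :
    multiDxi α (symbL P z) x ξ = multiD α (pe (polyXi d (pe (polyV P z) x))) ξ := by
  unfold multiDxi
  rw [funext fun η => symbL_eq_xi P z x η]

lemma pderiv_polyXi (w : ℂ) (j : Fin d) :
    MvPolynomial.pderiv j (polyXi d w) = 2 * MvPolynomial.X j := by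
  classical
  simp [polyXi, MvPolynomial.pderiv_X, Pi.single_apply]

lemma pderiv_pderiv_polyXi (w : ℂ) (j k : Fin d) :
    MvPolynomial.pderiv j (MvPolynomial.pderiv k (polyXi d w)) = if j = k then 2 else 0 := by
  classical
  rw [pderiv_polyXi, show (2 : MvPolynomial (Fin d) ℂ) = MvPolynomial.C 2 from rfl,
    MvPolynomial.pderiv_C_mul, MvPolynomial.pderiv_X]
  rcases eq_or_ne j k with rfl | h
  · simp
  · simp [h]

lemma ne_zero_of_mem_piAntidiag {α : Fin d → ℕ} {n : ℕ} (hn : n ≠ 0)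
    (h : α ∈ Finset.piAntidiag (Finset.univ : Finset (Fin d)) n) : α ≠ 0 := by
  rintro rfl
  rw [Finset.mem_piAntidiag] at h
  exact hn (by simpa using h.1.symm)

variable {b : Symb d}

/-- Mixed `x, ξ` derivatives of `L` vanish, which leaves `α = 0` or `β = 0`. The `ξ`-Hessian of `L`
is twice the identity, so the constants are `1/4 · 1/2 · 2` and `1/4 · 1/2`. -/
lemma moyal_two_symbL (hx : ∀ ξ, ContDiff ℝ ∞ fun y => b y ξ) (hξ : ∀ x, ContDiff ℝ ∞ (b x))
    (x ξ : Fin d → ℝ) :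
    moyal 2 (symbL P z) b x ξ =
      (1 / 4) * ∑ j, partialD j (partialD j fun y => b y ξ) x +
      (1 / 8) * ∑ j, ∑ k,
        pe (MvPolynomial.pderiv j (MvPolynomial.pderiv k (polyV P z))) x *
          partialD j (partialD k (b x)) ξ := by
  have h02 : ∀ β ∈ Finset.piAntidiag (Finset.univ : Finset (Fin d)) 2,
      ((-1 : ℂ) ^ 2 / (2 ^ 2 * (∏ j, (((0 : Fin d → ℕ) j).factorial : ℂ)) *
          (∏ j, ((β j).factorial : ℂ)))) *
        multiDxi 0 (multiDx β (symbL P z)) x ξ * multiDxi β (multiDx 0 b) x ξ =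
      (1 / 4) * ((∏ j, ((β j).factorial : ℂ))⁻¹ *
        (multiD β (pe (polyV P z)) x * multiD β (b x) ξ)) := by
    intro β hβ
    rw [multiDxi_zero, multiDx_zero, multiDx_symbL P z (ne_zero_of_mem_piAntidiag two_ne_zero hβ)]
    simp only [Pi.zero_apply, Nat.factorial_zero, Nat.cast_one, Finset.prod_const_one, multiDxi]
    norm_num [div_eq_mul_inv]
    ring
  have h20 : ∀ α ∈ Finset.piAntidiag (Finset.univ : Finset (Fin d)) 2,
      ((-1 : ℂ) ^ 0 / (2 ^ 2 * (∏ j, ((α j).factorial : ℂ)) *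
          (∏ j, (((0 : Fin d → ℕ) j).factorial : ℂ)))) *
        multiDxi α (multiDx 0 (symbL P z)) x ξ * multiDxi 0 (multiDx α b) x ξ =
      (1 / 4) * ((∏ j, ((α j).factorial : ℂ))⁻¹ *
        (multiD α (pe (polyXi d (pe (polyV P z) x))) ξ * multiD α (fun y => b y ξ) x)) := by
    intro α hα
    rw [multiDxi_zero, multiDx_zero, multiDxi_symbL]
    simp only [Pi.zero_apply, Nat.factorial_zero, Nat.cast_one, Finset.prod_const_one, multiDx]
    norm_num [div_eq_mul_inv]
    ring
  have h11 : ∀ α ∈ Finset.piAntidiag (Finset.univ : Finset (Fin d)) 1,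
      ∀ β ∈ Finset.piAntidiag (Finset.univ : Finset (Fin d)) 1,
      ((-1 : ℂ) ^ 1 / (2 ^ 2 * (∏ j, ((α j).factorial : ℂ)) *
          (∏ j, ((β j).factorial : ℂ)))) *
        multiDxi α (multiDx β (symbL P z)) x ξ * multiDxi β (multiDx α b) x ξ = 0 := by
    intro α hα β hβ
    rw [multiDxi_multiDx_symbL P z (ne_zero_of_mem_piAntidiag one_ne_zero hα)
      (ne_zero_of_mem_piAntidiag one_ne_zero hβ)]
    simp
  unfold moyal
  rw [show Finset.HasAntidiagonal.antidiagonal 2 = {(0, 2), (1, 1), (2, 0)} from rfl,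
    Finset.sum_insert (by simp), Finset.sum_insert (by simp), Finset.sum_singleton]
  simp only [Finset.piAntidiag_zero, Finset.sum_singleton]
  rw [Finset.sum_congr rfl h02, Finset.sum_congr rfl h20,
    Finset.sum_congr rfl fun α hα => Finset.sum_congr rfl (h11 α hα), ← Finset.mul_sum,
    ← Finset.mul_sum, sum_piAntidiag_two
      (fun β => multiD β (pe (polyV P z)) x * multiD β (b x) ξ), sum_piAntidiag_two
      (fun α => multiD α (pe (polyXi d (pe (polyV P z) x))) ξ * multiD α (fun y => b y ξ) x)]
  simp only [multiD_single_add (contDiff_pe _), multiD_single (contDiff_pe _),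
    multiD_single_add (hx ξ), multiD_single (hx ξ), multiD_single_add (hξ x),
    multiD_single (hξ x), partialD_pe, pderiv_pderiv_polyXi, Finset.sum_const_zero]
  have h3 : ∀ j, ∑ k, pe (if j = k then 2 else 0) ξ *
      partialD j (partialD k fun y => b y ξ) x = 2 * partialD j (partialD j fun y => b y ξ) x := by
    intro j
    rw [Finset.sum_eq_single j (fun k _ hk => by simp [hk.symm]) (by simp)]
    simp
  simp only [h3, ← Finset.mul_sum]
  ring

/-- As `L` is quadratic in `ξ`, its fourth `ξ`-derivatives vanish as well, and only `α = 0`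
survives; the constant is `1/16 · 1/24`. -/
lemma moyal_four_symbL (hξ : ∀ x, ContDiff ℝ ∞ (b x))
    (x ξ : Fin d → ℝ) :
    moyal 4 (symbL P z) b x ξ = (1 / 384) * ∑ j, ∑ k, ∑ l, ∑ m,
      pe (MvPolynomial.pderiv j (MvPolynomial.pderiv k (MvPolynomial.pderiv l
        (MvPolynomial.pderiv m (polyV P z))))) x *
          partialD j (partialD k (partialD l (partialD m (b x)))) ξ := by
  have h04 : ∀ β ∈ Finset.piAntidiag (Finset.univ : Finset (Fin d)) 4,
      ((-1 : ℂ) ^ 4 / (2 ^ 4 * (∏ j, (((0 : Fin d → ℕ) j).factorial : ℂ)) *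
          (∏ j, ((β j).factorial : ℂ)))) *
        multiDxi 0 (multiDx β (symbL P z)) x ξ * multiDxi β (multiDx 0 b) x ξ =
      (1 / 16) * ((∏ j, ((β j).factorial : ℂ))⁻¹ *
        (multiD β (pe (polyV P z)) x * multiD β (b x) ξ)) := by
    intro β hβ
    rw [multiDxi_zero, multiDx_zero, multiDx_symbL P z (ne_zero_of_mem_piAntidiag four_ne_zero hβ)]
    simp only [Pi.zero_apply, Nat.factorial_zero, Nat.cast_one, Finset.prod_const_one, multiDxi]
    norm_num [div_eq_mul_inv]
    ring
  have h40 : ∀ α ∈ Finset.piAntidiag (Finset.univ : Finset (Fin d)) 4,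
      ((-1 : ℂ) ^ 0 / (2 ^ 4 * (∏ j, ((α j).factorial : ℂ)) *
          (∏ j, (((0 : Fin d → ℕ) j).factorial : ℂ)))) *
        multiDxi α (multiDx 0 (symbL P z)) x ξ * multiDxi 0 (multiDx α b) x ξ =
      (1 / 16) * ((∏ j, ((α j).factorial : ℂ))⁻¹ *
        (multiD α (pe (polyXi d (pe (polyV P z) x))) ξ * multiD α (fun y => b y ξ) x)) := by
    intro α hα
    rw [multiDxi_zero, multiDx_zero, multiDxi_symbL]
    simp only [Pi.zero_apply, Nat.factorial_zero, Nat.cast_one, Finset.prod_const_one, multiDx]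
    norm_num [div_eq_mul_inv]
    ring
  have hmix : ∀ n k : ℕ, n ≠ 0 → k ≠ 0 →
      ∑ α ∈ Finset.piAntidiag (Finset.univ : Finset (Fin d)) n,
      ∑ β ∈ Finset.piAntidiag (Finset.univ : Finset (Fin d)) k,
      ((-1 : ℂ) ^ k / (2 ^ 4 * (∏ j, ((α j).factorial : ℂ)) *
          (∏ j, ((β j).factorial : ℂ)))) *
        multiDxi α (multiDx β (symbL P z)) x ξ * multiDxi β (multiDx α b) x ξ = 0 := by
    intro n k hn hk
    refine Finset.sum_eq_zero fun α hα => Finset.sum_eq_zero fun β hβ => ?_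
    rw [multiDxi_multiDx_symbL P z (ne_zero_of_mem_piAntidiag hn hα)
      (ne_zero_of_mem_piAntidiag hk hβ)]
    simp
  unfold moyal
  rw [show Finset.HasAntidiagonal.antidiagonal 4 = {(0, 4), (1, 3), (2, 2), (3, 1), (4, 0)}
    from rfl,
    Finset.sum_insert (by simp), Finset.sum_insert (by simp), Finset.sum_insert (by simp),
    Finset.sum_insert (by simp), Finset.sum_singleton, hmix 1 3 (by simp) (by simp),
    hmix 2 2 (by simp) (by simp), hmix 3 1 (by simp) (by simp)]
  simp only [Finset.piAntidiag_zero, Finset.sum_singleton]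
  rw [Finset.sum_congr rfl h04, Finset.sum_congr rfl h40, ← Finset.mul_sum,
    ← Finset.mul_sum, sum_piAntidiag_four
      (fun β => multiD β (pe (polyV P z)) x * multiD β (b x) ξ), sum_piAntidiag_four
      (fun α => multiD α (pe (polyXi d (pe (polyV P z) x))) ξ * multiD α (fun y => b y ξ) x)]
  simp only [multiD_single_add (contDiff_pe _), multiD_single (contDiff_pe _),
    multiD_single_add (hξ x),
    multiD_single (hξ x), partialD_pe, pderiv_pderiv_polyXi]
  have h3 : ∀ j k l m : Fin d, MvPolynomial.pderiv j (MvPolynomial.pderiv k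
      (if l = m then (2 : MvPolynomial (Fin d) ℂ) else 0)) = 0 := by
    intro j k l m
    rw [show (2 : MvPolynomial (Fin d) ℂ) = MvPolynomial.C 2 from rfl]
    split_ifs <;> simp
  simp only [h3, pe_zero, zero_mul, Finset.sum_const_zero]
  ring

end MoyalL

end QuadraticPencil

namespace QuadraticPencil

open scoped ContDiff

/-! ### Explicit symbols -/

section Explicit

variable {d : ℕ}

local notation "∂" => MvPolynomial.pderiv

/-- The commutator of two derivations is a derivation, and this one vanishes on the variables. -/
lemma pderiv_comm {R : Type*} [CommRing R] (p : MvPolynomial (Fin d) R) (j k : Fin d) :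
    ∂ j (∂ k p) = ∂ k (∂ j p) := by
  classical
  have h : (⁅MvPolynomial.pderiv (R := R) j, ∂ k⁆ : Derivation R (MvPolynomial (Fin d) R) (MvPolynomial (Fin d) R)) = 0 := by
    refine MvPolynomial.derivation_ext fun i => ?_
    rw [Derivation.commutator_apply, MvPolynomial.pderiv_X, MvPolynomial.pderiv_X]
    have : ∀ a b : Fin d, (∂ a ((Pi.single b 1 : Fin d → MvPolynomial (Fin d) R) i) :
        MvPolynomial (Fin d) R) = 0 := by
      intro a b
      rcases eq_or_ne i b with rfl | h
      · simp
      · simp [Pi.single_eq_of_ne h]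
    simp [this]
  have h2 := congrArg (fun D => D p) h
  simp only [Derivation.commutator_apply, Derivation.zero_apply] at h2
  exact sub_eq_zero.1 h2

lemma laplacian_ratF {D : MvPolynomial (Fin d) ℂ} (hD : ∀ y, pe D y ≠ 0)
    (p : MvPolynomial (Fin d) ℂ) (n : ℕ) (y : Fin d → ℝ) :
    ∑ j, partialD j (partialD j (ratF p D n)) y =
      (∑ j, pe (∂ j (∂ j p)) y) * (pe D y)⁻¹ ^ n -
      n * (2 * ∑ j, pe (∂ j p) y * pe (∂ j D) y + pe p y * ∑ j, pe (∂ j (∂ j D)) y) *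
        (pe D y)⁻¹ ^ (n + 1) +
      n * (n + 1) * (pe p y * ∑ j, pe (∂ j D) y ^ 2) * (pe D y)⁻¹ ^ (n + 2) := by
  simp only [partialD_partialD_ratF hD, Finset.mul_sum, Finset.sum_mul, ← Finset.sum_add_distrib,
    ← Finset.sum_sub_distrib]
  exact Finset.sum_congr rfl fun j _ => by ring

/-- For `D = |ξ|² + w` one has `∂_j D = 2 ξ_j` and `∂_j∂_k D = 2 δ_{jk}`; the symmetry of `v`
identifies the two cross terms. -/
lemma hessian_ratF_polyXi {w : ℂ} (hD : ∀ y, pe (polyXi d w) y ≠ 0)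
    (p : MvPolynomial (Fin d) ℂ) (n : ℕ) (v : Fin d → Fin d → ℂ) (hv : ∀ j k, v j k = v k j)
    (ξ : Fin d → ℝ) :
    ∑ j, ∑ k, v j k * partialD j (partialD k (ratF p (polyXi d w) n)) ξ =
      (∑ j, ∑ k, v j k * pe (∂ j (∂ k p)) ξ) * (pe (polyXi d w) ξ)⁻¹ ^ n -
      n * (4 * ∑ j, ∑ k, v j k * (pe (∂ j p) ξ * ξ k) + 2 * pe p ξ * ∑ j, v j j) *
        (pe (polyXi d w) ξ)⁻¹ ^ (n + 1) +
      4 * (n * (n + 1)) * (pe p ξ * ∑ j, ∑ k, v j k * (ξ j * ξ k)) *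
        (pe (polyXi d w) ξ)⁻¹ ^ (n + 2) := by
  have h1 : ∑ j, ∑ k, v j k * (pe (∂ k p) ξ * ξ j) = ∑ j, ∑ k, v j k * (pe (∂ j p) ξ * ξ k) := by
    rw [Finset.sum_comm]
    exact Finset.sum_congr rfl fun j _ => Finset.sum_congr rfl fun k _ => by rw [hv k j]
  have h2 : ∑ j, ∑ k, v j k * pe (∂ j (∂ k (polyXi d w))) ξ = 2 * ∑ j, v j j := by
    rw [Finset.mul_sum]
    refine Finset.sum_congr rfl fun j _ => ?_
    rw [Finset.sum_eq_single j (fun k _ hk => by simp [pderiv_pderiv_polyXi, hk.symm]) (by simp)]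
    simp [pderiv_pderiv_polyXi, mul_comm]
  set i := (pe (polyXi d w) ξ)⁻¹
  calc _ = (∑ j, ∑ k, v j k * pe (∂ j (∂ k p)) ξ) * i ^ n -
      n * (2 * ∑ j, ∑ k, v j k * (pe (∂ k p) ξ * ξ j) +
        2 * ∑ j, ∑ k, v j k * (pe (∂ j p) ξ * ξ k) +
        pe p ξ * ∑ j, ∑ k, v j k * pe (∂ j (∂ k (polyXi d w))) ξ) * i ^ (n + 1) +
      4 * (n * (n + 1)) * (pe p ξ * ∑ j, ∑ k, v j k * (ξ j * ξ k)) * i ^ (n + 2) := by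
        simp only [partialD_partialD_ratF hD, Finset.mul_sum, Finset.sum_mul,
          ← Finset.sum_add_distrib, ← Finset.sum_sub_distrib]
        refine Finset.sum_congr rfl fun j _ => Finset.sum_congr rfl fun k _ => ?_
        simp only [pderiv_polyXi, pe_mul, pe_X, pe_ofNat]
        ring
    _ = _ := by rw [h1, h2]; ring

variable (P : MvPolynomial (Fin d) ℝ) (z : ℂ)

/-- `|ξ|² + (P - z)²` as a polynomial in `x`. -/
noncomputable def polyX (ξ : Fin d → ℝ) : MvPolynomial (Fin d) ℂ :=
  polyV P z + MvPolynomial.C (∑ j, (ξ j : ℂ) ^ 2)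

lemma pderiv_polyX (ξ : Fin d → ℝ) (j : Fin d) : ∂ j (polyX P z ξ) = ∂ j (polyV P z) := by
  simp [polyX]

/-- The Laplacian of a polynomial. -/
noncomputable def polyLap {R : Type*} [CommRing R] (p : MvPolynomial (Fin d) R) :
    MvPolynomial (Fin d) R := ∑ j, ∂ j (∂ j p)

/-- The inner product of the gradients of two polynomials. -/
noncomputable def polyGrad {R : Type*} [CommRing R] (p q : MvPolynomial (Fin d) R) :
    MvPolynomial (Fin d) R := ∑ j, ∂ j p * ∂ j q

/-- `∑_{j,k} ∂_j∂_k p ξ_j ξ_k` as a polynomial in `x`. -/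
noncomputable def polyHx (p : MvPolynomial (Fin d) ℂ) (ξ : Fin d → ℝ) : MvPolynomial (Fin d) ℂ :=
  ∑ j, ∑ k, ∂ j (∂ k p) * MvPolynomial.C ((ξ j : ℂ) * ξ k)

/-- `∑_{j,k} v_{j,k} ξ_j ξ_k` as a polynomial in `ξ`. -/
noncomputable def polyHxi (v : Fin d → Fin d → ℂ) : MvPolynomial (Fin d) ℂ :=
  ∑ j, ∑ k, MvPolynomial.C (v j k) * (MvPolynomial.X j * MvPolynomial.X k)

lemma pe_polyHxi (v : Fin d → Fin d → ℂ) (ξ : Fin d → ℝ) :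
    pe (polyHxi v) ξ = ∑ j, ∑ k, v j k * (ξ j * ξ k) := by simp [polyHxi]

lemma pderiv_polyHxi (v : Fin d → Fin d → ℂ) (hv : ∀ j k, v j k = v k j) (l : Fin d) :
    ∂ l (polyHxi v) = ∑ k, MvPolynomial.C (2 * v l k) * MvPolynomial.X k := by
  classical
  have h1 : ∂ l (polyHxi v) = ∑ j, ∑ k, (MvPolynomial.C (v j k) * (MvPolynomial.X j *
      ∂ l (MvPolynomial.X k))) + ∑ j, ∑ k, (MvPolynomial.C (v j k) * (∂ l (MvPolynomial.X j) *
      MvPolynomial.X k)) := by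
    simp only [polyHxi, map_sum, MvPolynomial.pderiv_mul, MvPolynomial.pderiv_C, zero_mul, zero_add,
      ← Finset.sum_add_distrib]
    exact Finset.sum_congr rfl fun j _ => Finset.sum_congr rfl fun k _ => by ring
  have h2 : ∀ k, (∂ l (MvPolynomial.X k) : MvPolynomial (Fin d) ℂ) = if k = l then 1 else 0 := by
    intro k
    rw [MvPolynomial.pderiv_X, Pi.single_apply]
  have h3 : ∑ j, ∑ k, (MvPolynomial.C (v j k) * (MvPolynomial.X j * ∂ l (MvPolynomial.X k))) =
      ∑ k, MvPolynomial.C (v l k) * MvPolynomial.X k := by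
    simp [h2, hv l]
  have h4 : ∑ j, ∑ k, (MvPolynomial.C (v j k) * (∂ l (MvPolynomial.X j) * MvPolynomial.X k)) =
      ∑ k, MvPolynomial.C (v l k) * MvPolynomial.X k := by
    rw [Finset.sum_comm]
    simp [h2]
  rw [h1, h3, h4, ← Finset.sum_add_distrib]
  exact Finset.sum_congr rfl fun k _ => by rw [two_mul, MvPolynomial.C_add]; ring

lemma pderiv_pderiv_polyHxi (v : Fin d → Fin d → ℂ) (hv : ∀ j k, v j k = v k j) (j k : Fin d) :
    ∂ j (∂ k (polyHxi v)) = MvPolynomial.C (2 * v j k) := by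
  classical
  rw [pderiv_polyHxi v hv, map_sum, Finset.sum_eq_single j]
  · rw [MvPolynomial.pderiv_C_mul, MvPolynomial.pderiv_X_self, mul_one, hv]
  · intro b _ hb
    rw [MvPolynomial.pderiv_C_mul, MvPolynomial.pderiv_X_of_ne hb, mul_zero]
  · simp

/-- The Hessian of `(P - z)²`. -/
noncomputable def hessV (x : Fin d → ℝ) (j k : Fin d) : ℂ := pe (∂ j (∂ k (polyV P z))) x

lemma hessV_symm (x : Fin d → ℝ) (j k : Fin d) : hessV P z x j k = hessV P z x k j := by
  rw [hessV, pderiv_comm, hessV]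

variable {P z}

lemma pe_polyX_ne (hL : ∀ x ξ, symbL P z x ξ ≠ 0) (ξ : Fin d → ℝ) :
    ∀ y, pe (polyX P z ξ) y ≠ 0 := by
  intro y; rw [polyX, ← symbL_eq_x]; exact hL y ξ

lemma pe_polyXi_ne (hL : ∀ x ξ, symbL P z x ξ ≠ 0) (x : Fin d → ℝ) :
    ∀ ξ, pe (polyXi d (pe (polyV P z) x)) ξ ≠ 0 := by
  intro ξ; rw [← symbL_eq_xi]; exact hL x ξ

lemma K0_eq_x (ξ : Fin d → ℝ) : (fun y => K0 P z y ξ) = ratF 1 (polyX P z ξ) 1 := by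
  funext y; simp [K0, ratF, symbL_eq_x, polyX]

lemma K0_eq_xi (x : Fin d → ℝ) : K0 P z x = ratF 1 (polyXi d (pe (polyV P z) x)) 1 := by
  funext y; simp [K0, ratF, symbL_eq_xi]

lemma sum_diag_hessV (x : Fin d → ℝ) :
    ∑ j, hessV P z x j j = pe (polyLap (polyV P z)) x := by simp [hessV, polyLap]

/-- Both halves of `{L, K_0}₂` contribute `-ΔV / 4` at order `L^{-2}`. At order `L^{-3}`, the
`x`-Laplacian gives `|∇V|² / 2` and the `ξ`-Hessian gives the quadratic form `D²V ξ·ξ`. -/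
lemma K2_explicit (hL : ∀ x ξ, symbL P z x ξ ≠ 0) (x ξ : Fin d → ℝ) :
    K2 P z x ξ = (1 / 2) * pe (polyLap (polyV P z)) x * (symbL P z x ξ)⁻¹ ^ 3 -
      ((1 / 2) * pe (polyGrad (polyV P z) (polyV P z)) x +
        ∑ j, ∑ k, hessV P z x j k * (ξ j * ξ k)) * (symbL P z x ξ)⁻¹ ^ 4 := by
  rw [K2, moyal_two_symbL]
  rotate_left
  · intro ξ; rw [K0_eq_x]; exact contDiff_ratF (pe_polyX_ne hL ξ) _ _
  · intro x; rw [K0_eq_xi]; exact contDiff_ratF (pe_polyXi_ne hL x) _ _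
  have h2 := hessian_ratF_polyXi (pe_polyXi_ne hL x) 1 1 (hessV P z x) (hessV_symm P z x) ξ
  simp only [hessV] at h2
  rw [K0_eq_x, laplacian_ratF (pe_polyX_ne hL ξ), K0_eq_xi, h2]
  simp only [pderiv_polyX, Derivation.map_one_eq_zero, map_zero, pe_zero, pe_one]
  rw [← symbL_eq_xi, polyX, ← symbL_eq_x, ratF, ← symbL_eq_xi]
  simp only [hessV, polyLap, polyGrad, pe_sum, pe_mul, pe_one, zero_mul, mul_zero,
    Finset.sum_const_zero]
  simp only [← pow_two]
  push_cast
  ring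

/-- `K_2` has to be differentiated in `x` for fixed `ξ` and in `ξ` for fixed `x`. Each time it is a
difference of two functions `p / D^n` in the active variable, to which the quotient formulas apply.
-/
lemma K2_eq_x (hL : ∀ x ξ, symbL P z x ξ ≠ 0) (ξ : Fin d → ℝ) :
    (fun y => K2 P z y ξ) = fun y =>
      ratF (MvPolynomial.C (1 / 2) * polyLap (polyV P z)) (polyX P z ξ) 3 y -
      ratF (MvPolynomial.C (1 / 2) * polyGrad (polyV P z) (polyV P z) + polyHx (polyV P z) ξ)
        (polyX P z ξ) 4 y := by
  funext y
  rw [K2_explicit hL, ratF, ratF, polyX, ← symbL_eq_x]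
  simp [polyHx, hessV]

lemma K2_eq_xi (hL : ∀ x ξ, symbL P z x ξ ≠ 0) (x : Fin d → ℝ) :
    K2 P z x = fun ξ =>
      ratF (MvPolynomial.C ((1 / 2) * pe (polyLap (polyV P z)) x))
        (polyXi d (pe (polyV P z) x)) 3 ξ -
      ratF (MvPolynomial.C ((1 / 2) * pe (polyGrad (polyV P z) (polyV P z)) x) +
        polyHxi (hessV P z x)) (polyXi d (pe (polyV P z) x)) 4 ξ := by
  funext ξ
  rw [K2_explicit hL, ratF, ratF, ← symbL_eq_xi]
  simp [pe_polyHxi]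

end Explicit

end QuadraticPencil

namespace QuadraticPencil

open scoped ContDiff

/-! ### The fourth-order product of `L` with `K_0` -/

section Explicit

variable {d : ℕ} {P : MvPolynomial (Fin d) ℝ} {z : ℂ}

local notation "∂" => MvPolynomial.pderiv

/-- The fourth derivatives of `(P - z)²`. -/
noncomputable def quartV (P : MvPolynomial (Fin d) ℝ) (z : ℂ) (x : Fin d → ℝ)
    (j k l m : Fin d) : ℂ :=
  pe (∂ j (∂ k (∂ l (∂ m (polyV P z))))) x

lemma quartV_swap_left (x : Fin d → ℝ) (j k l m : Fin d) :
    quartV P z x j k l m = quartV P z x k j l m := by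
  rw [quartV, pderiv_comm, quartV]

lemma quartV_swap_mid (x : Fin d → ℝ) (j k l m : Fin d) :
    quartV P z x j k l m = quartV P z x j l k m := by
  rw [quartV, pderiv_comm _ k l, quartV]

lemma quartV_swap_right (x : Fin d → ℝ) (j k l m : Fin d) :
    quartV P z x j k l m = quartV P z x j k m l := by
  rw [quartV, pderiv_comm _ l m, quartV]

lemma sum_pair_comm (f : Fin d → Fin d → Fin d → Fin d → ℂ) :
    ∑ j, ∑ k, ∑ l, ∑ m, f j k l m = ∑ l, ∑ m, ∑ j, ∑ k, f j k l m := by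
  calc _ = ∑ j, ∑ l, ∑ m, ∑ k, f j k l m := by
        refine Finset.sum_congr rfl fun j _ => ?_
        rw [Finset.sum_comm]
        exact Finset.sum_congr rfl fun l _ => Finset.sum_comm
    _ = _ := by
        rw [Finset.sum_comm]
        exact Finset.sum_congr rfl fun l _ => Finset.sum_comm

lemma sum_mul_pderiv_pderiv_X_mul_X (ξ : Fin d → ℝ) (l m : Fin d) (v : Fin d → Fin d → ℂ)
    (hv : ∀ j k, v j k = v k j) :
    ∑ j, ∑ k, v j k * pe (∂ j (∂ k (MvPolynomial.X l * MvPolynomial.X m))) ξ = 2 * v l m := by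
  classical
  have : ∀ j k, pe (∂ j (∂ k (MvPolynomial.X l * MvPolynomial.X m))) ξ =
      (if j = l then if k = m then 1 else 0 else 0) +
      (if j = m then if k = l then 1 else 0 else 0) := by
    intro j k
    simp only [MvPolynomial.pderiv_mul, MvPolynomial.pderiv_X, Pi.single_apply, map_add]
    have e : ∀ a b : Fin d, ∂ j (if a = b then (1 : MvPolynomial (Fin d) ℂ) else 0) = 0 := by
      intro a b; split_ifs <;> simp
    simp only [e, zero_mul, mul_zero, zero_add, add_zero, pe_add, pe_mul]
    simp only [eq_comm]
    split_ifs <;> simp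
  simp only [this, mul_add, Finset.sum_add_distrib, mul_ite, mul_one, mul_zero,
    Finset.sum_ite_irrel, Finset.sum_const_zero, Finset.sum_ite_eq', Finset.mem_univ, if_true]
  rw [hv m l]; ring

lemma sum_mul_pderiv_X_mul_X (ξ : Fin d → ℝ) (l m : Fin d) (v : Fin d → Fin d → ℂ) :
    ∑ j, ∑ k, v j k * (pe (∂ j (MvPolynomial.X l * MvPolynomial.X m)) ξ * ξ k) =
      ∑ k, v l k * (ξ m * ξ k) + ∑ k, v m k * (ξ l * ξ k) := by
  classical
  have : ∀ j, pe (∂ j (MvPolynomial.X l * MvPolynomial.X m)) ξ =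
      (if j = l then (ξ m : ℂ) else 0) + (if j = m then (ξ l : ℂ) else 0) := by
    intro j
    simp only [MvPolynomial.pderiv_mul, MvPolynomial.pderiv_X, Pi.single_apply, pe_add, pe_mul,
      pe_X]
    simp only [eq_comm]
    split_ifs <;> simp
  simp only [this, add_mul, mul_add, Finset.sum_add_distrib, ite_mul, mul_ite, mul_zero,
    zero_mul, Finset.sum_ite_irrel, Finset.sum_const_zero, Finset.sum_ite_eq', Finset.mem_univ,
    if_true]

/-- Differentiating `ξ_l ξ_m / D^n` produces partial traces of `D⁴V` with various index patterns. By
total symmetry they all equal one quadratic form (or one double trace); this lemma and the following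
ones rewrite each pattern in that normal form. -/
lemma sum_quartV_a (x ξ : Fin d → ℝ) : ∑ l, ∑ m, ∑ k, quartV P z x l k l m * (ξ m * ξ k) =
    ∑ j, ∑ k, (∑ l, quartV P z x j k l l) * (ξ j * ξ k) := by
  rw [Finset.sum_comm]
  refine Finset.sum_congr rfl fun m _ => ?_
  rw [Finset.sum_comm]
  refine Finset.sum_congr rfl fun k _ => ?_
  rw [Finset.sum_mul]
  refine Finset.sum_congr rfl fun l _ => ?_
  rw [quartV_swap_left, quartV_swap_right, quartV_swap_mid, quartV_swap_left]

lemma sum_quartV_b (x ξ : Fin d → ℝ) : ∑ l, ∑ m, ∑ k, quartV P z x m k l m * (ξ l * ξ k) =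
    ∑ j, ∑ k, (∑ l, quartV P z x j k l l) * (ξ j * ξ k) := by
  rw [← sum_quartV_a, Finset.sum_comm]
  refine Finset.sum_congr rfl fun m _ => Finset.sum_congr rfl fun l _ =>
    Finset.sum_congr rfl fun k _ => ?_
  rw [quartV_swap_right]

lemma sum_quartV_c (x ξ : Fin d → ℝ) : ∑ l, ∑ m, (∑ j, quartV P z x j j l m) * (ξ l * ξ m) =
    ∑ j, ∑ k, (∑ l, quartV P z x j k l l) * (ξ j * ξ k) := by
  refine Finset.sum_congr rfl fun l _ => Finset.sum_congr rfl fun m _ => ?_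
  rw [Finset.sum_congr rfl fun j _ => ?_]
  rw [quartV_swap_mid x j j l m, quartV_swap_left x j l j m, quartV_swap_right x l j j m,
    quartV_swap_mid x l j m j]

lemma sum_quartV_d (x : Fin d → ℝ) :
    ∑ l, ∑ m, quartV P z x l m l m = ∑ j, ∑ l, quartV P z x j j l l :=
  Finset.sum_congr rfl fun l _ => Finset.sum_congr rfl fun m _ => by rw [quartV_swap_mid]

lemma sum_quartV_e (x : Fin d → ℝ) :
    ∑ l, ∑ j, quartV P z x j j l l = ∑ j, ∑ l, quartV P z x j j l l := Finset.sum_comm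

lemma sum_quartV_f (x ξ : Fin d → ℝ) : ∑ l, ∑ j, ∑ k, quartV P z x j k l l * (ξ j * ξ k) =
    ∑ j, ∑ k, (∑ l, quartV P z x j k l l) * (ξ j * ξ k) := by
  rw [Finset.sum_comm]
  refine Finset.sum_congr rfl fun j _ => ?_
  rw [Finset.sum_comm]
  exact Finset.sum_congr rfl fun k _ => by rw [Finset.sum_mul]

lemma sum_quartV_g (x ξ : Fin d → ℝ) :
    ∑ l, ∑ m, (∑ j, ∑ k, quartV P z x j k l m * (ξ j * ξ k)) * (ξ l * ξ m) =
    ∑ j, ∑ k, ∑ l, ∑ m, quartV P z x j k l m * (ξ j * ξ k * (ξ l * ξ m) : ℂ) := by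
  rw [sum_pair_comm]
  simp only [Finset.sum_mul, mul_assoc]

/-- The four `ξ`-derivatives are taken in two rounds, so that the Hessian formula for `p / D^n`
suffices: the first round is explicit in `l, m`, the second is contracted with `D⁴V` over `j, k`. -/
lemma moyal_four_K0 (hL : ∀ x ξ, symbL P z x ξ ≠ 0) (x ξ : Fin d → ℝ) :
    moyal 4 (symbL P z) (K0 P z) x ξ =
      (1 / 16) * (∑ j, ∑ l, quartV P z x j j l l) * (symbL P z x ξ)⁻¹ ^ 3 -
      (3 / 4) * (∑ j, ∑ k, (∑ l, quartV P z x j k l l) * (ξ j * ξ k)) *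
        (symbL P z x ξ)⁻¹ ^ 4 +
      (∑ j, ∑ k, ∑ l, ∑ m, quartV P z x j k l m * (ξ j * ξ k * (ξ l * ξ m))) *
        (symbL P z x ξ)⁻¹ ^ 5 := by
  classical
  have hD := pe_polyXi_ne hL x
  rw [moyal_four_symbL]
  rotate_left
  · intro x; rw [K0_eq_xi]; exact contDiff_ratF (pe_polyXi_ne hL x) _ _
  set D := polyXi d (pe (polyV P z) x) with hDdef
  have hi : (symbL P z x ξ)⁻¹ = (pe D ξ)⁻¹ := by rw [symbL_eq_xi]
  rw [hi]
  set i := (pe D ξ)⁻¹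
  -- The Hessian of `1 / D` is `-2 δ_{lm} / D² + 8 ξ_l ξ_m / D³`; the second term is written as a
  -- subtraction to match `partialD_sub`.
  have hlm : ∀ l m, partialD l (partialD m (K0 P z x)) = fun η =>
      ratF (MvPolynomial.C (if l = m then -2 else 0)) D 2 η -
      (-8) * ratF (MvPolynomial.X l * MvPolynomial.X m) D 3 η := by
    intro l m
    funext η
    rw [K0_eq_xi, partialD_partialD_ratF hD, hDdef, pderiv_pderiv_polyXi]
    simp only [pderiv_polyXi, ratF, pe_mul, pe_X, pe_C, pe_ofNat, Derivation.map_one_eq_zero,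
      map_zero, pe_zero, pe_one]
    split_ifs <;> simp <;> ring
  have hsub : ∀ l m j k, partialD j (partialD k (partialD l (partialD m (K0 P z x)))) ξ =
      partialD j (partialD k (ratF (MvPolynomial.C (if l = m then -2 else 0)) D 2)) ξ +
      8 * partialD j (partialD k (ratF (MvPolynomial.X l * MvPolynomial.X m) D 3)) ξ := by
    intro l m j k
    have c1 := contDiff_ratF hD (MvPolynomial.C (if l = m then -2 else 0)) 2
    have c2 := contDiff_ratF hD (MvPolynomial.X l * MvPolynomial.X m) 3
    rw [hlm, partialD_sub c1 (contDiff_const.mul c2), partialD_const_mul c2,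
      partialD_sub (contDiff_partialD c1 k) (contDiff_const.mul (contDiff_partialD c2 k)),
      partialD_const_mul (contDiff_partialD c2 k)]
    ring
  have hterm : ∀ l m, ∑ j, ∑ k, quartV P z x j k l m *
      partialD j (partialD k (partialD l (partialD m (K0 P z x)))) ξ =
      (if l = m then 8 * (∑ j, quartV P z x j j l l) * i ^ 3 -
        48 * (∑ j, ∑ k, quartV P z x j k l l * (ξ j * ξ k)) * i ^ 4 else 0) +
      (16 * quartV P z x l m l m * i ^ 3 -
        (96 * ∑ k, quartV P z x l k l m * (ξ m * ξ k) +
          96 * ∑ k, quartV P z x m k l m * (ξ l * ξ k) +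
          48 * (∑ j, quartV P z x j j l m) * (ξ l * ξ m)) * i ^ 4 +
        384 * ((∑ j, ∑ k, quartV P z x j k l m * (ξ j * ξ k)) * (ξ l * ξ m)) * i ^ 5) := by
    intro l m
    have e1 := hessian_ratF_polyXi hD (MvPolynomial.C (if l = m then -2 else 0)) 2
      (fun j k => quartV P z x j k l m) (fun j k => quartV_swap_left x j k l m) ξ
    have e2 := hessian_ratF_polyXi hD (MvPolynomial.X l * MvPolynomial.X m) 3
      (fun j k => quartV P z x j k l m) (fun j k => quartV_swap_left x j k l m) ξ
    rw [sum_mul_pderiv_pderiv_X_mul_X ξ l m _ (fun j k => quartV_swap_left x j k l m),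
      sum_mul_pderiv_X_mul_X] at e2
    simp only [MvPolynomial.pderiv_C, map_zero, pe_zero, mul_zero, zero_mul,
      Finset.sum_const_zero, pe_C, zero_sub, zero_add] at e1
    simp only [hsub, mul_add, Finset.sum_add_distrib]
    rw [e1]
    have e3 : ∑ j, ∑ k, quartV P z x j k l m * (8 * partialD j (partialD k
        (ratF (MvPolynomial.X l * MvPolynomial.X m) D 3)) ξ) = 8 * ∑ j, ∑ k, quartV P z x j k l m *
        partialD j (partialD k (ratF (MvPolynomial.X l * MvPolynomial.X m) D 3)) ξ := by
      simp only [Finset.mul_sum]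
      exact Finset.sum_congr rfl fun j _ => Finset.sum_congr rfl fun k _ => by ring
    rw [e3, e2]
    simp only [pe_mul, pe_X]
    split_ifs with h
    · subst h
      push_cast
      ring
    · push_cast
      ring
  change (1 / 384) * ∑ j, ∑ k, ∑ l, ∑ m, quartV P z x j k l m *
      partialD j (partialD k (partialD l (partialD m (K0 P z x)))) ξ = _
  -- The sum over `j, k` goes inside, where `hterm` evaluates it for fixed `l, m`.
  rw [sum_pair_comm]
  simp only [hterm, Finset.sum_add_distrib, Finset.sum_sub_distrib, Finset.sum_ite_eq,
    Finset.mem_univ, if_true, ← Finset.mul_sum, ← Finset.sum_mul, mul_assoc (48 : ℂ)]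
  rw [sum_quartV_a, sum_quartV_b, sum_quartV_c, sum_quartV_f, sum_quartV_d, sum_quartV_e,
    sum_quartV_g]
  ring

end Explicit

end QuadraticPencil

namespace QuadraticPencil

open scoped ContDiff

/-! ### Second derivatives of `K_2` and the explicit form of `K_4` -/

section Explicit

variable {d : ℕ} {P : MvPolynomial (Fin d) ℝ} {z : ℂ}

local notation "∂" => MvPolynomial.pderiv

lemma partialD_partialD_sub {f g : (Fin d → ℝ) → ℂ} (hf : ContDiff ℝ ∞ f) (hg : ContDiff ℝ ∞ g)
    (j k : Fin d) (y : Fin d → ℝ) : partialD j (partialD k fun y => f y - g y) y =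
      partialD j (partialD k f) y - partialD j (partialD k g) y := by
  rw [partialD_sub hf hg, partialD_sub (contDiff_partialD hf k) (contDiff_partialD hg k)]

lemma pe_polyHx (p : MvPolynomial (Fin d) ℂ) (x ξ : Fin d → ℝ) :
    pe (polyHx p ξ) x = ∑ j, ∑ k, pe (∂ j (∂ k p)) x * (ξ j * ξ k) := by
  simp [polyHx]

lemma pderiv_mul_C' (p : MvPolynomial (Fin d) ℂ) (c : ℂ) (j : Fin d) :
    ∂ j (p * MvPolynomial.C c) = ∂ j p * MvPolynomial.C c := by
  rw [mul_comm, MvPolynomial.pderiv_C_mul, mul_comm]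

lemma pe_polyLap_polyHx (p : MvPolynomial (Fin d) ℂ) (x ξ : Fin d → ℝ) :
    pe (polyLap (polyHx p ξ)) x = ∑ j, ∑ k, pe (polyLap (∂ j (∂ k p))) x * (ξ j * ξ k) := by
  simp only [polyLap, polyHx, map_sum, pderiv_mul_C', pe_sum, pe_mul, pe_C, Finset.sum_mul]
  rw [Finset.sum_comm]
  exact Finset.sum_congr rfl fun j _ => Finset.sum_comm

lemma pe_polyGrad_polyHx (p q : MvPolynomial (Fin d) ℂ) (x ξ : Fin d → ℝ) :
    pe (polyGrad (polyHx p ξ) q) x =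
      ∑ j, ∑ k, pe (polyGrad (∂ j (∂ k p)) q) x * (ξ j * ξ k) := by
  simp only [polyGrad, polyHx, map_sum, pderiv_mul_C', pe_sum, pe_mul, pe_C, Finset.sum_mul]
  rw [Finset.sum_comm]
  refine Finset.sum_congr rfl fun j _ => ?_
  rw [Finset.sum_comm]
  exact Finset.sum_congr rfl fun j _ => Finset.sum_congr rfl fun j _ => by ring

lemma laplacian_K2 (hL : ∀ x ξ, symbL P z x ξ ≠ 0) (x ξ : Fin d → ℝ) :
    ∑ j, partialD j (partialD j fun y => K2 P z y ξ) x =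
      (1 / 2) * pe (polyLap (polyLap (polyV P z))) x * (symbL P z x ξ)⁻¹ ^ 3 -
      (3 * pe (polyGrad (polyLap (polyV P z)) (polyV P z)) x +
        (3 / 2) * pe (polyLap (polyV P z)) x ^ 2 +
        (1 / 2) * pe (polyLap (polyGrad (polyV P z) (polyV P z))) x +
        ∑ j, ∑ k, pe (polyLap (∂ j (∂ k (polyV P z)))) x * (ξ j * ξ k)) *
          (symbL P z x ξ)⁻¹ ^ 4 +
      (8 * (pe (polyLap (polyV P z)) x * pe (polyGrad (polyV P z) (polyV P z)) x) +
        4 * pe (polyGrad (polyGrad (polyV P z) (polyV P z)) (polyV P z)) x +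
        8 * ∑ j, ∑ k, pe (polyGrad (∂ j (∂ k (polyV P z))) (polyV P z)) x * (ξ j * ξ k) +
        4 * pe (polyLap (polyV P z)) x * ∑ j, ∑ k, hessV P z x j k * (ξ j * ξ k)) *
          (symbL P z x ξ)⁻¹ ^ 5 -
      (10 * pe (polyGrad (polyV P z) (polyV P z)) x ^ 2 +
        20 * pe (polyGrad (polyV P z) (polyV P z)) x *
          ∑ j, ∑ k, hessV P z x j k * (ξ j * ξ k)) * (symbL P z x ξ)⁻¹ ^ 6 := by
  have hD := pe_polyX_ne hL ξ
  rw [K2_eq_x hL]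
  simp only [partialD_partialD_sub (contDiff_ratF hD _ _) (contDiff_ratF hD _ _),
    Finset.sum_sub_distrib, laplacian_ratF hD]
  rw [polyX, ← symbL_eq_x]
  have e1 : ∀ p : MvPolynomial (Fin d) ℂ, ∑ j, pe (∂ j (∂ j p)) x = pe (polyLap p) x := by
    intro p; simp [polyLap]
  have e2 : ∀ p q : MvPolynomial (Fin d) ℂ, ∑ j, pe (∂ j p) x * pe (∂ j q) x =
      pe (polyGrad p q) x := by
    intro p q; simp [polyGrad]
  have e3 : ∀ q : MvPolynomial (Fin d) ℂ, ∑ j, pe (∂ j q) x ^ 2 = pe (polyGrad q q) x := by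
    intro q; simp [polyGrad, pow_two]
  have e4 : ∀ (c : ℂ) (p : MvPolynomial (Fin d) ℂ), polyLap (MvPolynomial.C c * p) =
      MvPolynomial.C c * polyLap p := by
    intro c p; simp only [polyLap, MvPolynomial.pderiv_C_mul, Finset.mul_sum]
  have e5 : ∀ (c : ℂ) (p q : MvPolynomial (Fin d) ℂ), polyGrad (MvPolynomial.C c * p) q =
      MvPolynomial.C c * polyGrad p q := by
    intro c p q; simp only [polyGrad, MvPolynomial.pderiv_C_mul, Finset.mul_sum, mul_assoc]
  have e6 : ∀ p q : MvPolynomial (Fin d) ℂ, polyLap (p + q) = polyLap p + polyLap q := by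
    intro p q; simp only [polyLap, map_add, Finset.sum_add_distrib]
  have e7 : ∀ p q r : MvPolynomial (Fin d) ℂ,
      polyGrad (p + q) r = polyGrad p r + polyGrad q r := by
    intro p q r; simp only [polyGrad, map_add, add_mul, Finset.sum_add_distrib]
  simp only [map_add, MvPolynomial.pderiv_C, add_zero]
  simp only [← map_add]
  simp only [e1, e2, e3, e4, e5, e6, e7, pe_add, pe_mul, pe_C, pe_polyLap_polyHx,
    pe_polyGrad_polyHx, pe_polyHx, hessV]
  push_cast
  ring

lemma hessian_K2 (hL : ∀ x ξ, symbL P z x ξ ≠ 0) (x ξ : Fin d → ℝ) :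
    ∑ j, ∑ k, hessV P z x j k * partialD j (partialD k (K2 P z x)) ξ =
      -(3 * pe (polyLap (polyV P z)) x ^ 2 + 2 * ∑ j, ∑ k, hessV P z x j k ^ 2) *
        (symbL P z x ξ)⁻¹ ^ 4 +
      (4 * (pe (polyLap (polyV P z)) x * pe (polyGrad (polyV P z) (polyV P z)) x) +
        32 * pe (polyLap (polyV P z)) x * ∑ j, ∑ k, hessV P z x j k * (ξ j * ξ k) +
        32 * ∑ j, ∑ k, (∑ l, hessV P z x j l * hessV P z x l k) * (ξ j * ξ k)) *
          (symbL P z x ξ)⁻¹ ^ 5 -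
      (40 * pe (polyGrad (polyV P z) (polyV P z)) x *
          ∑ j, ∑ k, hessV P z x j k * (ξ j * ξ k) +
        80 * (∑ j, ∑ k, hessV P z x j k * (ξ j * ξ k)) ^ 2) * (symbL P z x ξ)⁻¹ ^ 6 := by
  have hD := pe_polyXi_ne hL x
  have hs := hessV_symm P z x
  rw [K2_eq_xi hL]
  simp only [partialD_partialD_sub (contDiff_ratF hD _ _) (contDiff_ratF hD _ _),
    Finset.sum_sub_distrib, mul_sub, hessian_ratF_polyXi hD _ _ _ hs, map_add,
    MvPolynomial.pderiv_C, map_zero, zero_add, pe_zero, mul_zero, zero_mul,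
    Finset.sum_const_zero, pderiv_pderiv_polyHxi _ hs, pe_add, pe_C, pe_polyHxi,
    sum_diag_hessV]
  simp only [pderiv_polyHxi _ hs, pe_sum, pe_mul, pe_C, pe_X]
  have e1 : ∑ j, ∑ k, hessV P z x j k * (2 * hessV P z x j k) =
      2 * ∑ j, ∑ k, hessV P z x j k ^ 2 := by
    simp only [Finset.mul_sum]
    exact Finset.sum_congr rfl fun j _ => Finset.sum_congr rfl fun k _ => by ring
  have e2 : ∑ j, ∑ k, hessV P z x j k * ((∑ l, 2 * hessV P z x j l * ξ l) * ξ k) =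
      2 * ∑ j, ∑ k, (∑ l, hessV P z x j l * hessV P z x l k) * (ξ j * ξ k) := by
    simp only [Finset.mul_sum, Finset.sum_mul]
    rw [Finset.sum_comm]
    conv_lhs => enter [2, k]; rw [Finset.sum_comm]
    refine Finset.sum_congr rfl fun j _ => Finset.sum_congr rfl fun k _ =>
      Finset.sum_congr rfl fun l _ => ?_
    rw [hs j l]; ring
  rw [e1, e2, ← symbL_eq_xi]
  push_cast
  ring

/-- The terms are grouped by the power of `L` and by their degree `0`, `2` or `4` in `ξ`, with
coefficients inside the sums, so that each group is one integral of the type computed by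
`integrable_resInt`, `integral_quadratic` or `integral_quartic`. -/
lemma K4_explicit (hL : ∀ x ξ, symbL P z x ξ ≠ 0) (x ξ : Fin d → ℝ) :
    K4 P z x ξ =
      -(3 / 16) * pe (polyLap (polyLap (polyV P z))) x * (symbL P z x ξ)⁻¹ ^ 4 +
      ((3 / 4) * pe (polyGrad (polyLap (polyV P z)) (polyV P z)) x +
        (3 / 4) * pe (polyLap (polyV P z)) x ^ 2 +
        (1 / 8) * pe (polyLap (polyGrad (polyV P z) (polyV P z))) x +
        (1 / 4) * ∑ j, ∑ k, hessV P z x j k ^ 2) * (symbL P z x ξ)⁻¹ ^ 5 +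
      (∑ j, ∑ k, pe (polyLap (∂ j (∂ k (polyV P z)))) x * (ξ j * ξ k)) *
        (symbL P z x ξ)⁻¹ ^ 5 -
      ((5 / 2) * (pe (polyLap (polyV P z)) x * pe (polyGrad (polyV P z) (polyV P z)) x) +
        pe (polyGrad (polyGrad (polyV P z) (polyV P z)) (polyV P z)) x) *
          (symbL P z x ξ)⁻¹ ^ 6 -
      (∑ j, ∑ k, (2 * pe (polyGrad (∂ j (∂ k (polyV P z))) (polyV P z)) x +
          5 * pe (polyLap (polyV P z)) x * hessV P z x j k +
          4 * ∑ l, hessV P z x j l * hessV P z x l k) * (ξ j * ξ k)) *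
        (symbL P z x ξ)⁻¹ ^ 6 -
      (∑ j, ∑ k, ∑ l, ∑ m, quartV P z x j k l m * (ξ j * ξ k * (ξ l * ξ m))) *
        (symbL P z x ξ)⁻¹ ^ 6 +
      (5 / 2) * pe (polyGrad (polyV P z) (polyV P z)) x ^ 2 * (symbL P z x ξ)⁻¹ ^ 7 +
      (∑ j, ∑ k, 10 * pe (polyGrad (polyV P z) (polyV P z)) x * hessV P z x j k *
        (ξ j * ξ k)) * (symbL P z x ξ)⁻¹ ^ 7 +
      (∑ j, ∑ k, ∑ l, ∑ m, 10 * hessV P z x j k * hessV P z x l m *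
        (ξ j * ξ k * (ξ l * ξ m))) * (symbL P z x ξ)⁻¹ ^ 7 := by
  rw [K4, moyal_four_K0 hL, moyal_two_symbL, laplacian_K2 hL]
  rotate_left
  · intro ξ; rw [K2_eq_x hL]
    exact (contDiff_ratF (pe_polyX_ne hL ξ) _ _).sub (contDiff_ratF (pe_polyX_ne hL ξ) _ _)
  · intro x; rw [K2_eq_xi hL]
    exact (contDiff_ratF (pe_polyXi_ne hL x) _ _).sub (contDiff_ratF (pe_polyXi_ne hL x) _ _)
  have h1 := hessian_K2 hL x ξ
  simp only [hessV] at h1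
  rw [h1]
  have e1 : ∑ j, ∑ l, quartV P z x j j l l = pe (polyLap (polyLap (polyV P z))) x := by
    simp [quartV, polyLap]
  have e2 : ∑ j, ∑ k, (∑ l, quartV P z x j k l l) * (ξ j * ξ k) =
      ∑ j, ∑ k, pe (polyLap (∂ j (∂ k (polyV P z)))) x * (ξ j * ξ k) := by
    refine Finset.sum_congr rfl fun j _ => Finset.sum_congr rfl fun k _ => ?_
    rw [polyLap, pe_sum]
    rw [Finset.sum_congr rfl fun l _ => ?_]
    rw [quartV_swap_mid x j k l l, quartV_swap_left x j l k l, quartV_swap_right x l j k l,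
      quartV_swap_mid x l j l k, quartV]
  have e3 : (∑ j, ∑ k, hessV P z x j k * (ξ j * ξ k)) ^ 2 =
      ∑ j, ∑ k, ∑ l, ∑ m, hessV P z x j k * hessV P z x l m * (ξ j * ξ k * (ξ l * ξ m)) := by
    rw [pow_two, Finset.sum_mul]
    refine Finset.sum_congr rfl fun j _ => ?_
    rw [Finset.sum_mul]
    refine Finset.sum_congr rfl fun k _ => ?_
    simp only [Finset.mul_sum]
    exact Finset.sum_congr rfl fun j _ => Finset.sum_congr rfl fun k _ => by ring
  simp only [hessV] at e3
  rw [e1, e2, e3]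
  simp only [K0, hessV, add_mul, mul_assoc, Finset.sum_add_distrib, ← Finset.mul_sum, one_div]
  ring

end Explicit

end QuadraticPencil

namespace QuadraticPencil

open scoped ContDiff

/-! ### Growth of polynomials and integration by parts on `ℝ^d` -/

section Growth

variable {d : ℕ}

lemma norm_pe_le (p : MvPolynomial (Fin d) ℂ) {k : ℕ} (hk : p.totalDegree ≤ k) :
    ∃ C : ℝ, 0 ≤ C ∧ ∀ y : Fin d → ℝ, ‖pe p y‖ ≤ C * (1 + ‖y‖) ^ k := by
  refine ⟨∑ m ∈ p.support, ‖p.coeff m‖, Finset.sum_nonneg fun _ _ => norm_nonneg _, fun y => ?_⟩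
  rw [pe, MvPolynomial.eval_eq', Finset.sum_mul]
  refine (norm_sum_le _ _).trans (Finset.sum_le_sum fun m hm => ?_)
  rw [norm_mul, norm_prod]
  refine mul_le_mul_of_nonneg_left ?_ (norm_nonneg _)
  have h1 : (1 : ℝ) ≤ 1 + ‖y‖ := by linarith [norm_nonneg y]
  calc ∏ i, ‖(y i : ℂ) ^ m i‖ ≤ ∏ i, (1 + ‖y‖) ^ m i := by
        refine Finset.prod_le_prod (fun _ _ => norm_nonneg _) fun i _ => ?_
        rw [norm_pow, Complex.norm_real]
        exact pow_le_pow_left₀ (norm_nonneg _) (by linarith [norm_le_pi_norm y i]) _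
    _ = (1 + ‖y‖) ^ ∑ i, m i := Finset.prod_pow_eq_pow_sum _ _ _
    _ ≤ (1 + ‖y‖) ^ k := by
        refine pow_le_pow_right₀ h1 (le_trans ?_ hk)
        have := MvPolynomial.le_totalDegree hm
        rwa [Finsupp.sum_fintype _ _ (fun _ => rfl)] at this

/-- Fubini with the coordinate `j` integrated first: on almost every line parallel to the `j`-th
axis the integral of `F'` is the difference of the limits of `F`, both zero. Only `F'` has to be
integrable; for `F` a decay of order one is enough. -/
lemma integral_hasLineDerivAt_eq_zero {F F' : (Fin d → ℝ) → ℂ} {j : Fin d}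
    (h : ∀ y, HasLineDerivAt ℝ F (F' y) y (Pi.single j 1)) (hF' : Integrable F')
    {C : ℝ} (hC : ∀ y, ‖F y‖ ≤ C * (1 + ‖y‖)⁻¹) : ∫ y, F' y = 0 := by
  obtain _ | n := d
  · exact j.elim0
  have he := volume_preserving_piFinSuccAbove (fun _ : Fin (n + 1) => ℝ) j
  set e := MeasurableEquiv.piFinSuccAbove (fun _ : Fin (n + 1) => ℝ) j with hedef
  have hint : Integrable (fun q : ℝ × (Fin n → ℝ) => F' (e.symm q)) :=
    (he.symm.integrable_comp_emb e.symm.measurableEmbedding).2 hF'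
  have hee : ∀ t y, e.symm (t, y) = j.insertNth t y := fun t y => rfl
  have h0 : ∫ y, F' y = ∫ q : ℝ × (Fin n → ℝ), F' (e.symm q) :=
    (he.symm.integral_comp' F').symm
  rw [h0]
  rw [Measure.volume_eq_prod] at hint ⊢
  rw [integral_prod_symm _ hint]
  refine integral_eq_zero_of_ae ?_
  filter_upwards [hint.prod_left_ae] with y hy
  have hins : ∀ t u : ℝ, (j.insertNth u y : Fin (n + 1) → ℝ) =
      j.insertNth t y + (u - t) • Pi.single j 1 := by
    intro t u
    funext i
    rcases Fin.eq_self_or_eq_succAbove j i with rfl | ⟨k, rfl⟩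
    · simp
    · simp
  have hd : ∀ t, HasDerivAt (fun u => F (e.symm (u, y))) (F' (e.symm (t, y))) t := by
    intro t
    simp only [hee]
    have h1 : HasDerivAt (fun s : ℝ => F (j.insertNth t y + s • Pi.single j 1))
      (F' (j.insertNth t y)) (t - t) := by rw [sub_self]; exact h _
    have h2 := HasDerivAt.scomp (h := fun u : ℝ => u - t) t h1 ((hasDerivAt_id t).sub_const t)
    rw [one_smul] at h2
    refine h2.congr_of_eventuallyEq (Filter.Eventually.of_forall fun u => ?_)
    simp only [hins t u, Function.comp]
  have hC0 : 0 ≤ C := by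
    have := (norm_nonneg _).trans (hC 0)
    simpa using this
  have hb : ∀ t, ‖F (e.symm (t, y))‖ ≤ C * (1 + |t|)⁻¹ := by
    intro t
    refine (hC _).trans (mul_le_mul_of_nonneg_left ?_ hC0)
    have : |t| ≤ ‖e.symm (t, y)‖ := by
      have := norm_le_pi_norm (e.symm (t, y)) j
      simpa [hee] using this
    gcongr
  have ht : ∀ l : Filter ℝ, Filter.Tendsto (fun t : ℝ => |t|) l Filter.atTop →
      Filter.Tendsto (fun t => F (e.symm (t, y))) l (nhds 0) := by
    intro l hl
    refine squeeze_zero_norm hb ?_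
    have h1 := (Filter.tendsto_atTop_add_const_left l 1 hl).inv_tendsto_atTop
    simpa using h1.const_mul C
  have := integral_of_hasDerivAt_of_tendsto hd hy (ht _ Filter.tendsto_abs_atBot_atTop)
    (ht _ Filter.tendsto_abs_atTop_atTop)
  simpa using this

lemma integrable_of_norm_le {f : (Fin d → ℝ) → ℂ} (hf : Continuous f) {C r : ℝ}
    (hr : (d : ℝ) < r) (h : ∀ y, ‖f y‖ ≤ C * (1 + ‖y‖) ^ (-r)) : Integrable f := by
  refine Integrable.mono' (Integrable.const_mul (integrable_one_add_norm (μ := volume)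
    (E := Fin d → ℝ) (r := r) (by simpa using hr)) C) hf.aestronglyMeasurable
    (Filter.Eventually.of_forall h)

end Growth

/-! ### Integrals over `ξ` -/

section Xi

variable {d : ℕ}

/-- A constant in the lower bound for `|ξ|² + Q²`. -/
noncomputable def resBound (Q : ℂ) : ℝ := 2 * (2 + (1 + 2 * ‖Q‖ ^ 2) / Q.re ^ 2)

/-- Factor `s + Q² = (√s + iQ)(√s - iQ)`: both factors have imaginary part `± Re Q`, so the modulus
is at least `(Re Q)²`. It is also at least `s - |Q|²`, which governs large `s`; the constant
combines the two bounds. -/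
lemma one_add_le_mul_norm {Q : ℂ} (hQ : 0 < Q.re) {s : ℝ} (hs : 0 ≤ s) :
    1 + s ≤ (2 + (1 + 2 * ‖Q‖ ^ 2) / Q.re ^ 2) * ‖(s : ℂ) + Q ^ 2‖ := by
  set N := ‖(s : ℂ) + Q ^ 2‖ with hN
  have hfac : (s : ℂ) + Q ^ 2 = ((√s : ℝ) + Complex.I * Q) * ((√s : ℝ) - Complex.I * Q) := by
    have : ((√s : ℝ) : ℂ) ^ 2 = s := by rw [← Complex.ofReal_pow, Real.sq_sqrt hs]
    linear_combination -this + Q ^ 2 * Complex.I_sq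
  have h1 : Q.re ≤ ‖((√s : ℝ) : ℂ) + Complex.I * Q‖ := by
    refine le_trans ?_ (Complex.abs_im_le_norm _)
    simp [le_abs_self]
  have h2 : Q.re ≤ ‖((√s : ℝ) : ℂ) - Complex.I * Q‖ := by
    refine le_trans ?_ (Complex.abs_im_le_norm _)
    simp [le_abs_self]
  have h3 : Q.re ^ 2 ≤ N := by
    rw [hN, hfac, norm_mul, pow_two]
    exact mul_le_mul h1 h2 hQ.le (norm_nonneg _)
  have h4 : s - ‖Q‖ ^ 2 ≤ N := by
    have := norm_sub_norm_le (s : ℂ) (-(Q ^ 2))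
    rw [norm_neg, norm_pow, Complex.norm_real, Real.norm_of_nonneg hs, sub_neg_eq_add] at this
    exact this
  have hN0 : 0 ≤ N := norm_nonneg _
  have h5 : 1 + 2 * ‖Q‖ ^ 2 ≤ (1 + 2 * ‖Q‖ ^ 2) / Q.re ^ 2 * N := by
    rw [div_mul_eq_mul_div, le_div_iff₀ (by positivity)]
    exact mul_le_mul_of_nonneg_left h3 (by positivity)
  rw [add_mul]
  nlinarith [sq_nonneg ‖Q‖]

lemma norm_sq_le_sum (ξ : Fin d → ℝ) : ‖ξ‖ ^ 2 ≤ ∑ j, ξ j ^ 2 := by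
  have h0 : 0 ≤ ∑ j, ξ j ^ 2 := Finset.sum_nonneg fun _ _ => sq_nonneg _
  have h : ‖ξ‖ ≤ √(∑ j, ξ j ^ 2) := by
    refine (pi_norm_le_iff_of_nonneg (Real.sqrt_nonneg _)).2 fun j => ?_
    rw [Real.norm_eq_abs]
    exact Real.abs_le_sqrt (Finset.single_le_sum (f := fun j => ξ j ^ 2)
      (fun _ _ => sq_nonneg _) (Finset.mem_univ j))
  calc ‖ξ‖ ^ 2 ≤ √(∑ j, ξ j ^ 2) ^ 2 := pow_le_pow_left₀ (norm_nonneg _) h 2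
    _ = _ := Real.sq_sqrt h0

/-- Here `‖ξ‖` is the supremum norm, which is at most the Euclidean one. The factor `2` in
`resBound` accounts for `(1 + ‖ξ‖)² ≤ 2 (1 + ‖ξ‖²)`. -/
lemma norm_inv_polyXi_le {Q : ℂ} (hQ : 0 < Q.re) (ξ : Fin d → ℝ) :
    pe (polyXi d (Q ^ 2)) ξ ≠ 0 ∧
    ‖(pe (polyXi d (Q ^ 2)) ξ)⁻¹‖ ≤ resBound Q * ((1 + ‖ξ‖) ^ 2)⁻¹ := by
  have h0 : 0 ≤ ∑ j, ξ j ^ 2 := Finset.sum_nonneg fun _ _ => sq_nonneg _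
  have h1 := one_add_le_mul_norm hQ h0
  have h2 : pe (polyXi d (Q ^ 2)) ξ = ((∑ j, ξ j ^ 2 : ℝ) : ℂ) + Q ^ 2 := by
    rw [pe_polyXi]; push_cast; rfl
  rw [← h2] at h1
  have h3 := norm_sq_le_sum ξ
  have h4 : (1 + ‖ξ‖) ^ 2 ≤ resBound Q * ‖pe (polyXi d (Q ^ 2)) ξ‖ := by
    rw [resBound, mul_assoc]
    nlinarith [sq_nonneg (1 - ‖ξ‖)]
  have h5 : pe (polyXi d (Q ^ 2)) ξ ≠ 0 := by
    intro h
    rw [h, norm_zero, mul_zero] at h4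
    have : 0 < (1 + ‖ξ‖) ^ 2 := by positivity
    linarith
  refine ⟨h5, ?_⟩
  have h6 : 0 < ‖pe (polyXi d (Q ^ 2)) ξ‖ := norm_pos_iff.2 h5
  rw [norm_inv, ← div_eq_mul_inv, inv_eq_one_div, div_le_div_iff₀ h6 (by positivity)]
  linarith

lemma resBound_nonneg (Q : ℂ) : 0 ≤ resBound Q := by unfold resBound; positivity

lemma norm_ratF_polyXi_le {Q : ℂ} (hQ : 0 < Q.re) (p : MvPolynomial (Fin d) ℂ) {k n r : ℕ}
    (hk : p.totalDegree ≤ k) (hn : k + r ≤ 2 * n) :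
    ∃ C : ℝ, 0 ≤ C ∧ ∀ ξ, ‖ratF p (polyXi d (Q ^ 2)) n ξ‖ ≤ C * ((1 + ‖ξ‖) ^ r)⁻¹ := by
  obtain ⟨C, hC0, hC⟩ := norm_pe_le p hk
  refine ⟨C * resBound Q ^ n, mul_nonneg hC0 (pow_nonneg (resBound_nonneg Q) _), fun ξ => ?_⟩
  have h1 : (1 : ℝ) ≤ 1 + ‖ξ‖ := by linarith [norm_nonneg ξ]
  rw [ratF, norm_mul, norm_pow]
  calc _ ≤ (C * (1 + ‖ξ‖) ^ k) * (resBound Q * ((1 + ‖ξ‖) ^ 2)⁻¹) ^ n :=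
        mul_le_mul (hC ξ) (pow_le_pow_left₀ (norm_nonneg _) (norm_inv_polyXi_le hQ ξ).2 n)
          (by positivity) (by positivity)
    _ = C * resBound Q ^ n * ((1 + ‖ξ‖) ^ k * ((1 + ‖ξ‖) ^ (2 * n))⁻¹) := by
        rw [mul_pow, inv_pow, ← pow_mul]; ring
    _ ≤ _ := by
        refine mul_le_mul_of_nonneg_left ?_
          (mul_nonneg hC0 (pow_nonneg (resBound_nonneg Q) _))
        rw [← div_eq_mul_inv, inv_eq_one_div, div_le_div_iff₀ (by positivity) (by positivity),
          one_mul, ← pow_add]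
        exact pow_le_pow_right₀ h1 hn

lemma integrable_ratF_polyXi {Q : ℂ} (hQ : 0 < Q.re) (p : MvPolynomial (Fin d) ℂ) {k n : ℕ}
    (hk : p.totalDegree ≤ k) (hn : k + d < 2 * n) : Integrable (ratF p (polyXi d (Q ^ 2)) n) := by
  obtain ⟨C, -, hC⟩ := norm_ratF_polyXi_le hQ p (n := n) (r := d + 1) hk (by omega)
  refine integrable_of_norm_le (contDiff_ratF (fun ξ => (norm_inv_polyXi_le hQ ξ).1) p n).continuous
    (C := C) (r := d + 1) (by linarith) fun y => ?_
  rw [Real.rpow_neg (by positivity)]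
  exact_mod_cast hC y

/-- `∫ (|ξ|² + Q²)^{-n} dξ`. -/
noncomputable def resInt (d n : ℕ) (Q : ℂ) : ℂ :=
  ∫ ξ : Fin d → ℝ, (pe (polyXi d (Q ^ 2)) ξ)⁻¹ ^ n

/-- The integral of `∂_j (p / D^n) = ∂_j p / D^n - 2n p ξ_j / D^{n+1}` is zero. The degree
conditions make both terms integrable and `p / D^n` of order `(1 + ‖ξ‖)^{-1}`. -/
lemma integral_X_mul_ratF {Q : ℂ} (hQ : 0 < Q.re) (p : MvPolynomial (Fin d) ℂ) (j : Fin d) {k n : ℕ}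
    (hk : p.totalDegree ≤ k) (hk1 : (MvPolynomial.pderiv j p).totalDegree + d < 2 * n)
    (hk2 : k + d < 2 * n + 1) (hk3 : k + 1 ≤ 2 * n) :
    2 * n * ∫ ξ, ratF (p * MvPolynomial.X j) (polyXi d (Q ^ 2)) (n + 1) ξ =
      ∫ ξ, ratF (MvPolynomial.pderiv j p) (polyXi d (Q ^ 2)) n ξ := by
  have hD : ∀ ξ, pe (polyXi d (Q ^ 2)) ξ ≠ 0 := fun ξ => (norm_inv_polyXi_le hQ ξ).1
  have i1 := integrable_ratF_polyXi hQ (MvPolynomial.pderiv j p) le_rfl hk1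
  have i2 : Integrable (ratF (p * MvPolynomial.X j) (polyXi d (Q ^ 2)) (n + 1)) := by
    refine integrable_ratF_polyXi hQ _ (k := k + 1) ?_ (by omega)
    refine (MvPolynomial.totalDegree_mul _ _).trans ?_
    rw [MvPolynomial.totalDegree_X]
    omega
  obtain ⟨C, -, hC⟩ := norm_ratF_polyXi_le hQ p (r := 1) hk hk3
  have hder : ∀ ξ, HasLineDerivAt ℝ (ratF p (polyXi d (Q ^ 2)) n)
      (ratF (MvPolynomial.pderiv j p) (polyXi d (Q ^ 2)) n ξ -
        (2 * n) * ratF (p * MvPolynomial.X j) (polyXi d (Q ^ 2)) (n + 1) ξ) ξ (Pi.single j 1) := by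
    intro ξ
    have h := hasLineDerivAt_ratF hD p n j ξ
    have e : ratF (p * MvPolynomial.pderiv j (polyXi d (Q ^ 2))) (polyXi d (Q ^ 2)) (n + 1) ξ =
        2 * ratF (p * MvPolynomial.X j) (polyXi d (Q ^ 2)) (n + 1) ξ := by
      simp only [ratF, pderiv_polyXi, pe_mul, pe_ofNat]; ring
    rw [e] at h
    convert h using 2
    ring
  have h0 := integral_hasLineDerivAt_eq_zero hder (i1.sub (i2.const_mul _)) (C := C)
    (by simpa using hC)
  rw [integral_sub i1 (i2.const_mul _), integral_const_mul] at h0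
  exact (sub_eq_zero.1 h0).symm

end Xi

end QuadraticPencil

namespace QuadraticPencil

open scoped ContDiff

/-! ### Moments in `ξ` and the recursion for `I_n(Q)` -/

section Xi

variable {d : ℕ}

lemma totalDegree_pderiv_le {R : Type*} [CommRing R] (p : MvPolynomial (Fin d) R) (j : Fin d) :
    (MvPolynomial.pderiv j p).totalDegree ≤ p.totalDegree - 1 := by
  refine Finset.sup_le fun m hm => ?_
  rw [MvPolynomial.mem_support_iff, MvPolynomial.coeff_pderiv] at hm
  have h1 : m + Finsupp.single j 1 ∈ p.support := by
    rw [MvPolynomial.mem_support_iff]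
    exact left_ne_zero_of_mul hm
  have h2 := MvPolynomial.le_totalDegree h1
  rw [Finsupp.sum_fintype _ _ (fun _ => rfl)] at h2 ⊢
  simp only [Finsupp.add_apply, Finset.sum_add_distrib] at h2
  have h3 : ∑ i, (Finsupp.single j 1 : Fin d →₀ ℕ) i = 1 := by
    simp [Finsupp.single_apply]
  omega

lemma totalDegree_X_mul_X (j k : Fin d) :
    (MvPolynomial.X j * MvPolynomial.X k : MvPolynomial (Fin d) ℂ).totalDegree ≤ 2 := by
  refine (MvPolynomial.totalDegree_mul _ _).trans ?_
  simp [MvPolynomial.totalDegree_X]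

lemma integral_X_mul_X {Q : ℂ} (hQ : 0 < Q.re) {n : ℕ} (hn : d < 2 * n) (j k : Fin d) :
    ∫ ξ, ratF (MvPolynomial.X j * MvPolynomial.X k) (polyXi d (Q ^ 2)) (n + 1) ξ =
      if j = k then resInt d n Q / (2 * n) else 0 := by
  have h := integral_X_mul_ratF hQ (MvPolynomial.X j) k (k := 1) (n := n)
    (by simp [MvPolynomial.totalDegree_X])
    (by
      have := totalDegree_pderiv_le (MvPolynomial.X j : MvPolynomial (Fin d) ℂ) k
      rw [MvPolynomial.totalDegree_X] at this
      omega) (by omega) (by omega)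
  have hn0 : (2 * n : ℂ) ≠ 0 := by
    have : n ≠ 0 := by omega
    exact_mod_cast (by omega : 2 * n ≠ 0)
  rw [← mul_right_inj' hn0, h]
  split_ifs with hjk
  · subst hjk
    rw [mul_div_cancel₀ _ hn0]
    simp [resInt, ratF]
  · simp [MvPolynomial.pderiv_X_of_ne hjk, ratF]

/-- One integration by parts in the variable `ξ_m` turns the fourth moment into three second
moments; the result is the sum over the three pairings of `j, k, l, m`. -/
lemma integral_X_pow_four {Q : ℂ} (hQ : 0 < Q.re) {n : ℕ} (hn : d < 2 * n) (j k l m : Fin d) :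
    ∫ ξ, ratF (MvPolynomial.X j * MvPolynomial.X k * (MvPolynomial.X l * MvPolynomial.X m))
      (polyXi d (Q ^ 2)) (n + 2) ξ =
      ((if j = k then if l = m then 1 else 0 else 0) +
        (if j = l then if k = m then 1 else 0 else 0) +
        (if j = m then if k = l then 1 else 0 else 0)) * (resInt d n Q / (4 * n * (n + 1))) := by
  have hdeg : (MvPolynomial.X j * (MvPolynomial.X k * MvPolynomial.X l) :
      MvPolynomial (Fin d) ℂ).totalDegree ≤ 3 := by
    refine (MvPolynomial.totalDegree_mul _ _).trans ?_
    have := totalDegree_X_mul_X k l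
    rw [MvPolynomial.totalDegree_X]
    omega
  have h := integral_X_mul_ratF hQ (MvPolynomial.X j * (MvPolynomial.X k * MvPolynomial.X l)) m
    (k := 3) (n := n + 1) hdeg
    (by
      have := totalDegree_pderiv_le (MvPolynomial.X j * (MvPolynomial.X k * MvPolynomial.X l) :
        MvPolynomial (Fin d) ℂ) m
      omega) (by omega) (by have := j.pos; omega)
  have hn0 : (2 * (n + 1 : ℕ) : ℂ) ≠ 0 := by
    exact_mod_cast (by omega : 2 * (n + 1) ≠ 0)
  have hn1 : (n : ℂ) ≠ 0 := by
    have : n ≠ 0 := by omega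
    exact_mod_cast this
  have hn2 : (n + 1 : ℂ) ≠ 0 := by exact_mod_cast n.succ_ne_zero
  rw [← mul_right_inj' hn0, show (MvPolynomial.X j * MvPolynomial.X k *
    (MvPolynomial.X l * MvPolynomial.X m) : MvPolynomial (Fin d) ℂ) =
    MvPolynomial.X j * (MvPolynomial.X k * MvPolynomial.X l) * MvPolynomial.X m by ring, h]
  have hi : ∀ a b : Fin d, Integrable
      (ratF (MvPolynomial.X a * MvPolynomial.X b) (polyXi d (Q ^ 2)) (n + 1)) :=
    fun a b => integrable_ratF_polyXi hQ _ (totalDegree_X_mul_X a b) (by omega)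
  have hexp : ∀ ξ, ratF (MvPolynomial.pderiv m (MvPolynomial.X j * (MvPolynomial.X k *
      MvPolynomial.X l))) (polyXi d (Q ^ 2)) (n + 1) ξ =
      (if j = m then 1 else 0) *
        ratF (MvPolynomial.X k * MvPolynomial.X l) (polyXi d (Q ^ 2)) (n + 1) ξ +
      (if k = m then 1 else 0) *
        ratF (MvPolynomial.X j * MvPolynomial.X l) (polyXi d (Q ^ 2)) (n + 1) ξ +
      (if l = m then 1 else 0) *
        ratF (MvPolynomial.X j * MvPolynomial.X k) (polyXi d (Q ^ 2)) (n + 1) ξ := by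
    intro ξ
    have hp : ∀ a, pe (MvPolynomial.pderiv m (MvPolynomial.X a : MvPolynomial (Fin d) ℂ)) ξ =
        if a = m then 1 else 0 := by
      intro a
      split_ifs with h
      · subst h; simp
      · simp [MvPolynomial.pderiv_X_of_ne h]
    simp only [ratF, MvPolynomial.pderiv_mul, pe_add, pe_mul, hp, pe_X]
    ring
  rw [integral_congr_ae (Filter.Eventually.of_forall hexp)]
  rw [integral_add (((hi _ _).const_mul _).fun_add ((hi _ _).const_mul _)) ((hi _ _).const_mul _),
    integral_add ((hi _ _).const_mul _) ((hi _ _).const_mul _), integral_const_mul,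
    integral_const_mul, integral_const_mul, integral_X_mul_X hQ hn, integral_X_mul_X hQ hn,
    integral_X_mul_X hQ hn]
  have e : ∀ (p q : Prop) [Decidable p] [Decidable q] (c : ℂ),
      (if p then (1 : ℂ) else 0) * (if q then c else 0) =
        (if p then if q then 1 else 0 else 0) * c := by
    intro p q _ _ c; split_ifs <;> simp
  rw [e, e, e]
  have e2 : ∀ (p q : Prop) [Decidable p] [Decidable q],
      (if p then if q then (1 : ℂ) else 0 else 0) = if q then if p then 1 else 0 else 0 := by
    intro p q _ _; split_ifs <;> rfl
  rw [e2 (k = m), e2 (l = m)]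
  push_cast
  field_simp
  ring

lemma integral_quadratic {Q : ℂ} (hQ : 0 < Q.re) {n : ℕ} (hn : d < 2 * n)
    (b : Fin d → Fin d → ℂ) :
    Integrable (fun ξ : Fin d → ℝ =>
      (∑ j, ∑ k, b j k * (ξ j * ξ k)) * (pe (polyXi d (Q ^ 2)) ξ)⁻¹ ^ (n + 1)) ∧
    ∫ ξ : Fin d → ℝ, (∑ j, ∑ k, b j k * (ξ j * ξ k)) * (pe (polyXi d (Q ^ 2)) ξ)⁻¹ ^ (n + 1) =
      (∑ j, b j j) * (resInt d n Q / (2 * n)) := by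
  have hi : ∀ j k : Fin d, Integrable (fun ξ => b j k *
      (ratF (MvPolynomial.X j * MvPolynomial.X k) (polyXi d (Q ^ 2)) (n + 1)) ξ) :=
    fun j k => (integrable_ratF_polyXi hQ _ (totalDegree_X_mul_X j k) (by omega)).const_mul _
  have hexp : (fun ξ : Fin d → ℝ =>
      (∑ j, ∑ k, b j k * (ξ j * ξ k)) * (pe (polyXi d (Q ^ 2)) ξ)⁻¹ ^ (n + 1)) =
      fun ξ => ∑ j, ∑ k, b j k *
        ratF (MvPolynomial.X j * MvPolynomial.X k) (polyXi d (Q ^ 2)) (n + 1) ξ := by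
    funext ξ
    simp [ratF, Finset.sum_mul, mul_assoc]
  rw [hexp]
  refine ⟨integrable_finsetSum _ fun j _ => integrable_finsetSum _ fun k _ => hi j k, ?_⟩
  rw [integral_finsetSum _ fun j _ => integrable_finsetSum _ fun k _ => hi j k, Finset.sum_mul]
  refine Finset.sum_congr rfl fun j _ => ?_
  rw [integral_finsetSum _ fun k _ => hi j k]
  simp_rw [integral_const_mul, integral_X_mul_X hQ hn]
  simp

lemma integral_quartic {Q : ℂ} (hQ : 0 < Q.re) {n : ℕ} (hn : d < 2 * n)
    (c : Fin d → Fin d → Fin d → Fin d → ℂ) :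
    Integrable (fun ξ : Fin d → ℝ =>
      (∑ j, ∑ k, ∑ l, ∑ m, c j k l m * (ξ j * ξ k * (ξ l * ξ m))) *
        (pe (polyXi d (Q ^ 2)) ξ)⁻¹ ^ (n + 2)) ∧
    ∫ ξ : Fin d → ℝ, (∑ j, ∑ k, ∑ l, ∑ m, c j k l m * (ξ j * ξ k * (ξ l * ξ m))) *
        (pe (polyXi d (Q ^ 2)) ξ)⁻¹ ^ (n + 2) =
      (∑ j, ∑ l, (c j j l l + c j l j l + c j l l j)) * (resInt d n Q / (4 * n * (n + 1))) := by
  have hi : ∀ j k l m : Fin d, Integrable (fun ξ => c j k l m *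
      (ratF (MvPolynomial.X j * MvPolynomial.X k * (MvPolynomial.X l * MvPolynomial.X m))
        (polyXi d (Q ^ 2)) (n + 2)) ξ) := by
    intro j k l m
    refine (integrable_ratF_polyXi hQ _ (k := 4) ?_ (by omega)).const_mul _
    refine (MvPolynomial.totalDegree_mul _ _).trans ?_
    have h1 := totalDegree_X_mul_X j k
    have h2 := totalDegree_X_mul_X l m
    omega
  have hexp : (fun ξ : Fin d → ℝ =>
      (∑ j, ∑ k, ∑ l, ∑ m, c j k l m * (ξ j * ξ k * (ξ l * ξ m))) *
        (pe (polyXi d (Q ^ 2)) ξ)⁻¹ ^ (n + 2)) =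
      fun ξ => ∑ j, ∑ k, ∑ l, ∑ m, c j k l m *
        ratF (MvPolynomial.X j * MvPolynomial.X k * (MvPolynomial.X l * MvPolynomial.X m))
          (polyXi d (Q ^ 2)) (n + 2) ξ := by
    funext ξ
    simp [ratF, Finset.sum_mul, mul_assoc]
  have i1 := fun j k l => integrable_finsetSum Finset.univ fun m _ => hi j k l m
  have i2 := fun j k => integrable_finsetSum Finset.univ fun l _ => i1 j k l
  have i3 := fun j => integrable_finsetSum Finset.univ fun k _ => i2 j k
  rw [hexp]
  refine ⟨integrable_finsetSum _ fun j _ => i3 j, ?_⟩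
  rw [integral_finsetSum _ fun j _ => i3 j, Finset.sum_mul]
  refine Finset.sum_congr rfl fun j _ => ?_
  rw [integral_finsetSum _ fun k _ => i2 j k]
  simp_rw [fun k => integral_finsetSum Finset.univ fun l (_ : l ∈ Finset.univ) => i1 j k l,
    fun k l => integral_finsetSum Finset.univ fun m (_ : m ∈ Finset.univ) => hi j k l m,
    integral_const_mul, integral_X_pow_four hQ hn]
  simp only [mul_add, add_mul, mul_ite, ite_mul, mul_one, mul_zero, zero_mul, one_mul,
    Finset.sum_add_distrib, Finset.sum_ite_irrel, Finset.sum_const_zero, Finset.sum_ite_eq,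
    Finset.mem_univ, if_true, Finset.sum_mul]

lemma integrable_resInt {Q : ℂ} (hQ : 0 < Q.re) {n : ℕ} (hn : d < 2 * n) :
    Integrable (fun ξ : Fin d → ℝ => (pe (polyXi d (Q ^ 2)) ξ)⁻¹ ^ n) := by
  have := integrable_ratF_polyXi (d := d) hQ 1 (k := 0) (n := n) (by simp) (by omega)
  refine this.congr (Filter.Eventually.of_forall fun ξ => ?_)
  simp [ratF]

/-- Integrate `|ξ|² D^{-(n+1)} = D^{-n} - Q² D^{-(n+1)}`: by the second moments the left side gives
`d / (2n)` times `I_n`. -/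
lemma resInt_succ {Q : ℂ} (hQ : 0 < Q.re) {n : ℕ} (hn : d < 2 * n) :
    resInt d (n + 1) Q = (1 - d / (2 * n)) * resInt d n Q / Q ^ 2 := by
  have hQ0 : Q ≠ 0 := by rintro rfl; simp at hQ
  have h := integral_quadratic hQ hn (fun j k : Fin d => if j = k then 1 else 0)
  have h1 := integrable_resInt hQ hn
  have h2 := integrable_resInt hQ (n := n + 1) (by omega : d < 2 * (n + 1))
  have hexp : (fun ξ : Fin d → ℝ => (∑ j, ∑ k, (if j = k then (1 : ℂ) else 0) * (ξ j * ξ k)) *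
      (pe (polyXi d (Q ^ 2)) ξ)⁻¹ ^ (n + 1)) = fun ξ => (pe (polyXi d (Q ^ 2)) ξ)⁻¹ ^ n -
      Q ^ 2 * (pe (polyXi d (Q ^ 2)) ξ)⁻¹ ^ (n + 1) := by
    funext ξ
    have h0 := (norm_inv_polyXi_le hQ ξ).1
    have e : ∑ j, ∑ k, (if j = k then (1 : ℂ) else 0) * (ξ j * ξ k) =
        pe (polyXi d (Q ^ 2)) ξ - Q ^ 2 := by
      rw [pe_polyXi]; simp [pow_two]
    rw [e, sub_mul, pow_succ' _ n, ← mul_assoc, mul_inv_cancel₀ h0, one_mul]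
  rw [hexp] at h
  have h3 := h.2
  rw [integral_sub h1 (h2.const_mul _), integral_const_mul] at h3
  change resInt d n Q - Q ^ 2 * resInt d (n + 1) Q = _ at h3
  have e2 : ∑ j : Fin d, (if j = j then (1 : ℂ) else 0) = d := by simp
  rw [e2] at h3
  rw [eq_div_iff (pow_ne_zero 2 hQ0)]
  linear_combination -h3

end Xi

end QuadraticPencil

namespace QuadraticPencil

open scoped ContDiff

/-! ### Dependence of `I_4` on `Q` and its value at `Q = 1` -/

section ResInt

variable {d : ℕ}

/-- Differentiation under the integral sign. On the disc of radius `Re Q / 2` real parts stay above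
`Re Q / 2` and moduli below `N`, so `resBound` is at most `K` there and a single integrable majorant
serves the whole disc. -/
lemma hasDerivAt_resInt {Q : ℂ} (hQ : 0 < Q.re) {n : ℕ} (hn : d < 2 * n) :
    HasDerivAt (resInt d n) (-(2 * n * Q) * resInt d (n + 1) Q) Q := by
  set F' : ℂ → (Fin d → ℝ) → ℂ := fun q ξ => -(2 * n * q) * (pe (polyXi d (q ^ 2)) ξ)⁻¹ ^ (n + 1)
  have hre : ∀ q ∈ Metric.ball Q (Q.re / 2), Q.re / 2 < q.re := by
    intro q hq
    have h1 := (Complex.abs_re_le_norm (q - Q)).trans_lt (mem_ball_iff_norm.1 hq)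
    rw [Complex.sub_re] at h1
    linarith [(abs_lt.1 h1).1]
  set N := ‖Q‖ + Q.re / 2
  set K : ℝ := 2 * (2 + (1 + 2 * N ^ 2) / (Q.re / 2) ^ 2)
  have hN : ∀ q ∈ Metric.ball Q (Q.re / 2), ‖q‖ ≤ N := by
    intro q hq
    have h1 := mem_ball_iff_norm.1 hq
    have h2 := norm_add_le (q - Q) Q
    rw [sub_add_cancel] at h2
    simp only [N]; linarith
  have hK : ∀ q ∈ Metric.ball Q (Q.re / 2), resBound q ≤ K := by
    intro q hq
    have h1 := hre q hq
    have h2 := hN q hq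
    simp only [resBound, K]
    gcongr
  have hK0 : 0 ≤ K := by positivity
  have hcont : ∀ q : ℂ, 0 < q.re → ∀ m : ℕ,
      Continuous (fun ξ : Fin d → ℝ => (pe (polyXi d (q ^ 2)) ξ)⁻¹ ^ m) := fun q hq m =>
    ((contDiff_pe _).continuous.inv₀ (fun ξ => (norm_inv_polyXi_le hq ξ).1)).pow m
  have key := hasDerivAt_integral_of_dominated_loc_of_deriv_le (μ := (volume : Measure (Fin d → ℝ)))
    (F := fun q ξ => (pe (polyXi d (q ^ 2)) ξ)⁻¹ ^ n) (F' := F') (x₀ := Q)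
    (s := Metric.ball Q (Q.re / 2))
    (bound := fun ξ => (2 * n * N * K ^ (n + 1)) * (1 + ‖ξ‖) ^ (-(2 * (n + 1) : ℝ)))
    (Metric.ball_mem_nhds Q (by linarith)) ?_ (integrable_resInt hQ hn) ?_ ?_ ?_ ?_
  · have h2 := key.2
    simp only [F', integral_const_mul] at h2
    exact h2
  · filter_upwards [Metric.ball_mem_nhds Q (by linarith : 0 < Q.re / 2)] with q hq
    exact (hcont q (by linarith [hre q hq]) n).aestronglyMeasurable
  · exact (continuous_const.mul (hcont Q hQ (n + 1))).aestronglyMeasurable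
  · refine Filter.Eventually.of_forall fun ξ q hq => ?_
    have hq0 : 0 < q.re := by linarith [hre q hq]
    have h1 := (norm_inv_polyXi_le hq0 ξ).2
    have h2 : ‖(pe (polyXi d (q ^ 2)) ξ)⁻¹‖ ≤ K * ((1 + ‖ξ‖) ^ 2)⁻¹ :=
      h1.trans (mul_le_mul_of_nonneg_right (hK q hq) (by positivity))
    have hpow : (1 + ‖ξ‖) ^ (-(2 * (n + 1) : ℝ)) = (((1 + ‖ξ‖) ^ 2)⁻¹) ^ (n + 1) := by
      rw [Real.rpow_neg (by positivity), inv_pow, ← pow_mul, ← Real.rpow_natCast]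
      push_cast
      rfl
    rw [hpow]
    simp only [F', norm_mul, norm_neg, norm_pow, Complex.norm_natCast, Complex.norm_ofNat]
    calc _ ≤ (2 * n * N) * (K * ((1 + ‖ξ‖) ^ 2)⁻¹) ^ (n + 1) := by
          have := hN q hq
          gcongr
      _ = _ := by rw [mul_pow]; ring
  · refine Integrable.const_mul (integrable_one_add_norm ?_) _
    simp only [Module.finrank_fintype_fun_eq_card, Fintype.card_fin]
    have : (d : ℝ) < 2 * n := by exact_mod_cast hn
    linarith
  · refine Filter.Eventually.of_forall fun ξ q hq => ?_
    have hq0 : 0 < q.re := by linarith [hre q hq]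
    have h0 := (norm_inv_polyXi_le hq0 ξ).1
    have e : ∀ q : ℂ, pe (polyXi d (q ^ 2)) ξ = ∑ j, (ξ j : ℂ) ^ 2 + q ^ 2 :=
      fun q => pe_polyXi _ _
    have h1 : HasDerivAt (fun q : ℂ => pe (polyXi d (q ^ 2)) ξ) (2 * q) q := by
      simp only [e]
      simpa using (hasDerivAt_pow 2 q).const_add (∑ j, (ξ j : ℂ) ^ 2)
    have h2 := (h1.inv h0).pow n
    refine h2.congr_deriv ?_
    simp only [F', Pi.inv_apply]
    rcases n with _ | n
    · simp
    · simp only [Nat.add_sub_cancel, div_eq_mul_inv, ← inv_pow]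
      push_cast
      ring

/-- For real `Q > 0` this would be the substitution `ξ → Qξ`. For complex `Q`, combining `I_4' = -8
Q I_5` with the recursion gives `Q I_4' = -(8 - d) I_4`, so the product has zero derivative on the
half-plane `Re Q > 0`, which is connected. -/
lemma resInt_four {Q : ℂ} (hQ : 0 < Q.re) (hd : d < 8) :
    Q ^ (8 - d) * resInt d 4 Q = resInt d 4 1 := by
  set U : Set ℂ := {q | 0 < q.re}
  have hU : IsOpen U := isOpen_lt continuous_const Complex.continuous_re
  have hconv : Convex ℝ U := convex_halfSpace_re_gt 0
  have hder : ∀ q ∈ U, HasDerivAt (fun q => q ^ (8 - d) * resInt d 4 q) 0 q := by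
    intro q hq
    have hq0 : q ≠ 0 := by rintro rfl; simp [U] at hq
    have h1 := (hasDerivAt_pow (8 - d) q).mul (hasDerivAt_resInt (d := d) (n := 4) hq (by omega))
    refine h1.congr_deriv ?_
    rw [resInt_succ (n := 4) hq (by omega)]
    obtain ⟨e, he⟩ : ∃ e, 8 - d = e + 1 := ⟨7 - d, by omega⟩
    have he2 : (d : ℂ) = 8 - (e + 1) := by
      have : d + (e + 1) = 8 := by omega
      have : (d : ℂ) + (e + 1) = 8 := by exact_mod_cast this
      linear_combination this
    rw [he, he2]
    simp only [Nat.add_sub_cancel]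
    push_cast
    field_simp
    ring
  have h := hU.is_const_of_deriv_eq_zero hconv.isPreconnected
    (fun q hq => (hder q hq).differentiableAt.differentiableWithinAt)
    (fun q hq => (hder q hq).deriv) (x := Q) (y := 1) hQ (by simp [U])
  simpa using h

open Real in
lemma resInt_one_eq (d : ℕ) [NeZero d] :
    resInt d 4 1 = ((d * (√π ^ d / Gamma (d / 2 + 1) *
      ∫ r in Set.Ioi (0 : ℝ), r ^ (d - 1) * ((1 + r ^ 2)⁻¹) ^ 4) : ℝ) : ℂ) := by
  have h1 : ∀ ξ : Fin d → ℝ, (pe (polyXi d (1 ^ 2)) ξ)⁻¹ ^ 4 =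
      (((1 + ‖WithLp.toLp 2 ξ‖ ^ 2)⁻¹ ^ 4 : ℝ) : ℂ) := by
    intro ξ
    rw [EuclideanSpace.norm_sq_eq, pe_polyXi]
    push_cast
    simp [add_comm]
    norm_cast
    simp
  unfold resInt
  rw [integral_congr_ae (Filter.Eventually.of_forall h1), integral_complex_ofReal]
  congr 1
  -- Polar coordinates need the Euclidean norm, so the integral is moved from the product space to
  -- `EuclideanSpace`.
  have h2 := (PiLp.volume_preserving_toLp (Fin d)).integral_comp
    (MeasurableEquiv.toLp 2 (Fin d → ℝ)).measurableEmbedding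
    (fun x : EuclideanSpace ℝ (Fin d) => (1 + ‖x‖ ^ 2)⁻¹ ^ 4)
  rw [h2]
  have h3 := integral_fun_norm_addHaar (volume : Measure (EuclideanSpace ℝ (Fin d)))
    (fun r => (1 + r ^ 2)⁻¹ ^ 4)
  rw [h3]
  have h4 : (0 : ℝ) < Gamma (d / 2 + 1) := Real.Gamma_pos_of_pos (by positivity)
  simp only [finrank_euclideanSpace, Fintype.card_fin, nsmul_eq_mul, smul_eq_mul, Measure.real,
    EuclideanSpace.volume_ball, ENNReal.ofReal_one, one_pow, one_mul]
  rw [ENNReal.toReal_ofReal (by positivity)]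

lemma tendsto_mul_inv_one_add_sq :
    Filter.Tendsto (fun r : ℝ => r * (1 + r ^ 2)⁻¹) Filter.atTop (nhds 0) := by
  refine squeeze_zero' ?_ ?_ tendsto_inv_atTop_zero
  · filter_upwards [Filter.eventually_gt_atTop 0] with r hr
    positivity
  · filter_upwards [Filter.eventually_gt_atTop 0] with r hr
    rw [← div_eq_mul_inv, inv_eq_one_div, div_le_div_iff₀ (by positivity) hr]
    nlinarith

lemma tendsto_inv_one_add_sq :
    Filter.Tendsto (fun r : ℝ => (1 + r ^ 2)⁻¹) Filter.atTop (nhds 0) :=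
  (Filter.tendsto_atTop_add_const_left _ 1 (Filter.tendsto_pow_atTop two_ne_zero)).inv_tendsto_atTop

lemma hasDerivAt_inv_one_add_sq (r : ℝ) :
    HasDerivAt (fun r : ℝ => (1 + r ^ 2)⁻¹) (-(2 * r) * ((1 + r ^ 2)⁻¹) ^ 2) r := by
  have h : (1 + r ^ 2) ≠ 0 := by positivity
  have h1 := (((hasDerivAt_pow 2 r).const_add 1).fun_inv h)
  refine h1.congr_deriv ?_
  simp [div_eq_mul_inv]

open Real in
-- With `v = 1 / (1 + r²)`, the function `a arctan r + r v (b + c v + e v²)` is a primitive of `f`.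
-- Hypothesis `hd` is its derivative as an identity in `r` and `v`, using `v' = -2 r v²`. The
-- algebraic part vanishes at both ends, and only the arctangent contributes.
lemma integral_radial {f : ℝ → ℝ} (a b c e : ℝ)
    (hd : ∀ r v : ℝ, v * (1 + r ^ 2) = 1 → a * v + ((v - 2 * r ^ 2 * v ^ 2) * (b + c * v + e * v ^ 2) +
      r * v * (c * (-(2 * r) * v ^ 2) + e * (2 * v * (-(2 * r) * v ^ 2)))) = f r)
    (hf : ∀ r, 0 ≤ f r) :
    ∫ r in Set.Ioi (0 : ℝ), f r = a * (π / 2) := by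
  set v : ℝ → ℝ := fun r => (1 + r ^ 2)⁻¹ with hv
  have hder : ∀ r, HasDerivAt
      (fun r => a * arctan r + r * v r * (b + c * v r + e * v r ^ 2)) (f r) r := by
    intro r
    have h0 := hasDerivAt_inv_one_add_sq r
    have h1 := ((hasDerivAt_id r).mul h0).mul (((h0.const_mul c).const_add b).add
      ((h0.pow 2).const_mul e))
    have h2 := ((hasDerivAt_arctan r).const_mul a).add h1
    refine h2.congr_deriv ?_
    rw [← hd r (v r) (inv_mul_cancel₀ (by positivity))]
    simp only [hv, id, Pi.mul_apply, Pi.add_apply, Pi.pow_apply]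
    push_cast
    ring
  have hlim : Filter.Tendsto (fun r => a * arctan r + r * v r * (b + c * v r + e * v r ^ 2))
      Filter.atTop (nhds (a * (π / 2) + 0 * (b + c * 0 + e * 0 ^ 2))) :=
    (((tendsto_arctan_atTop.mono_right nhdsWithin_le_nhds).const_mul a)).add
      (tendsto_mul_inv_one_add_sq.mul ((tendsto_inv_one_add_sq.const_mul c |>.const_add b).add
        ((tendsto_inv_one_add_sq.pow 2).const_mul e)))
  have := integral_Ioi_of_hasDerivAt_of_nonneg' (a := 0) (fun x _ => hder x)
    (fun x _ => hf x) hlim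
  rw [this]
  simp

open Real in
lemma resInt_five : resInt 5 4 1 = ((π ^ 3 / 12 : ℝ) : ℂ) := by
  rw [resInt_one_eq]
  congr 1
  -- The coefficients come from `r⁴ v⁴ = v² - 2v³ + v⁴` and the reduction `∫ v^{n+1} = r v^n / (2n)
  -- + (2n - 1) / (2n) ∫ v^n`. The sphere factor uses `Γ(7/2) = 15√π / 8`.
  rw [integral_radial (1 / 16) (3 / 48) (-14 / 48) (8 / 48)]
  · have h := Real.Gamma_nat_add_half 3
    have e : ((5 : ℕ) : ℝ) / 2 + 1 = (3 : ℕ) + 1 / 2 := by norm_num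
    rw [e, h]
    have hpi : √π ^ 2 = π := Real.sq_sqrt Real.pi_pos.le
    have hs : √π ≠ 0 := by positivity
    have h5 : √π ^ 5 = π ^ 2 * √π := by
      calc √π ^ 5 = (√π ^ 2) ^ 2 * √π := by ring
        _ = _ := by rw [hpi]
    rw [h5]
    norm_num [Nat.doubleFactorial]
    field_simp
    norm_num
  · intro r v h
    obtain rfl : v = (1 + r ^ 2)⁻¹ := eq_inv_of_mul_eq_one_left h
    field_simp
    ring
  · intro r
    simp only [Nat.reduceSub]
    positivity

open Real in
lemma resInt_seven : resInt 7 4 1 = ((π ^ 4 / 6 : ℝ) : ℂ) := by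
  rw [resInt_one_eq]
  congr 1
  -- The same reduction applied to `r⁶ v⁴ = v - 3v² + 3v³ - v⁴`.
  rw [integral_radial (5 / 16) (-33 / 48) (26 / 48) (-8 / 48)]
  · have h := Real.Gamma_nat_add_half 4
    have e : ((7 : ℕ) : ℝ) / 2 + 1 = (4 : ℕ) + 1 / 2 := by norm_num
    rw [e, h]
    have hpi : √π ^ 2 = π := Real.sq_sqrt Real.pi_pos.le
    have hs : √π ≠ 0 := by positivity
    have h5 : √π ^ 7 = π ^ 3 * √π := by
      calc √π ^ 7 = (√π ^ 2) ^ 3 * √π := by ring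
        _ = _ := by rw [hpi]
    rw [h5]
    norm_num [Nat.doubleFactorial]
    field_simp
    norm_num
  · intro r v h
    obtain rfl : v = (1 + r ^ 2)⁻¹ := eq_inv_of_mul_eq_one_left h
    field_simp
    ring
  · intro r
    simp only [Nat.reduceSub]
    positivity

end ResInt

end QuadraticPencil

namespace QuadraticPencil

open scoped ContDiff

section IntK4

variable {d : ℕ}

local notation "∂" => MvPolynomial.pderiv

/-! ### Laplacians and gradients of polynomials -/

section PolyIdentities

variable {R : Type*} [CommRing R] (p q r : MvPolynomial (Fin d) R)

/-- The squared norm of the Hessian of a polynomial. -/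
noncomputable def polyHessSq : MvPolynomial (Fin d) R := ∑ j, ∑ k, ∂ j (∂ k p) ^ 2

/-- `D²p ∇p · ∇p`. -/
noncomputable def polyHessGrad : MvPolynomial (Fin d) R := ∑ j, ∑ k, ∂ j (∂ k p) * ∂ j p * ∂ k p

lemma polyGrad_comm : polyGrad p q = polyGrad q p :=
  Finset.sum_congr rfl fun _ _ => mul_comm _ _

lemma polyGrad_add_left : polyGrad (p + q) r = polyGrad p r + polyGrad q r := by
  simp only [polyGrad, map_add, add_mul, Finset.sum_add_distrib]

lemma polyGrad_mul_left : polyGrad (p * q) r = p * polyGrad q r + q * polyGrad p r := by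
  simp only [polyGrad, MvPolynomial.pderiv_mul, Finset.mul_sum, ← Finset.sum_add_distrib]
  exact Finset.sum_congr rfl fun _ _ => by ring

lemma polyGrad_mul_right : polyGrad r (p * q) = p * polyGrad r q + q * polyGrad r p := by
  rw [polyGrad_comm, polyGrad_mul_left, polyGrad_comm q, polyGrad_comm p]

lemma polyLap_add : polyLap (p + q) = polyLap p + polyLap q := by
  simp only [polyLap, map_add, Finset.sum_add_distrib]

lemma polyLap_mul : polyLap (p * q) = p * polyLap q + q * polyLap p + 2 * polyGrad p q := by
  simp only [polyLap, polyGrad, MvPolynomial.pderiv_mul, map_add, Finset.mul_sum,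
    ← Finset.sum_add_distrib]
  exact Finset.sum_congr rfl fun _ _ => by ring

/-- Bochner's identity in flat space. -/
lemma polyLap_polyGrad_self :
    polyLap (polyGrad p p) = 2 * polyHessSq p + 2 * polyGrad (polyLap p) p := by
  have h : ∀ k, polyLap (∂ k p) = ∂ k (polyLap p) := by
    intro k
    simp only [polyLap, map_sum]
    refine Finset.sum_congr rfl fun j _ => ?_
    rw [pderiv_comm p j k, pderiv_comm _ j k]
  have h1 : polyLap (polyGrad p p) = ∑ k, polyLap (∂ k p * ∂ k p) := by
    simp only [polyLap, polyGrad, map_sum]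
    exact Finset.sum_comm
  have h2 : ∑ k, (∂ k p * ∂ k (polyLap p) + ∂ k p * ∂ k (polyLap p)) =
      2 * polyGrad (polyLap p) p := by
    rw [polyGrad, Finset.mul_sum]
    exact Finset.sum_congr rfl fun j _ => by ring
  have h3 : ∑ k, 2 * polyGrad (∂ k p) (∂ k p) = 2 * polyHessSq p := by
    rw [polyHessSq, Finset.mul_sum]
    refine Finset.sum_congr rfl fun j _ => ?_
    rw [polyGrad, Finset.sum_congr rfl fun k _ => ?_]
    rw [pderiv_comm p j k, pow_two]
  rw [h1]
  simp only [polyLap_mul, h]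
  rw [Finset.sum_add_distrib, h2, h3, add_comm]

lemma polyGrad_polyGrad_self : polyGrad (polyGrad p p) p = 2 * polyHessGrad p := by
  simp only [polyGrad, polyHessGrad, map_sum, MvPolynomial.pderiv_mul, Finset.mul_sum,
    Finset.sum_mul]
  exact Finset.sum_congr rfl fun j _ => Finset.sum_congr rfl fun k _ => by ring

/-- The Hessian of `p²` is `2p D²p + 2 ∇p ⊗ ∇p`. -/
lemma polyHessSq_sq : polyHessSq (p ^ 2) =
    4 * p ^ 2 * polyHessSq p + 8 * p * polyHessGrad p + 4 * polyGrad p p ^ 2 := by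
  have h : polyGrad p p ^ 2 = ∑ j, ∑ k, ∂ j p ^ 2 * ∂ k p ^ 2 := by
    rw [pow_two, polyGrad, Finset.sum_mul_sum]
    exact Finset.sum_congr rfl fun j _ => Finset.sum_congr rfl fun k _ => by ring
  rw [h]
  simp only [polyHessSq, polyHessGrad, pow_two p, MvPolynomial.pderiv_mul, map_add, Finset.mul_sum,
    ← Finset.sum_add_distrib]
  exact Finset.sum_congr rfl fun j _ => Finset.sum_congr rfl fun k _ => by ring

end PolyIdentities

variable {P : MvPolynomial (Fin d) ℝ} {z : ℂ}

lemma integrable_fun_sub {α : Type*} [MeasurableSpace α] {μ : Measure α} {f g : α → ℂ}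
    (hf : Integrable f μ) (hg : Integrable g μ) : Integrable (fun a => f a - g a) μ :=
  hf.sub hg

/-- A term of degree `2s` in `ξ` over `L^{n+s}` integrates to a multiple of `I_n`, so only `I_4, …,
I_7` occur. The contractions are traces of symmetric tensors, hence Laplacians, gradient products
and `|D²V|²`; Bochner's identity eliminates `Δ|∇V|²`. -/
lemma integral_K4 (hL : ∀ x ξ, symbL P z x ξ ≠ 0) (hd : d < 8) (x : Fin d → ℝ) {Q : ℂ}
    (hQ : 0 < Q.re) (hQx : pe (polyV P z) x = Q ^ 2) :
    Integrable (K4 P z x) ∧ ∫ ξ, K4 P z x ξ =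
      -(1 / 10) * pe (polyLap (polyLap (polyV P z))) x * resInt d 4 Q +
      ((4 / 5) * pe (polyGrad (polyLap (polyV P z)) (polyV P z)) x +
        (1 / 3) * pe (polyLap (polyV P z)) x ^ 2 +
        (4 / 15) * pe (polyHessSq (polyV P z)) x) * resInt d 5 Q -
      ((5 / 3) * (pe (polyLap (polyV P z)) x * pe (polyGrad (polyV P z) (polyV P z)) x) +
        pe (polyGrad (polyGrad (polyV P z) (polyV P z)) (polyV P z)) x) * resInt d 6 Q +
      (5 / 2) * pe (polyGrad (polyV P z) (polyV P z)) x ^ 2 * resInt d 7 Q := by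
  have h4 := integrable_resInt (d := d) (n := 4) hQ (by omega)
  have h5 := integrable_resInt (d := d) (n := 5) hQ (by omega)
  have h6 := integrable_resInt (d := d) (n := 6) hQ (by omega)
  have h7 := integrable_resInt (d := d) (n := 7) hQ (by omega)
  have b1 := integral_quadratic hQ (n := 4) (by omega : d < 2 * 4)
    (fun j k => pe (polyLap (∂ j (∂ k (polyV P z)))) x)
  have b2 := integral_quadratic hQ (n := 5) (by omega : d < 2 * 5)
    (fun j k => 2 * pe (polyGrad (∂ j (∂ k (polyV P z))) (polyV P z)) x +
          5 * pe (polyLap (polyV P z)) x * hessV P z x j k +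
          4 * ∑ l, hessV P z x j l * hessV P z x l k)
  have b3 := integral_quadratic hQ (n := 6) (by omega : d < 2 * 6)
    (fun j k => 10 * pe (polyGrad (polyV P z) (polyV P z)) x * hessV P z x j k)
  have c1 := integral_quartic hQ (n := 4) (by omega : d < 2 * 4) (quartV P z x)
  have c2 := integral_quartic hQ (n := 5) (by omega : d < 2 * 5)
    (fun j k l m => 10 * hessV P z x j k * hessV P z x l m)
  have hK : K4 P z x = _ := funext fun ξ => K4_explicit hL x ξ
  simp only [symbL_eq_xi, hQx] at hK
  set i : (Fin d → ℝ) → ℂ := fun ξ => (pe (polyXi d (Q ^ 2)) ξ)⁻¹ with hi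
  have t1 := (h4.const_mul (-(3 / 16) * pe (polyLap (polyLap (polyV P z))) x))
  have t2 := h5.const_mul ((3 / 4) * pe (polyGrad (polyLap (polyV P z)) (polyV P z)) x +
        (3 / 4) * pe (polyLap (polyV P z)) x ^ 2 +
        (1 / 8) * pe (polyLap (polyGrad (polyV P z) (polyV P z))) x +
        (1 / 4) * ∑ j, ∑ k, hessV P z x j k ^ 2)
  have t3 := b1.1
  have t4 := h6.const_mul ((5 / 2) * (pe (polyLap (polyV P z)) x *
      pe (polyGrad (polyV P z) (polyV P z)) x) +
        pe (polyGrad (polyGrad (polyV P z) (polyV P z)) (polyV P z)) x)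
  have t7 := h7.const_mul ((5 / 2) * pe (polyGrad (polyV P z) (polyV P z)) x ^ 2)
  -- Integrability of the partial sums, nested as in `K4_explicit`: splitting the integral needs it
  -- at each stage.
  have s2 := t1.fun_add t2
  have s3 := s2.fun_add t3
  have s4 := integrable_fun_sub s3 t4
  have s5 := integrable_fun_sub s4 b2.1
  have s6 := integrable_fun_sub s5 c1.1
  have s7 := s6.fun_add t7
  have s8 := s7.fun_add b3.1
  have s9 := s8.fun_add c2.1
  rw [hK]
  refine ⟨s9, ?_⟩
  rw [integral_add s8 c2.1, integral_add s7 b3.1, integral_add s6 t7, integral_sub s5 c1.1,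
    integral_sub s4 b2.1, integral_sub s3 t4, integral_add s2 t3, integral_add t1 t2,
    integral_const_mul, integral_const_mul, integral_const_mul, integral_const_mul,
    b1.2, b2.2, b3.2, c1.2, c2.2]
  rw [← resInt, ← resInt, ← resInt, ← resInt]
  have e1 : ∑ j, pe (polyLap (∂ j (∂ j (polyV P z)))) x = pe (polyLap (polyLap (polyV P z))) x := by
    simp only [polyLap, map_sum, pe_sum]
    exact Finset.sum_comm
  have e2 : ∑ j, pe (polyGrad (∂ j (∂ j (polyV P z))) (polyV P z)) x =
      pe (polyGrad (polyLap (polyV P z)) (polyV P z)) x := by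
    simp only [polyGrad, polyLap, map_sum, pe_sum, pe_mul, Finset.sum_mul]
    exact Finset.sum_comm
  have e3 : ∑ j, ∑ l, hessV P z x j l * hessV P z x l j = pe (polyHessSq (polyV P z)) x := by
    simp only [polyHessSq, pe_sum, pe_pow]
    refine Finset.sum_congr rfl fun j _ => Finset.sum_congr rfl fun k _ => ?_
    rw [hessV_symm P z x k j, ← pow_two]
    rfl
  have e4 : ∑ j, ∑ k, hessV P z x j k ^ 2 = pe (polyHessSq (polyV P z)) x := by
    simp only [polyHessSq, pe_sum, pe_pow]; rfl
  have e5 : ∑ j, ∑ l, (quartV P z x j j l l + quartV P z x j l j l + quartV P z x j l l j) =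
      3 * pe (polyLap (polyLap (polyV P z))) x := by
    have : pe (polyLap (polyLap (polyV P z))) x = ∑ j, ∑ l, quartV P z x j j l l := by
      simp [quartV, polyLap]
    rw [this, Finset.mul_sum]
    refine Finset.sum_congr rfl fun j _ => ?_
    rw [Finset.mul_sum]
    refine Finset.sum_congr rfl fun l _ => ?_
    rw [quartV_swap_right x j l l j, quartV_swap_mid x j l j l]
    ring
  have e6 : ∑ j, ∑ l, (10 * hessV P z x j j * hessV P z x l l +
      10 * hessV P z x j l * hessV P z x j l + 10 * hessV P z x j l * hessV P z x l j) =
      10 * pe (polyLap (polyV P z)) x ^ 2 + 20 * pe (polyHessSq (polyV P z)) x := by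
    rw [← e4, ← sum_diag_hessV, pow_two, Finset.sum_mul_sum]
    simp only [Finset.mul_sum, ← Finset.sum_add_distrib]
    refine Finset.sum_congr rfl fun j _ => Finset.sum_congr rfl fun k _ => ?_
    rw [hessV_symm P z x k j]
    ring
  rw [e1, e4, e5, e6]
  simp only [Finset.sum_add_distrib, ← Finset.mul_sum]
  rw [e2, e3, sum_diag_hessV, polyLap_polyGrad_self]
  simp only [pe_add, pe_mul, pe_ofNat]
  push_cast
  ring

end IntK4

end QuadraticPencil

namespace QuadraticPencil

open scoped ContDiff

/-! ### From derivatives of `(P - z)²` to derivatives of `P` -/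

section EvalK4

variable {d : ℕ}

local notation "∂" => MvPolynomial.pderiv

section MapPoly

variable {R S : Type*} [CommRing R] [CommRing S] (f : R →+* S) (p : MvPolynomial (Fin d) R)

lemma polyLap_map : polyLap (MvPolynomial.map f p) = MvPolynomial.map f (polyLap p) := by
  simp only [polyLap, map_sum, MvPolynomial.pderiv_map]

end MapPoly

variable (P : MvPolynomial (Fin d) ℝ) (z : ℂ)

lemma lap_eq (x : Fin d → ℝ) : lap P x = MvPolynomial.eval x (polyLap P) := by
  simp [lap, D2, polyLap]

lemma gradSq_eq (x : Fin d → ℝ) : gradSq P x = MvPolynomial.eval x (polyGrad P P) := by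
  simp [gradSq, D1, polyGrad, pow_two]

lemma hessGrad_eq (x : Fin d → ℝ) : hessGrad P x = MvPolynomial.eval x (polyHessGrad P) := by
  simp [hessGrad, D1, D2, polyHessGrad]

lemma bilap_eq (x : Fin d → ℝ) : bilap P x = MvPolynomial.eval x (polyLap (polyLap P)) := by
  simp [bilap, D22, polyLap]

lemma pderiv_polyQ (j : Fin d) :
    ∂ j (polyQ P z) = MvPolynomial.map Complex.ofRealHom (∂ j P) := by
  simp [polyQ, MvPolynomial.pderiv_map]

lemma polyLap_polyQ : polyLap (polyQ P z) = MvPolynomial.map Complex.ofRealHom (polyLap P) := by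
  simp only [polyLap, pderiv_polyQ, MvPolynomial.pderiv_map, map_sum]

lemma polyGrad_polyQ (p : MvPolynomial (Fin d) ℝ) :
    polyGrad (MvPolynomial.map Complex.ofRealHom p) (polyQ P z) =
      MvPolynomial.map Complex.ofRealHom (polyGrad p P) := by
  simp only [polyGrad, pderiv_polyQ, MvPolynomial.pderiv_map, map_sum, map_mul]

lemma polyGrad_polyQ_self :
    polyGrad (polyQ P z) (polyQ P z) = MvPolynomial.map Complex.ofRealHom (polyGrad P P) := by
  simp only [polyGrad, pderiv_polyQ, map_sum, map_mul]

lemma polyHessSq_polyQ :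
    polyHessSq (polyQ P z) = MvPolynomial.map Complex.ofRealHom (polyHessSq P) := by
  simp only [polyHessSq, pderiv_polyQ, MvPolynomial.pderiv_map, map_sum, map_pow]

lemma polyHessGrad_polyQ :
    polyHessGrad (polyQ P z) = MvPolynomial.map Complex.ofRealHom (polyHessGrad P) := by
  simp only [polyHessGrad, pderiv_polyQ, MvPolynomial.pderiv_map, map_sum, map_mul]

lemma polyLap_polyV : polyLap (polyV P z) =
    2 * (polyQ P z * MvPolynomial.map Complex.ofRealHom (polyLap P) +
      MvPolynomial.map Complex.ofRealHom (polyGrad P P)) := by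
  rw [polyV, pow_two, polyLap_mul, polyLap_polyQ, polyGrad_polyQ_self]
  ring

lemma polyGrad_polyV : polyGrad (polyV P z) (polyV P z) =
    4 * (polyQ P z * (polyQ P z * MvPolynomial.map Complex.ofRealHom (polyGrad P P))) := by
  rw [polyV, pow_two]
  simp only [polyGrad_mul_left, polyGrad_mul_right, polyGrad_polyQ_self]
  ring

lemma polyLap_ofNat_mul (n : ℕ) [n.AtLeastTwo] (p : MvPolynomial (Fin d) ℂ) :
    polyLap (ofNat(n) * p) = ofNat(n) * polyLap p := by
  have : (ofNat(n) : MvPolynomial (Fin d) ℂ) = MvPolynomial.C (ofNat(n) : ℂ) := rfl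
  simp only [this, polyLap, MvPolynomial.pderiv_C_mul, Finset.mul_sum]

lemma polyGrad_ofNat_mul (n : ℕ) [n.AtLeastTwo] (p q : MvPolynomial (Fin d) ℂ) :
    polyGrad (ofNat(n) * p) q = ofNat(n) * polyGrad p q := by
  have : (ofNat(n) : MvPolynomial (Fin d) ℂ) = MvPolynomial.C (ofNat(n) : ℂ) := rfl
  simp only [this, polyGrad, MvPolynomial.pderiv_C_mul, Finset.mul_sum, mul_assoc]

lemma polyLap_polyLap_polyV : polyLap (polyLap (polyV P z)) =
    2 * polyQ P z * MvPolynomial.map Complex.ofRealHom (polyLap (polyLap P)) +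
    8 * MvPolynomial.map Complex.ofRealHom (polyGrad (polyLap P) P) +
    2 * MvPolynomial.map Complex.ofRealHom (polyLap P) ^ 2 +
    4 * MvPolynomial.map Complex.ofRealHom (polyHessSq P) := by
  rw [polyLap_polyV, polyLap_ofNat_mul, polyLap_add, polyLap_mul, polyLap_polyQ, polyLap_map,
    polyLap_map, polyLap_polyGrad_self, polyGrad_comm, polyGrad_polyQ]
  simp only [map_add, map_mul, map_ofNat]
  ring

lemma polyGrad_polyLap_polyV : polyGrad (polyLap (polyV P z)) (polyV P z) =
    4 * polyQ P z ^ 2 * MvPolynomial.map Complex.ofRealHom (polyGrad (polyLap P) P) +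
    4 * polyQ P z * MvPolynomial.map Complex.ofRealHom (polyLap P) *
      MvPolynomial.map Complex.ofRealHom (polyGrad P P) +
    8 * polyQ P z * MvPolynomial.map Complex.ofRealHom (polyHessGrad P) := by
  rw [polyLap_polyV, polyGrad_ofNat_mul, polyV, pow_two]
  simp only [polyGrad_mul_right, polyGrad_add_left, polyGrad_mul_left, polyGrad_polyQ,
    polyGrad_polyQ_self, polyGrad_polyGrad_self]
  simp only [map_mul, map_ofNat]
  ring

lemma polyGrad_polyGrad_polyV : polyGrad (polyGrad (polyV P z) (polyV P z)) (polyV P z) =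
    16 * polyQ P z ^ 3 * MvPolynomial.map Complex.ofRealHom (polyHessGrad P) +
    16 * polyQ P z ^ 2 * MvPolynomial.map Complex.ofRealHom (polyGrad P P) ^ 2 := by
  rw [polyGrad_polyV, polyGrad_ofNat_mul, polyV, pow_two]
  simp only [polyGrad_mul_right, polyGrad_mul_left, polyGrad_polyQ,
    polyGrad_polyQ_self, polyGrad_polyGrad_self]
  simp only [map_mul, map_ofNat]
  ring

lemma polyHessSq_polyV : polyHessSq (polyV P z) =
    4 * polyQ P z ^ 2 * MvPolynomial.map Complex.ofRealHom (polyHessSq P) +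
    8 * polyQ P z * MvPolynomial.map Complex.ofRealHom (polyHessGrad P) +
    4 * MvPolynomial.map Complex.ofRealHom (polyGrad P P) ^ 2 := by
  rw [polyV, polyHessSq_sq, polyHessSq_polyQ, polyHessGrad_polyQ, polyGrad_polyQ_self]

variable {P z}

/-- The recursion brings `I_5, I_6, I_7` back to `I_4`, and the derivatives of `V` are expanded in
those of `P`, with `z` entering only through `Q`. The six scalars are passed as variables, which
turns the final comparison into pure algebra. -/
lemma integral_K4_eval (hL : ∀ x ξ, symbL P z x ξ ≠ 0) (hd : d < 8) (x : Fin d → ℝ) {Q : ℂ}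
    (hQ : 0 < Q.re) (hQx : (MvPolynomial.eval x P : ℝ) - z = Q) {a e l n g h : ℂ}
    (ha : a = (MvPolynomial.eval x (polyLap (polyLap P)) : ℝ))
    (he : e = (MvPolynomial.eval x (polyGrad (polyLap P) P) : ℝ))
    (hl : l = (MvPolynomial.eval x (polyLap P) : ℝ))
    (hn : n = (MvPolynomial.eval x (polyHessSq P) : ℝ))
    (hg : g = (MvPolynomial.eval x (polyGrad P P) : ℝ))
    (hh : h = (MvPolynomial.eval x (polyHessGrad P) : ℝ)) :
    Integrable (K4 P z x) ∧ ∫ ξ, K4 P z x ξ = resInt d 4 Q * (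
      -(1 / 10) * (2 * Q * a + 8 * e + 2 * l ^ 2 + 4 * n) +
      ((4 / 5) * (4 * Q ^ 2 * e + 4 * Q * l * g + 8 * Q * h) +
        (1 / 3) * (2 * (Q * l + g)) ^ 2 +
        (4 / 15) * (4 * Q ^ 2 * n + 8 * Q * h + 4 * g ^ 2)) * ((1 - d / 8) / Q ^ 2) -
      ((5 / 3) * (2 * (Q * l + g) * (4 * (Q * (Q * g)))) +
        (16 * Q ^ 3 * h + 16 * Q ^ 2 * g ^ 2)) * ((1 - d / 8) * (1 - d / 10) / Q ^ 4) +
      (5 / 2) * (4 * (Q * (Q * g))) ^ 2 *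
        ((1 - d / 8) * (1 - d / 10) * (1 - d / 12) / Q ^ 6)) := by
  have hV : pe (polyV P z) x = Q ^ 2 := by rw [pe_polyV, hQx]
  have hq : pe (polyQ P z) x = Q := by rw [pe_polyQ, hQx]
  have hQ0 : Q ≠ 0 := by rintro rfl; simp at hQ
  obtain ⟨h1, h2⟩ := integral_K4 hL hd x hQ hV
  refine ⟨h1, ?_⟩
  have m5 := resInt_succ (d := d) hQ (n := 4) (by omega)
  have m6 := resInt_succ (d := d) hQ (n := 5) (by omega)
  have m7 := resInt_succ (d := d) hQ (n := 6) (by omega)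
  rw [h2, m7, m6, m5, polyLap_polyLap_polyV, polyGrad_polyLap_polyV, polyGrad_polyGrad_polyV,
    polyHessSq_polyV, polyLap_polyV, polyGrad_polyV]
  simp only [pe_add, pe_mul, pe_pow, pe_ofNat, hq, pe_map, ← ha, ← he, ← hl, ← hn, ← hg, ← hh]
  push_cast
  field_simp
  ring

end EvalK4

/-- The coefficients of `Q^{-1}, …, Q^{-4}` in `Q ∫ K_4 dξ`, in dimension five. -/
lemma mul_integral_K4_five {P : MvPolynomial (Fin 5) ℝ} {z : ℂ}
    (hL : ∀ x ξ, symbL P z x ξ ≠ 0) (x : Fin 5 → ℝ) {Q : ℂ}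
    (hQ : 0 < Q.re) (hQx : (MvPolynomial.eval x P : ℝ) - z = Q) :
    Q * ∫ ξ, K4 P z x ξ =
      ((-(Real.pi ^ 3 / 60) * MvPolynomial.eval x (polyLap (polyLap P)) : ℝ) : ℂ) * Q⁻¹ ^ 1 +
      ((Real.pi ^ 3 / 30 * MvPolynomial.eval x (polyGrad (polyLap P) P) +
        Real.pi ^ 3 / 40 * MvPolynomial.eval x (polyLap P) ^ 2 : ℝ) : ℂ) * Q⁻¹ ^ 2 +
      ((-(Real.pi ^ 3 / 40) * (MvPolynomial.eval x (polyLap P) *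
        MvPolynomial.eval x (polyGrad P P)) +
        Real.pi ^ 3 / 60 * MvPolynomial.eval x (polyHessGrad P) : ℝ) : ℂ) * Q⁻¹ ^ 3 +
      ((-(3 * Real.pi ^ 3 / 160) * MvPolynomial.eval x (polyGrad P P) ^ 2 : ℝ) : ℂ) * Q⁻¹ ^ 4 := by
  have hQ0 : Q ≠ 0 := by rintro rfl; simp at hQ
  rw [(integral_K4_eval hL (by norm_num) x hQ hQx rfl rfl rfl rfl rfl rfl).2]
  have h4 := resInt_four (d := 5) hQ (by norm_num)
  rw [resInt_five] at h4
  have h4' : resInt 5 4 Q = ((Real.pi ^ 3 / 12 : ℝ) : ℂ) / Q ^ 3 := by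
    rw [← h4]; field_simp
  rw [h4']
  push_cast
  field_simp
  ring

/-- The coefficients of `Q, 1, Q^{-1}, Q^{-2}` in `Q ∫ K_4 dξ`, in dimension seven. -/
lemma mul_integral_K4_seven {P : MvPolynomial (Fin 7) ℝ} {z : ℂ}
    (hL : ∀ x ξ, symbL P z x ξ ≠ 0) (x : Fin 7 → ℝ) {Q : ℂ}
    (hQ : 0 < Q.re) (hQx : (MvPolynomial.eval x P : ℝ) - z = Q) :
    Q * ∫ ξ, K4 P z x ξ =
      ((-(Real.pi ^ 4 / 30) * MvPolynomial.eval x (polyLap (polyLap P)) : ℝ) : ℂ) * Q +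
      ((-(Real.pi ^ 4 / 15) * MvPolynomial.eval x (polyGrad (polyLap P) P) -
        Real.pi ^ 4 / 180 * MvPolynomial.eval x (polyLap P) ^ 2 -
        2 * Real.pi ^ 4 / 45 * MvPolynomial.eval x (polyHessSq P) : ℝ) : ℂ) +
      ((7 * Real.pi ^ 4 / 180 * (MvPolynomial.eval x (polyLap P) *
        MvPolynomial.eval x (polyGrad P P)) +
        7 * Real.pi ^ 4 / 90 * MvPolynomial.eval x (polyHessGrad P) : ℝ) : ℂ) * Q⁻¹ ^ 1 +
      ((-(7 * Real.pi ^ 4 / 240) * MvPolynomial.eval x (polyGrad P P) ^ 2 : ℝ) : ℂ) * Q⁻¹ ^ 2 := by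
  have hQ0 : Q ≠ 0 := by rintro rfl; simp at hQ
  rw [(integral_K4_eval hL (by norm_num) x hQ hQx rfl rfl rfl rfl rfl rfl).2]
  have h4 := resInt_four (d := 7) hQ (by norm_num)
  rw [resInt_seven] at h4
  have h4' : resInt 7 4 Q = ((Real.pi ^ 4 / 6 : ℝ) : ℂ) / Q := by
    rw [← h4]; norm_num; field_simp
  rw [h4']
  push_cast
  field_simp
  ring

end QuadraticPencil

namespace QuadraticPencil

/-! ### Geometry of the contour -/

section Contour

variable {r₀ θ₀ : ℝ}

lemma ray_mem_contour {r : ℝ} (hr : r₀ ≤ r) :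
    r * Complex.exp (θ₀ * Complex.I) ∈ contour r₀ θ₀ := Or.inl ⟨r, hr, Or.inl rfl⟩

lemma ray_mem_contour' {r : ℝ} (hr : r₀ ≤ r) :
    r * Complex.exp (-θ₀ * Complex.I) ∈ contour r₀ θ₀ := Or.inl ⟨r, hr, Or.inr rfl⟩

lemma arc_mem_contour {θ : ℝ} (h1 : θ₀ ≤ θ) (h2 : θ ≤ 2 * Real.pi - θ₀) :
    r₀ * Complex.exp (θ * Complex.I) ∈ contour r₀ θ₀ := Or.inr ⟨θ, h1, h2, rfl⟩

lemma norm_ofReal_mul_exp {r : ℝ} (hr : 0 ≤ r) (θ : ℝ) :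
    ‖(r : ℂ) * Complex.exp (θ * Complex.I)‖ = r := by
  rw [norm_mul, Complex.norm_exp_ofReal_mul_I, mul_one, Complex.norm_real, Real.norm_of_nonneg hr]

lemma re_ofReal_mul_exp (r θ : ℝ) :
    ((r : ℂ) * Complex.exp (θ * Complex.I)).re = r * Real.cos θ := by
  rw [Complex.re_ofReal_mul, Complex.exp_ofReal_mul_I_re]

/-- The contour lies in the closed sector around the negative axis cut out by its two rays. As `cos
θ₀ < 0`, this keeps `p - z` in the right half-plane for every `p ≥ 0`. -/
lemma re_le_of_mem_contour (hr₀ : 0 < r₀) (h1 : Real.pi / 2 < θ₀) (h2 : θ₀ < Real.pi) {z : ℂ}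
    (hz : z ∈ contour r₀ θ₀) : r₀ ≤ ‖z‖ ∧ z.re ≤ Real.cos θ₀ * ‖z‖ := by
  rcases hz with ⟨r, hr, rfl | rfl⟩ | ⟨θ, hθ1, hθ2, rfl⟩
  · rw [norm_ofReal_mul_exp (hr₀.le.trans hr), re_ofReal_mul_exp, mul_comm]
    exact ⟨hr, le_rfl⟩
  · rw [← Complex.ofReal_neg, norm_ofReal_mul_exp (hr₀.le.trans hr), re_ofReal_mul_exp,
      Real.cos_neg, mul_comm]
    exact ⟨hr, le_rfl⟩
  · rw [norm_ofReal_mul_exp hr₀.le, re_ofReal_mul_exp, mul_comm]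
    refine ⟨le_rfl, mul_le_mul_of_nonneg_right ?_ hr₀.le⟩
    -- The angle is reflected into `[θ₀, π]`, where the cosine is decreasing.
    have h3 : Real.cos θ = Real.cos (Real.pi - |Real.pi - θ|) := by
      rw [Real.cos_pi_sub, Real.cos_abs, Real.cos_pi_sub, neg_neg]
    rw [h3]
    have h4 : |Real.pi - θ| ≤ Real.pi - θ₀ := abs_le.2 ⟨by linarith, by linarith⟩
    refine Real.cos_le_cos_of_nonneg_of_le_pi (by linarith) ?_ (by linarith)
    linarith [abs_nonneg (Real.pi - θ)]

lemma cos_neg_of_obtuse (h1 : Real.pi / 2 < θ₀) (h2 : θ₀ < Real.pi) : Real.cos θ₀ < 0 :=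
  Real.cos_neg_of_pi_div_two_lt_of_lt h1 (by linarith [Real.pi_pos])

lemma sub_re_pos_of_mem_contour (hr₀ : 0 < r₀) (h1 : Real.pi / 2 < θ₀) (h2 : θ₀ < Real.pi) {z : ℂ}
    (hz : z ∈ contour r₀ θ₀) {p : ℝ} (hp : 0 ≤ p) : 0 < ((p : ℂ) - z).re := by
  obtain ⟨h3, h4⟩ := re_le_of_mem_contour hr₀ h1 h2 hz
  have := mul_neg_of_neg_of_pos (cos_neg_of_obtuse h1 h2) (hr₀.trans_le h3)
  rw [Complex.sub_re, Complex.ofReal_re]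
  linarith

lemma exp_mem_region (h2 : θ₀ < Real.pi) {r θ : ℝ} (hr : 0 < r)
    (hθ : |θ| ≤ θ₀) : r * Complex.exp (θ * Complex.I) ∈ region r₀ θ₀ := by
  right
  rw [Complex.exp_mul_I, Complex.arg_mul_cos_add_sin_mul_I hr
    ⟨by linarith [neg_abs_le θ], by linarith [le_abs_self θ]⟩]
  exact hθ

lemma contour_subset_region (hr₀ : 0 < r₀) (h1 : Real.pi / 2 < θ₀) (h2 : θ₀ < Real.pi) :
    contour r₀ θ₀ ⊆ region r₀ θ₀ := by
  have h0 : 0 < θ₀ := by linarith [Real.pi_pos]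
  rintro z (⟨r, hr, rfl | rfl⟩ | ⟨θ, hθ1, hθ2, rfl⟩)
  · exact exp_mem_region h2 (hr₀.trans_le hr) (abs_of_pos h0).le
  · rw [← Complex.ofReal_neg]
    exact exp_mem_region h2 (hr₀.trans_le hr) (by rw [abs_neg, abs_of_pos h0])
  · left
    rw [norm_ofReal_mul_exp hr₀.le]

lemma ofReal_mem_region (h0 : 0 ≤ θ₀) {p : ℝ} (hp : 0 ≤ p) : (p : ℂ) ∈ region r₀ θ₀ := by
  right
  rwa [Complex.arg_ofReal_of_nonneg hp, abs_zero]

lemma cos_mul_norm_le_re (h2 : θ₀ < Real.pi) {z : ℂ} (h : |z.arg| ≤ θ₀) :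
    Real.cos θ₀ * ‖z‖ ≤ z.re := by
  rw [← Complex.norm_mul_cos_arg z, mul_comm, ← Real.cos_abs z.arg]
  exact mul_le_mul_of_nonneg_left (Real.cos_le_cos_of_nonneg_of_le_pi (abs_nonneg _) h2.le h)
    (norm_nonneg _)

lemma add_mem_slitPlane {t : ℝ} (hr₀ : 0 < r₀) (h2 : θ₀ < Real.pi) (ht : r₀ < t)
    {z : ℂ} (hz : z ∈ region r₀ θ₀) : z + t ∈ Complex.slitPlane := by
  rcases hz with hz | hz
  · left
    rw [Complex.add_re, Complex.ofReal_re]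
    linarith [neg_abs_le z.re, Complex.abs_re_le_norm z]
  · by_cases him : z.im = 0
    · left
      rw [Complex.add_re, Complex.ofReal_re]
      by_contra! hneg
      have : z = (z.re : ℂ) := Complex.ext rfl (by simp [him])
      rw [this, Complex.arg_ofReal_of_neg (by linarith), abs_of_pos Real.pi_pos] at hz
      linarith
    · right
      simpa using him

/-- On the disc, `|z + t| ≥ t - r₀`. On the sector, the law of cosines gives `|z + t|² ≥ s (|z| +
t)²` for `s = (1 + cos θ₀) / 2`, the difference being at least `(1 - s)(|z| - t)²`. -/
lemma exists_le_norm_add {t : ℝ} (h0 : 0 ≤ θ₀) (h2 : θ₀ < Real.pi) (ht : r₀ < t)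
    (hr₀ : 0 < r₀) : ∃ c > 0, ∀ z ∈ region r₀ θ₀, c * (1 + ‖z‖) ≤ ‖z + t‖ := by
  have hc : 0 < 1 + Real.cos θ₀ := by
    have := Real.cos_lt_cos_of_nonneg_of_le_pi h0 le_rfl h2
    rw [Real.cos_pi] at this
    linarith
  set s := (1 + Real.cos θ₀) / 2 with hs
  have hs0 : 0 < s := by positivity
  have ht0 : 0 < t := hr₀.trans ht
  refine ⟨min ((t - r₀) / (1 + r₀)) (√s * min 1 t), lt_min ?_ ?_, fun z hz => ?_⟩
  · exact div_pos (by linarith) (by linarith)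
  · have := lt_min one_pos ht0
    positivity
  rcases hz with hz | hz
  · have h1 : ‖z + t‖ ≥ t - r₀ := by
      refine le_trans ?_ (Complex.re_le_norm _)
      rw [Complex.add_re, Complex.ofReal_re]
      linarith [neg_abs_le z.re, Complex.abs_re_le_norm z]
    refine le_trans ?_ h1
    calc _ ≤ (t - r₀) / (1 + r₀) * (1 + r₀) :=
          mul_le_mul (min_le_left _ _) (by linarith) (by positivity)
            (div_nonneg (by linarith) (by linarith))
      _ = t - r₀ := div_mul_cancel₀ _ (by linarith)
  · have h3 := cos_mul_norm_le_re h2 hz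
    have h4 : s * (‖z‖ + t) ^ 2 ≤ ‖z + t‖ ^ 2 := by
      have e1 : ‖z + t‖ ^ 2 = ‖z‖ ^ 2 + 2 * t * z.re + t ^ 2 := by
        rw [← Complex.normSq_eq_norm_sq, ← Complex.normSq_eq_norm_sq, Complex.normSq_apply,
          Complex.normSq_apply]
        simp
        ring
      rw [e1]
      have h5 : 2 * t * (Real.cos θ₀ * ‖z‖) ≤ 2 * t * z.re :=
        mul_le_mul_of_nonneg_left h3 (by positivity)
      have h6 : 0 ≤ (1 - s) * (‖z‖ - t) ^ 2 :=
        mul_nonneg (by linarith [Real.cos_le_one θ₀]) (sq_nonneg _)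
      have h7 : Real.cos θ₀ = 2 * s - 1 := by rw [hs]; ring
      rw [h7] at h5
      nlinarith
    have h5 : √s * (‖z‖ + t) ≤ ‖z + t‖ := by
      refine abs_le_of_sq_le_sq' ?_ (norm_nonneg _) |>.2
      rwa [mul_pow, Real.sq_sqrt hs0.le]
    refine le_trans ?_ h5
    calc _ ≤ √s * min 1 t * (1 + ‖z‖) :=
          mul_le_mul_of_nonneg_right (min_le_right _ _) (by positivity)
      _ = √s * (min 1 t * (1 + ‖z‖)) := mul_assoc _ _ _
      _ ≤ _ := by
        refine mul_le_mul_of_nonneg_left ?_ (Real.sqrt_nonneg _)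
        nlinarith [min_le_left 1 t, min_le_right 1 t, norm_nonneg z]

/-- Away from `p`, in particular on the contour, `z - p` is comparable to `1 + ‖z‖`. -/
lemma exists_norm_inv_sub_le (hr₀ : 0 < r₀) (h1 : Real.pi / 2 < θ₀) (h2 : θ₀ < Real.pi) :
    ∃ K : ℝ, 0 < K ∧ ∀ p : ℝ, 0 ≤ p → ∀ z : ℂ, z ∈ contour r₀ θ₀ ∨ 2 * p + 1 ≤ ‖z‖ →
      z ≠ p ∧ ‖((p : ℂ) - z)⁻¹‖ ≤ K * (1 + ‖z‖)⁻¹ := by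
  have hc := cos_neg_of_obtuse h1 h2
  set c := -Real.cos θ₀ with hcdef
  have hc0 : 0 < c := by linarith
  refine ⟨2 + (1 + r₀) / (r₀ * c), by positivity, fun p hp z hz => ?_⟩
  have key : 1 + ‖z‖ ≤ (2 + (1 + r₀) / (r₀ * c)) * ‖(p : ℂ) - z‖ := by
    have hK : 0 ≤ (1 + r₀) / (r₀ * c) := by positivity
    rcases hz with hz | hz
    · obtain ⟨h3, h4⟩ := re_le_of_mem_contour hr₀ h1 h2 hz
      have h5 : c * ‖z‖ ≤ ‖(p : ℂ) - z‖ := by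
        refine le_trans ?_ (Complex.re_le_norm _)
        rw [Complex.sub_re, Complex.ofReal_re]
        linarith
      calc 1 + ‖z‖ ≤ (1 + r₀) / (r₀ * c) * (c * ‖z‖) := by
            rw [div_mul_eq_mul_div, le_div_iff₀ (by positivity)]
            nlinarith
        _ ≤ (2 + (1 + r₀) / (r₀ * c)) * (c * ‖z‖) :=
            mul_le_mul_of_nonneg_right (by linarith) (by positivity)
        _ ≤ _ := mul_le_mul_of_nonneg_left h5 (by positivity)
    · have h5 : ‖z‖ - p ≤ ‖(p : ℂ) - z‖ := by
        have := norm_sub_norm_le z (p : ℂ)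
        rwa [Complex.norm_real, Real.norm_of_nonneg hp, norm_sub_rev] at this
      calc 1 + ‖z‖ ≤ 2 * ‖(p : ℂ) - z‖ := by linarith
        _ ≤ _ := mul_le_mul_of_nonneg_right (by linarith) (norm_nonneg _)
  have h1z : 0 < 1 + ‖z‖ := by positivity
  have hpos : 0 < ‖(p : ℂ) - z‖ := by
    by_contra! h
    have h' : ‖(p : ℂ) - z‖ = 0 := le_antisymm h (norm_nonneg _)
    rw [h', mul_zero] at key
    linarith
  refine ⟨fun h => by simp [h] at hpos, ?_⟩
  rw [norm_inv, ← div_eq_mul_inv, inv_eq_one_div, div_le_div_iff₀ hpos h1z]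
  linarith

/-! ### Integrals over the contour -/

variable {F G : ℂ → ℂ}

lemma ContourIntegrable.congr (hF : ContourIntegrable r₀ θ₀ F) (h : Set.EqOn F G (contour r₀ θ₀))
    (h2 : θ₀ < Real.pi) : ContourIntegrable r₀ θ₀ G := by
  obtain ⟨a, b, c⟩ := hF
  refine ⟨a.congr_fun (fun r hr => h (ray_mem_contour (le_of_lt hr))) measurableSet_Ioi, ?_,
    c.congr_fun (fun r hr => h (ray_mem_contour' (le_of_lt hr))) measurableSet_Ioi⟩
  refine b.congr fun θ hθ => h ?_
  rw [Set.uIoc_of_le (by linarith)] at hθ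
  exact arc_mem_contour hθ.1.le hθ.2

lemma contourInt_congr (h : Set.EqOn F G (contour r₀ θ₀)) (h2 : θ₀ < Real.pi) :
    contourInt r₀ θ₀ F = contourInt r₀ θ₀ G := by
  unfold contourInt
  congr 2
  · congr 1
    · congr 1
      refine setIntegral_congr_fun measurableSet_Ioi fun r hr => ?_
      simp only [h (ray_mem_contour (le_of_lt hr))]
    · refine intervalIntegral.integral_congr fun θ hθ => ?_
      rw [Set.uIcc_of_le (by linarith)] at hθ
      simp only [h (arc_mem_contour hθ.1 hθ.2)]
  · refine setIntegral_congr_fun measurableSet_Ioi fun r hr => ?_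
    simp only [h (ray_mem_contour' (le_of_lt hr))]

lemma continuous_arcDeriv : Continuous fun θ : ℝ =>
    Complex.I * r₀ * Complex.exp (θ * Complex.I) := by fun_prop

lemma ContourIntegrable.add (hF : ContourIntegrable r₀ θ₀ F) (hG : ContourIntegrable r₀ θ₀ G) :
    ContourIntegrable r₀ θ₀ (fun z => F z + G z) :=
  ⟨hF.1.add hG.1, hF.2.1.add hG.2.1, hF.2.2.add hG.2.2⟩

lemma ContourIntegrable.const_mul (c : ℂ) (hF : ContourIntegrable r₀ θ₀ F) :
    ContourIntegrable r₀ θ₀ (fun z => c * F z) :=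
  ⟨hF.1.const_mul c, hF.2.1.const_mul c, hF.2.2.const_mul c⟩

lemma contourInt_add (hF : ContourIntegrable r₀ θ₀ F) (hG : ContourIntegrable r₀ θ₀ G) :
    contourInt r₀ θ₀ (fun z => F z + G z) = contourInt r₀ θ₀ F + contourInt r₀ θ₀ G := by
  unfold contourInt
  simp only [add_mul]
  rw [integral_add (hF.1.mul_const _) (hG.1.mul_const _),
    integral_add (hF.2.2.mul_const _) (hG.2.2.mul_const _),
    intervalIntegral.integral_add (hF.2.1.mul_continuousOn continuous_arcDeriv.continuousOn)
      (hG.2.1.mul_continuousOn continuous_arcDeriv.continuousOn)]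
  ring

lemma contourInt_const_mul (c : ℂ) (F : ℂ → ℂ) :
    contourInt r₀ θ₀ (fun z => c * F z) = c * contourInt r₀ θ₀ F := by
  unfold contourInt
  simp only [mul_assoc]
  rw [integral_const_mul, integral_const_mul, intervalIntegral.integral_const_mul]
  ring

lemma integrableOn_ray {e : ℂ} (he : ‖e‖ = 1)
    (hc : ContinuousOn (fun r : ℝ => F (r * e)) (Set.Ici r₀)) {C ν : ℝ} (hν : 1 < ν)
    (hb : ∀ r : ℝ, r₀ ≤ r → ‖F (r * e)‖ ≤ C * (1 + ‖(r : ℂ) * e‖) ^ (-ν)) :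
    IntegrableOn (fun r : ℝ => F (r * e)) (Set.Ioi r₀) := by
  have h := (integrable_one_add_norm (μ := volume) (E := ℝ) (r := ν) (by simpa using hν)).const_mul C
  refine Integrable.mono' h.integrableOn
    ((hc.mono Set.Ioi_subset_Ici_self).aestronglyMeasurable measurableSet_Ioi) ?_
  refine (ae_restrict_iff' measurableSet_Ioi).2 (Filter.Eventually.of_forall fun r hr => ?_)
  have := hb r (le_of_lt hr)
  rwa [norm_mul, he, mul_one, Complex.norm_real] at this

lemma contourIntegrable_of_norm_le (h2 : θ₀ < Real.pi)
    (hc : ContinuousOn F (contour r₀ θ₀)) {C ν : ℝ} (hν : 1 < ν)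
    (hb : ∀ z ∈ contour r₀ θ₀, ‖F z‖ ≤ C * (1 + ‖z‖) ^ (-ν)) : ContourIntegrable r₀ θ₀ F := by
  refine ⟨integrableOn_ray (Complex.norm_exp_ofReal_mul_I θ₀) ?_ hν
    fun r hr => hb _ (ray_mem_contour hr), ?_,
    integrableOn_ray ?_ ?_ hν fun r hr => hb _ (ray_mem_contour' hr)⟩
  · exact hc.comp (by fun_prop) fun r hr => ray_mem_contour hr
  · refine ContinuousOn.intervalIntegrable ?_
    rw [Set.uIcc_of_le (by linarith)]
    exact hc.comp (by fun_prop) fun θ hθ => arc_mem_contour hθ.1 hθ.2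
  · rw [← Complex.ofReal_neg, Complex.norm_exp_ofReal_mul_I]
  · exact hc.comp (by fun_prop) fun r hr => ray_mem_contour' hr

/-- The fundamental theorem of calculus on the three pieces. The values at the two corners cancel,
since `e^{i(2π - θ₀)} = e^{-iθ₀}`, and the limits at infinity remain. -/
lemma contourInt_of_hasDerivAt (h2 : θ₀ < Real.pi)
    (hG : ∀ z ∈ contour r₀ θ₀, HasDerivAt G (F z) z) (hF : ContourIntegrable r₀ θ₀ F)
    {a b : ℂ} (ha : Filter.Tendsto (fun r : ℝ => G (r * Complex.exp (θ₀ * Complex.I)))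
      Filter.atTop (nhds a))
    (hb : Filter.Tendsto (fun r : ℝ => G (r * Complex.exp (-θ₀ * Complex.I)))
      Filter.atTop (nhds b)) :
    contourInt r₀ θ₀ F = (1 / (2 * Complex.I * Real.pi)) * (b - a) := by
  have hray : ∀ (e : ℂ) (r : ℝ), HasDerivAt (fun r : ℝ => (r : ℂ) * e) e r := fun e r => by
    simpa using (Complex.ofRealCLM.hasDerivAt (x := r)).mul_const e
  have e1 := integral_Ioi_of_hasDerivAt_of_tendsto' (a := r₀)
    (fun r hr => (hG _ (ray_mem_contour hr)).comp r (hray _ r)) (hF.1.mul_const _) ha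
  have e2 := integral_Ioi_of_hasDerivAt_of_tendsto' (a := r₀)
    (fun r hr => (hG _ (ray_mem_contour' hr)).comp r (hray _ r)) (hF.2.2.mul_const _) hb
  have hle : θ₀ ≤ 2 * Real.pi - θ₀ := by linarith
  have harc : ∀ θ : ℝ, HasDerivAt (fun θ : ℝ => (r₀ : ℂ) * Complex.exp (θ * Complex.I))
      (Complex.I * r₀ * Complex.exp (θ * Complex.I)) θ := fun θ => by
    have h : HasDerivAt (fun z : ℂ => (r₀ : ℂ) * Complex.exp (z * Complex.I))
        (r₀ * (Complex.exp (θ * Complex.I) * Complex.I)) θ := by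
      simpa using (((hasDerivAt_id (θ : ℂ)).mul_const Complex.I).cexp.const_mul (r₀ : ℂ))
    have e : Complex.I * r₀ * Complex.exp (θ * Complex.I) =
      r₀ * (Complex.exp (θ * Complex.I) * Complex.I) := by ring
    rw [e]
    exact h.comp_ofReal
  have e3 := intervalIntegral.integral_eq_sub_of_hasDerivAt (a := θ₀) (b := 2 * Real.pi - θ₀)
    (fun θ hθ => (hG _ (arc_mem_contour (r₀ := r₀) (by rw [Set.uIcc_of_le hle] at hθ; exact hθ.1)
      (by rw [Set.uIcc_of_le hle] at hθ; exact hθ.2))).comp θ (harc θ))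
    (hF.2.1.mul_continuousOn continuous_arcDeriv.continuousOn)
  have e4 : Complex.exp ((2 * Real.pi - θ₀ : ℝ) * Complex.I) =
      Complex.exp (-θ₀ * Complex.I) := by
    have : ((2 * Real.pi - θ₀ : ℝ) : ℂ) * Complex.I =
      -θ₀ * Complex.I + 2 * Real.pi * Complex.I := by push_cast; ring
    rw [this, Complex.exp_periodic]
  unfold contourInt
  rw [e1, e2, e3]
  simp only [Function.comp, e4]
  ring

end Contour
end QuadraticPencil

namespace QuadraticPencil

/-! ### Cauchy's theorem for the unbounded contour -/

section Cauchy

variable {r₀ θ₀ : ℝ} {g : ℂ → ℂ}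

lemma continuousOn_ray (hg : ContinuousOn g (region r₀ θ₀)) (hr₀ : 0 < r₀) (h2 : θ₀ < Real.pi)
    {θ : ℝ} (hθ : |θ| ≤ θ₀) {s : Set ℝ} (hs : s ⊆ Set.Ici r₀) :
    ContinuousOn (fun r : ℝ => g (r * Complex.exp (θ * Complex.I))) s :=
  hg.comp (by fun_prop) fun _ hr => exp_mem_region h2 (hr₀.trans_le (hs hr)) hθ

/-- Cauchy's theorem for the sector `r₀ ≤ |z| ≤ R`, `|arg z| ≤ θ₀`. -/
lemma integral_boundary_sector (hr₀ : 0 < r₀) (h0 : 0 < θ₀) (h2 : θ₀ < Real.pi)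
    (hg : AnalyticOnNhd ℂ g (region r₀ θ₀)) {R : ℝ} (hR : r₀ ≤ R) :
    (∫ r in r₀..R, g (r * Complex.exp (-θ₀ * Complex.I)) * Complex.exp (-θ₀ * Complex.I)) -
      (∫ r in r₀..R, g (r * Complex.exp (θ₀ * Complex.I)) * Complex.exp (θ₀ * Complex.I)) +
      (∫ θ in -θ₀..θ₀, g (R * Complex.exp (θ * Complex.I)) *
        (Complex.I * R * Complex.exp (θ * Complex.I))) -
      (∫ θ in -θ₀..θ₀, g (r₀ * Complex.exp (θ * Complex.I)) *
        (Complex.I * r₀ * Complex.exp (θ * Complex.I))) = 0 := by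
  have hR0 : 0 < R := hr₀.trans_le hR
  have hlog : Real.log r₀ ≤ Real.log R := Real.log_le_log hr₀ hR
  have hmem : ∀ w : ℂ, |w.im| ≤ θ₀ → Complex.exp w ∈ region r₀ θ₀ := fun w hw => by
    have := exp_mem_region (r₀ := r₀) h2 (Real.exp_pos w.re) hw
    rwa [Complex.ofReal_exp, ← Complex.exp_add, Complex.re_add_im] at this
  -- The exponential maps the rectangle `[log r₀, log R] × [-θ₀, θ₀]` onto the sector, so Cauchy's
  -- theorem on rectangles applies after this substitution.
  have key := Complex.integral_boundary_rect_eq_zero_of_differentiableOn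
    (fun w => g (Complex.exp w) * Complex.exp w) (⟨Real.log r₀, -θ₀⟩ : ℂ) (⟨Real.log R, θ₀⟩ : ℂ) (by
      intro w hw
      rw [Complex.mem_reProdIm, Set.uIcc_of_le (show -θ₀ ≤ θ₀ by linarith)] at hw
      exact (((hg _ (hmem w (abs_le.2 hw.2))).differentiableAt.comp w
        Complex.differentiableAt_exp).mul Complex.differentiableAt_exp).differentiableWithinAt)
  simp only at key
  have hray : ∀ θ : ℝ, |θ| ≤ θ₀ → ∫ x in Real.log r₀..Real.log R,
      g (Complex.exp (x + θ * Complex.I)) * Complex.exp (x + θ * Complex.I) =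
      ∫ r in r₀..R, g (r * Complex.exp (θ * Complex.I)) * Complex.exp (θ * Complex.I) := by
    intro θ hθ
    have h := intervalIntegral.integral_deriv_smul_comp' (a := Real.log r₀) (b := Real.log R)
      (f := Real.exp) (f' := Real.exp)
      (g := fun r : ℝ => g (r * Complex.exp (θ * Complex.I)) * Complex.exp (θ * Complex.I))
      (fun x _ => Real.hasDerivAt_exp x) Real.continuous_exp.continuousOn ?_
    · rw [Real.exp_log hr₀, Real.exp_log hR0] at h
      rw [← h]
      refine intervalIntegral.integral_congr fun x _ => ?_
      simp only [Function.comp, Complex.real_smul, Complex.ofReal_exp, Complex.exp_add]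
      ring
    · refine (continuousOn_ray hg.continuousOn hr₀ h2 hθ ?_).mul continuousOn_const
      rintro _ ⟨x, hx, rfl⟩
      rw [Set.uIcc_of_le hlog] at hx
      exact (Real.le_exp_log r₀).trans (Real.exp_le_exp.2 hx.1)
  have harc : ∀ r : ℝ, 0 < r → Complex.I • ∫ θ in -θ₀..θ₀,
      g (Complex.exp (Real.log r + θ * Complex.I)) * Complex.exp (Real.log r + θ * Complex.I) =
      ∫ θ in -θ₀..θ₀, g (r * Complex.exp (θ * Complex.I)) *
        (Complex.I * r * Complex.exp (θ * Complex.I)) := by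
    intro r hr
    rw [← intervalIntegral.integral_smul]
    refine intervalIntegral.integral_congr fun x _ => ?_
    simp only [Complex.exp_add, ← Complex.ofReal_exp, Real.exp_log hr, smul_eq_mul]
    ring
  rw [hray _ (by rw [abs_neg, abs_of_pos h0]), hray _ (abs_of_pos h0).le, harc _ hR0,
    harc _ hr₀] at key
  simpa using key

/-- Cauchy's theorem on the disc `|z| ≤ r₀`, the circle being split into two arcs. -/
lemma integral_arc_add_arc (hr₀ : 0 < r₀) (hg : AnalyticOnNhd ℂ g (region r₀ θ₀)) :
    (∫ θ in -θ₀..θ₀, g (r₀ * Complex.exp (θ * Complex.I)) *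
        (Complex.I * r₀ * Complex.exp (θ * Complex.I))) +
      ∫ θ in θ₀..(2 * Real.pi - θ₀), g (r₀ * Complex.exp (θ * Complex.I)) *
        (Complex.I * r₀ * Complex.exp (θ * Complex.I)) = 0 := by
  have hball : Metric.closedBall (0 : ℂ) r₀ ⊆ region r₀ θ₀ := fun z hz => Or.inl (by simpa using hz)
  have hcirc := Complex.circleIntegral_eq_zero_of_differentiable_on_off_countable hr₀.le
    Set.countable_empty (hg.continuousOn.mono hball) fun z hz =>
      (hg z (hball (Metric.ball_subset_closedBall hz.1))).differentiableAt
  have hcont : Continuous fun θ : ℝ => g (r₀ * Complex.exp (θ * Complex.I)) *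
      (Complex.I * r₀ * Complex.exp (θ * Complex.I)) := by
    refine Continuous.mul ?_ continuous_arcDeriv
    refine (hg.continuousOn.mono hball).comp_continuous (by fun_prop) fun θ => ?_
    rw [mem_closedBall_zero_iff, norm_ofReal_mul_exp hr₀.le]
  have hper : Function.Periodic (fun θ : ℝ => g (r₀ * Complex.exp (θ * Complex.I)) *
      (Complex.I * r₀ * Complex.exp (θ * Complex.I))) (2 * Real.pi) := by
    intro θ
    have : Complex.exp ((θ + 2 * Real.pi : ℝ) * Complex.I) = Complex.exp (θ * Complex.I) := by
      push_cast
      rw [add_mul, Complex.exp_periodic]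
    simp only [this]
  rw [intervalIntegral.integral_add_adjacent_intervals (hcont.intervalIntegrable _ _)
    (hcont.intervalIntegrable _ _)]
  have h := hper.intervalIntegral_add_eq (-θ₀) 0
  rw [zero_add, neg_add_eq_sub] at h
  rw [h, ← hcirc, circleIntegral]
  refine intervalIntegral.integral_congr fun θ _ => ?_
  simp only [deriv_circleMap, circleMap, smul_eq_mul, zero_add]
  ring

/-- Truncated at radius `R`, the contour is closed by the arc `|z| = R`, `|arg z| ≤ θ₀`. The
integral over that arc is `O(R^{1-ν})` and tends to zero. -/
lemma contourInt_eq_zero (hr₀ : 0 < r₀) (h0 : 0 < θ₀) (h2 : θ₀ < Real.pi)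
    (hg : AnalyticOnNhd ℂ g (region r₀ θ₀)) (hi : ContourIntegrable r₀ θ₀ g) {C ν R₀ : ℝ}
    (hν : 1 < ν) (hb : ∀ z ∈ region r₀ θ₀, R₀ ≤ ‖z‖ → ‖g z‖ ≤ C * (1 + ‖z‖) ^ (-ν)) :
    contourInt r₀ θ₀ g = 0 := by
  -- The sector and the disc share the inner arc `|z| = r₀`, `|arg z| ≤ θ₀`; it cancels in the sum
  -- of the two Cauchy identities.
  have hJ : ∀ R, r₀ ≤ R →
      -(∫ r in r₀..R, g (r * Complex.exp (θ₀ * Complex.I)) * Complex.exp (θ₀ * Complex.I)) +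
        (∫ θ in θ₀..(2 * Real.pi - θ₀), g (r₀ * Complex.exp (θ * Complex.I)) *
          (Complex.I * r₀ * Complex.exp (θ * Complex.I))) +
        ∫ r in r₀..R, g (r * Complex.exp (-θ₀ * Complex.I)) * Complex.exp (-θ₀ * Complex.I) =
      -∫ θ in -θ₀..θ₀, g (R * Complex.exp (θ * Complex.I)) *
        (Complex.I * R * Complex.exp (θ * Complex.I)) := by
    intro R hR
    linear_combination integral_boundary_sector hr₀ h0 h2 hg hR +
      integral_arc_add_arc (θ₀ := θ₀) hr₀ hg
  have hlim : Filter.Tendsto (fun R : ℝ => -∫ θ in -θ₀..θ₀,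
      g (R * Complex.exp (θ * Complex.I)) * (Complex.I * R * Complex.exp (θ * Complex.I)))
      Filter.atTop (nhds 0) := by
    have hz : Filter.Tendsto (fun R : ℝ => |C| * (1 + R) ^ (-(ν - 1)) * |θ₀ - -θ₀|)
        Filter.atTop (nhds 0) := by
      have h1 := (tendsto_rpow_neg_atTop (y := ν - 1) (by linarith)).comp
        (Filter.tendsto_atTop_add_const_left Filter.atTop (1 : ℝ) Filter.tendsto_id)
      simpa using (h1.const_mul |C|).mul_const |θ₀ - -θ₀|
    refine squeeze_zero_norm' ?_ hz
    filter_upwards [Filter.eventually_ge_atTop (max R₀ r₀)] with R hR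
    have hR0 : 0 < R := hr₀.trans_le ((le_max_right _ _).trans hR)
    rw [norm_neg]
    refine intervalIntegral.norm_integral_le_of_norm_le_const fun θ hθ => ?_
    rw [Set.uIoc_of_le (by linarith)] at hθ
    have hm := exp_mem_region (r₀ := r₀) h2 hR0 (abs_le.2 ⟨hθ.1.le, hθ.2⟩)
    have h3 := hb _ hm (by
      rw [norm_ofReal_mul_exp hR0.le]; exact (le_max_left _ _).trans hR)
    rw [norm_ofReal_mul_exp hR0.le] at h3
    have h4 : ‖Complex.I * R * Complex.exp (θ * Complex.I)‖ = R := by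
      rw [mul_assoc, norm_mul, Complex.norm_I, one_mul, norm_ofReal_mul_exp hR0.le]
    have h5 : (1 + R) ^ (-(ν - 1)) = (1 + R) ^ (-ν) * (1 + R) := by
      rw [neg_sub, sub_eq_add_neg, add_comm 1 (-ν), Real.rpow_add (by positivity), Real.rpow_one]
    rw [norm_mul, h4, h5]
    calc _ ≤ C * (1 + R) ^ (-ν) * R := mul_le_mul_of_nonneg_right h3 hR0.le
      _ ≤ |C| * (1 + R) ^ (-ν) * R := by
        have : C ≤ |C| := le_abs_self C
        gcongr
      _ ≤ |C| * (1 + R) ^ (-ν) * (1 + R) :=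
        mul_le_mul_of_nonneg_left (by linarith) (by positivity)
      _ = _ := by ring
  have t1 := intervalIntegral_tendsto_integral_Ioi r₀
    (hi.1.mul_const (Complex.exp (θ₀ * Complex.I))) Filter.tendsto_id
  have t2 := intervalIntegral_tendsto_integral_Ioi r₀
    (hi.2.2.mul_const (Complex.exp (-θ₀ * Complex.I))) Filter.tendsto_id
  have t3 := (t1.neg.add_const (∫ θ in θ₀..(2 * Real.pi - θ₀),
    g (r₀ * Complex.exp (θ * Complex.I)) *
      (Complex.I * r₀ * Complex.exp (θ * Complex.I)))).add t2
  have t4 := tendsto_nhds_unique t3 (hlim.congr' (by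
    filter_upwards [Filter.eventually_ge_atTop r₀] with R hR
    exact (hJ R hR).symm))
  rw [contourInt, t4, mul_zero]

end Cauchy

end QuadraticPencil

namespace QuadraticPencil

/-! ### Cauchy's formula for the contour -/

section Dslope

variable {f : ℂ → ℂ} {p : ℂ}

lemma analyticAt_dslope (hf : AnalyticAt ℂ f p) : AnalyticAt ℂ (dslope f p) p :=
  ⟨_, hf.hasFPowerSeriesAt.has_fpower_series_dslope_fslope⟩

lemma analyticOnNhd_dslope {S : Set ℂ} (hf : AnalyticOnNhd ℂ f S) (hp : p ∈ S) :
    AnalyticOnNhd ℂ (dslope f p) S := by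
  intro z hz
  rcases eq_or_ne z p with rfl | hne
  · exact analyticAt_dslope (hf z hz)
  · refine AnalyticAt.congr (f := fun w => (w - p)⁻¹ * (f w - f p)) ?_ ?_
    · exact ((analyticAt_id.sub analyticAt_const).inv (sub_ne_zero.2 hne)).mul
        ((hf z hz).sub analyticAt_const)
    · filter_upwards [eventually_ne_nhds hne] with w hw
      rw [dslope_of_ne _ hw, slope_def_field, div_eq_inv_mul]

/-- The difference quotient at `p` shifts the Taylor coefficients at `p` by one. -/
lemma iteratedDeriv_dslope (hf : AnalyticAt ℂ f p) (k : ℕ) :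
    iteratedDeriv k (dslope f p) p / k.factorial =
      iteratedDeriv (k + 1) f p / (k + 1).factorial := by
  have h1 := hf.hasFPowerSeriesAt.has_fpower_series_dslope_fslope
  have h2 := (analyticAt_dslope hf).hasFPowerSeriesAt
  have h3 := congrArg (fun q => q.coeff k) (h2.eq_formalMultilinearSeries h1)
  simpa [FormalMultilinearSeries.coeff_fslope, FormalMultilinearSeries.coeff_ofScalars] using h3

end Dslope

section Cauchy

variable {r₀ θ₀ ν : ℝ} {f : ℂ → ℂ}

/-- `f` is holomorphic near the closed region to the right of the contour, and `O((1 + |z|)^{-ν})`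
on the contour and at infinity. -/
structure DecaysOn (r₀ θ₀ ν : ℝ) (f : ℂ → ℂ) : Prop where
  analytic : AnalyticOnNhd ℂ f (region r₀ θ₀)
  bound : ∃ C R₀ : ℝ, ∀ z ∈ region r₀ θ₀, z ∈ contour r₀ θ₀ ∨ R₀ ≤ ‖z‖ →
    ‖f z‖ ≤ C * (1 + ‖z‖) ^ (-ν)

lemma DecaysOn.mono {ν' : ℝ} (hf : DecaysOn r₀ θ₀ ν f) (h : ν' ≤ ν) : DecaysOn r₀ θ₀ ν' f := by
  obtain ⟨ha, C, R₀, hC⟩ := hf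
  refine ⟨ha, |C|, R₀, fun z hz hz' => (hC z hz hz').trans ?_⟩
  refine mul_le_mul (le_abs_self C) (Real.rpow_le_rpow_of_exponent_le ?_ (by linarith))
    (by positivity) (abs_nonneg C)
  linarith [norm_nonneg z]

lemma Admissible.decaysOn (hf : Admissible r₀ θ₀ ν f) : DecaysOn r₀ θ₀ ν f :=
  ⟨hf.1, hf.2.choose, 0, fun z hz _ => hf.2.choose_spec z hz⟩

lemma DecaysOn.sub {g : ℂ → ℂ} (hf : DecaysOn r₀ θ₀ ν f) (hg : DecaysOn r₀ θ₀ ν g) :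
    DecaysOn r₀ θ₀ ν (fun z => f z - g z) := by
  obtain ⟨ha, C, R, hC⟩ := hf
  obtain ⟨hb, C', R', hC'⟩ := hg
  refine ⟨ha.sub hb, C + C', max R R', fun z hz hz' => ?_⟩
  rw [add_mul]
  exact (norm_sub_le _ _).trans (add_le_add
    (hC z hz (hz'.imp_right (le_max_left _ _).trans))
    (hC' z hz (hz'.imp_right (le_max_right _ _).trans)))

lemma decaysOn_const (c : ℂ) : DecaysOn r₀ θ₀ 0 (fun _ => c) :=
  ⟨analyticOnNhd_const, ‖c‖, 0, fun z _ _ => by simp⟩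

lemma decaysOn_inv_add {t : ℝ} (hr₀ : 0 < r₀) (h0 : 0 ≤ θ₀) (h2 : θ₀ < Real.pi) (ht : r₀ < t)
    (c : ℂ) : DecaysOn r₀ θ₀ 1 (fun z => c * (z + t)⁻¹) := by
  obtain ⟨k, hk, hb⟩ := exists_le_norm_add h0 h2 ht hr₀
  refine ⟨fun z hz => analyticAt_const.mul ((analyticAt_id.add analyticAt_const).inv
    (Complex.slitPlane_ne_zero (add_mem_slitPlane hr₀ h2 ht hz))), ‖c‖ * k⁻¹, 0, fun z hz _ => ?_⟩
  rw [norm_mul, Real.rpow_neg_one, mul_assoc, ← mul_inv, norm_inv]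
  exact mul_le_mul_of_nonneg_left (inv_anti₀ (by positivity) (hb z hz)) (norm_nonneg c)

/-- When `f(p) = 0` the difference quotient is `f(z) / (z - p)`, which gains one order of decay
wherever `z - p` is comparable to `1 + |z|`. This is the case on the contour and for `|z| ≥ 2p + 1`,
which is why `DecaysOn` asks for bounds only there. -/
lemma DecaysOn.dslope_of_eq_zero (hr₀ : 0 < r₀) (h1 : Real.pi / 2 < θ₀) (h2 : θ₀ < Real.pi)
    (hf : DecaysOn r₀ θ₀ ν f) {p : ℝ} (hp : 0 ≤ p) (hfp : f p = 0) :
    DecaysOn r₀ θ₀ (ν + 1) (dslope f p) := by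
  obtain ⟨ha, C, R, hC⟩ := hf
  obtain ⟨K, hK0, hK⟩ := exists_norm_inv_sub_le hr₀ h1 h2
  refine ⟨analyticOnNhd_dslope ha (ofReal_mem_region (by linarith [Real.pi_pos]) hp), C * K,
    max R (2 * p + 1), fun z hz hz' => ?_⟩
  have b1 := hC z hz (hz'.imp_right (le_max_left _ _).trans)
  obtain ⟨hne, b2⟩ := hK p hp z (hz'.imp_right (le_max_right _ _).trans)
  rw [dslope_of_ne _ hne, slope_def_field, hfp, sub_zero, div_eq_mul_inv, norm_mul, ← neg_sub,
    inv_neg, norm_neg, neg_add, Real.rpow_add (by positivity), Real.rpow_neg_one]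
  calc _ ≤ (C * (1 + ‖z‖) ^ (-ν)) * (K * (1 + ‖z‖)⁻¹) :=
        mul_le_mul b1 b2 (norm_nonneg _) ((norm_nonneg _).trans b1)
    _ = _ := by ring

/-- `f - f(p)` has the same difference quotient and vanishes at `p`, but is only known to be
bounded, so the quotient decays to first order. -/
lemma DecaysOn.dslope (hr₀ : 0 < r₀) (h1 : Real.pi / 2 < θ₀) (h2 : θ₀ < Real.pi)
    (hf : DecaysOn r₀ θ₀ ν f) (hν : 0 ≤ ν) {p : ℝ} (hp : 0 ≤ p) :
    DecaysOn r₀ θ₀ 1 (dslope f p) := by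
  have h := ((hf.mono hν).sub (decaysOn_const (f p))).dslope_of_eq_zero hr₀ h1 h2 hp (sub_self _)
  rw [zero_add] at h
  have e : _root_.dslope (fun z => f z - f p) (p : ℂ) = _root_.dslope f p := by
    funext z
    rcases eq_or_ne z (p : ℂ) with rfl | hne
    · simp
    · simp [dslope_of_ne _ hne, slope_def_field]
  rwa [e] at h

lemma contourIntegrable_inv_pow_mul (hr₀ : 0 < r₀) (h1 : Real.pi / 2 < θ₀) (h2 : θ₀ < Real.pi)
    (hf : DecaysOn r₀ θ₀ ν f) {p : ℝ} (hp : 0 ≤ p) {n : ℕ} (hn : 1 < ν + n) :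
    ContourIntegrable r₀ θ₀ (fun z => ((p : ℂ) - z)⁻¹ ^ n * f z) := by
  obtain ⟨ha, C, R, hC⟩ := hf
  obtain ⟨K, hK0, hK⟩ := exists_norm_inv_sub_le hr₀ h1 h2
  have hsub := contour_subset_region hr₀ h1 h2
  refine contourIntegrable_of_norm_le h2 (ContinuousOn.mul (ContinuousOn.pow (ContinuousOn.inv₀
    (by fun_prop) fun z hz => sub_ne_zero.2 (hK p hp z (Or.inl hz)).1.symm) n)
    (ha.continuousOn.mono hsub)) (C := K ^ n * C) hn fun z hz => ?_
  have b1 := hC z (hsub hz) (Or.inl hz)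
  have b2 := (hK p hp z (Or.inl hz)).2
  rw [norm_mul, norm_pow, neg_add, Real.rpow_add (by positivity), Real.rpow_neg (by positivity) n,
    Real.rpow_natCast]
  calc _ ≤ (K * (1 + ‖z‖)⁻¹) ^ n * (C * (1 + ‖z‖) ^ (-ν)) :=
        mul_le_mul (pow_le_pow_left₀ (norm_nonneg _) b2 n) b1 (norm_nonneg _) (by positivity)
    _ = _ := by rw [mul_pow, inv_pow]; ring

lemma DecaysOn.contourInt_eq_zero (hr₀ : 0 < r₀) (h1 : Real.pi / 2 < θ₀) (h2 : θ₀ < Real.pi)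
    (hf : DecaysOn r₀ θ₀ ν f) (hν : 1 < ν) : contourInt r₀ θ₀ f = 0 := by
  have hi := contourIntegrable_inv_pow_mul hr₀ h1 h2 hf le_rfl (n := 0) (by simpa using hν)
  simp only [pow_zero, one_mul] at hi
  obtain ⟨ha, C, R, hC⟩ := hf
  exact QuadraticPencil.contourInt_eq_zero hr₀ (by linarith [Real.pi_pos]) h2 ha hi hν
    fun z hz hz' => hC z hz (Or.inr hz')

/-- From exponent two on, `(p - z)^{-(k+2)}` has the single-valued primitive `(p - z)^{-(k+1)} / (k
+ 1)`, which vanishes at infinity. -/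
lemma contourInt_inv_pow (hr₀ : 0 < r₀) (h1 : Real.pi / 2 < θ₀) (h2 : θ₀ < Real.pi)
    {p : ℝ} (hp : 0 ≤ p) (k : ℕ) :
    contourInt r₀ θ₀ (fun z => ((p : ℂ) - z)⁻¹ ^ (k + 2)) = 0 := by
  obtain ⟨K, hK0, hK⟩ := exists_norm_inv_sub_le hr₀ h1 h2
  have hi := contourIntegrable_inv_pow_mul hr₀ h1 h2 (decaysOn_const 1) hp (n := k + 2)
    (by push_cast; linarith [(Nat.cast_nonneg k : (0 : ℝ) ≤ k)])
  simp only [mul_one] at hi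
  have hlim : ∀ e : ℂ, ‖e‖ = 1 → (∀ r : ℝ, r₀ ≤ r → (r : ℂ) * e ∈ contour r₀ θ₀) →
      Filter.Tendsto (fun r : ℝ => ((k : ℂ) + 1)⁻¹ * ((p : ℂ) - r * e)⁻¹ ^ (k + 1))
        Filter.atTop (nhds 0) := by
    intro e he hm
    have h3 : Filter.Tendsto (fun r : ℝ => ((p : ℂ) - r * e)⁻¹) Filter.atTop (nhds 0) := by
      have hz : Filter.Tendsto (fun r : ℝ => K * (1 + r)⁻¹) Filter.atTop (nhds 0) := by
        simpa using (Filter.tendsto_atTop_add_const_left Filter.atTop (1 : ℝ)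
          Filter.tendsto_id).inv_tendsto_atTop.const_mul K
      refine squeeze_zero_norm' ?_ hz
      filter_upwards [Filter.eventually_ge_atTop r₀] with r hr
      have := (hK p hp _ (Or.inl (hm r hr))).2
      rwa [norm_mul, he, mul_one, Complex.norm_real,
        Real.norm_of_nonneg (hr₀.le.trans hr)] at this
    simpa using (h3.pow (k + 1)).const_mul ((k : ℂ) + 1)⁻¹
  rw [contourInt_of_hasDerivAt (G := fun z => ((k : ℂ) + 1)⁻¹ * ((p : ℂ) - z)⁻¹ ^ (k + 1)) h2 ?_ hi
    (hlim _ (Complex.norm_exp_ofReal_mul_I θ₀) fun r hr => ray_mem_contour hr)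
    (hlim _ (by rw [← Complex.ofReal_neg, Complex.norm_exp_ofReal_mul_I])
      fun r hr => ray_mem_contour' hr)]
  · ring
  · intro z hz
    have hne : (p : ℂ) - z ≠ 0 := sub_ne_zero.2 (hK p hp z (Or.inl hz)).1.symm
    have hk : (k : ℂ) + 1 ≠ 0 := Nat.cast_add_one_ne_zero k
    refine HasDerivAt.congr_deriv (((((hasDerivAt_id' z).const_sub (p : ℂ)).inv hne).pow
      (k + 1)).const_mul ((k : ℂ) + 1)⁻¹) ?_
    simp only [Nat.add_sub_cancel, Pi.inv_apply]
    push_cast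
    field_simp
    rw [pow_add, one_div, inv_pow _ 2, mul_left_comm, mul_inv_cancel₀ (pow_ne_zero 2 hne), mul_one]

/-- A simple pole alone decays too slowly. The factor `(p + t) / (z + t)`, equal to `1` at `p`,
makes the integrand `1 / (p - z) + 1 / (z + t)`, with primitive `-log (p - z) + log (z + t)`.
Principal branches are admissible because `Re (p - z) > 0` and `z + t` avoids the negative axis on
the contour. -/
lemma contourInt_inv_mul_inv (hr₀ : 0 < r₀) (h1 : Real.pi / 2 < θ₀) (h2 : θ₀ < Real.pi)
    {p t : ℝ} (hp : 0 ≤ p) (ht : r₀ < t) :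
    contourInt r₀ θ₀ (fun z => ((p : ℂ) - z)⁻¹ ^ 1 * (((p : ℂ) + t) * (z + t)⁻¹)) = -1 := by
  have h0 : 0 < θ₀ := by linarith [Real.pi_pos]
  have hsub := contour_subset_region hr₀ h1 h2
  have hi := contourIntegrable_inv_pow_mul hr₀ h1 h2
    (decaysOn_inv_add hr₀ h0.le h2 ht ((p : ℂ) + t)) hp (n := 1) (by norm_num)
  -- The `log r` of the two logarithms cancel and their arguments remain: `φ` is the argument of
  -- `-e^{iθ}` in `(-π, π)`. The limit is `iπ` for `θ = θ₀` and `-iπ` for `θ = -θ₀`.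
  have hlim : ∀ θ φ : ℝ, |θ| < Real.pi → |φ| < Real.pi →
      Complex.exp (φ * Complex.I) = -Complex.exp (θ * Complex.I) →
      Filter.Tendsto (fun r : ℝ => -Complex.log ((p : ℂ) - r * Complex.exp (θ * Complex.I)) +
        Complex.log (r * Complex.exp (θ * Complex.I) + t)) Filter.atTop
        (nhds (-(φ * Complex.I) + θ * Complex.I)) := by
    intro θ φ hθ hφ he
    have hlog : ∀ ψ : ℝ, |ψ| < Real.pi →
        Complex.log (Complex.exp (ψ * Complex.I)) = ψ * Complex.I ∧
        Complex.exp (ψ * Complex.I) ∈ Complex.slitPlane := by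
      intro ψ hψ
      rw [abs_lt] at hψ
      have h3 : Complex.log (Complex.exp (ψ * Complex.I)) = ψ * Complex.I := by
        rw [Complex.log_exp] <;> simp <;> linarith
      refine ⟨h3, Complex.mem_slitPlane_iff_arg.2 ⟨?_, Complex.exp_ne_zero _⟩⟩
      rw [← Complex.log_im, h3]
      simpa using hψ.2.ne
    have hinv : ∀ s : ℝ, Filter.Tendsto (fun r : ℝ => (s : ℂ) * ((r⁻¹ : ℝ) : ℂ)) Filter.atTop
        (nhds 0) := fun s => by
      simpa using ((Complex.continuous_ofReal.tendsto 0).comp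
        tendsto_inv_atTop_zero).const_mul (s : ℂ)
    have l1 : Filter.Tendsto (fun r : ℝ => (p : ℂ) * ((r⁻¹ : ℝ) : ℂ) - Complex.exp (θ * Complex.I))
        Filter.atTop (nhds (Complex.exp (φ * Complex.I))) := by
      simpa [he] using (hinv p).sub_const (Complex.exp (θ * Complex.I))
    have l2 : Filter.Tendsto (fun r : ℝ => Complex.exp (θ * Complex.I) + (t : ℂ) * ((r⁻¹ : ℝ) : ℂ))
        Filter.atTop (nhds (Complex.exp (θ * Complex.I))) := by
      simpa using (hinv t).const_add (Complex.exp (θ * Complex.I))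
    have l3 := (l1.clog (hlog φ hφ).2).neg.add (l2.clog (hlog θ hθ).2)
    rw [(hlog φ hφ).1, (hlog θ hθ).1] at l3
    refine l3.congr' ?_
    filter_upwards [Filter.eventually_gt_atTop 0, l1.eventually_ne (Complex.exp_ne_zero _),
      l2.eventually_ne (Complex.exp_ne_zero _)] with r hr n1 n2
    have hr' : (r : ℂ) ≠ 0 := by exact_mod_cast hr.ne'
    have e1 : (p : ℂ) - r * Complex.exp (θ * Complex.I) =
        r * ((p : ℂ) * ((r⁻¹ : ℝ) : ℂ) - Complex.exp (θ * Complex.I)) := by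
      push_cast
      field_simp
    have e2 : r * Complex.exp (θ * Complex.I) + t =
        r * (Complex.exp (θ * Complex.I) + (t : ℂ) * ((r⁻¹ : ℝ) : ℂ)) := by
      push_cast
      field_simp
    rw [e1, e2, Complex.log_ofReal_mul hr n1, Complex.log_ofReal_mul hr n2]
    ring
  have a := hlim θ₀ (θ₀ - Real.pi) (by rwa [abs_of_pos h0]) (by rw [abs_lt]; constructor <;> linarith)
    (by
      push_cast
      rw [sub_mul, Complex.exp_sub, Complex.exp_pi_mul_I, div_neg, div_one])
  have b := hlim (-θ₀) (Real.pi - θ₀) (by rwa [abs_neg, abs_of_pos h0])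
    (by rw [abs_lt]; constructor <;> linarith)
    (by
      push_cast
      rw [sub_mul, sub_eq_add_neg, Complex.exp_add, Complex.exp_pi_mul_I, neg_mul, neg_mul,
        one_mul])
  simp only [Complex.ofReal_neg] at b
  rw [contourInt_of_hasDerivAt (G := fun z => -Complex.log ((p : ℂ) - z) + Complex.log (z + t))
    h2 ?_ hi a b]
  · have hpi : (Real.pi : ℂ) ≠ 0 := by exact_mod_cast Real.pi_pos.ne'
    have hI := Complex.I_ne_zero
    push_cast
    field_simp
    ring
  · intro z hz
    have hre := sub_re_pos_of_mem_contour hr₀ h1 h2 hz hp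
    have hs1 : (p : ℂ) - z ∈ Complex.slitPlane := Or.inl hre
    have hs2 := add_mem_slitPlane hr₀ h2 ht (hsub hz)
    have n1 := Complex.slitPlane_ne_zero hs1
    have n2 := Complex.slitPlane_ne_zero hs2
    refine HasDerivAt.congr_deriv ((((hasDerivAt_id' z).const_sub (p : ℂ)).clog hs1).neg.add
      (((hasDerivAt_id' z).add_const (t : ℂ)).clog hs2)) ?_
    field_simp
    ring

/-- Cauchy's formula for the derivatives of a function that decays in the region. -/
theorem contourInt_inv_pow_mul (hr₀ : 0 < r₀) (h1 : Real.pi / 2 < θ₀) (h2 : θ₀ < Real.pi)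
    (hf : DecaysOn r₀ θ₀ ν f) (hν : 0 < ν) {p : ℝ} (hp : 0 ≤ p) (k : ℕ) :
    contourInt r₀ θ₀ (fun z => ((p : ℂ) - z)⁻¹ ^ (k + 1) * f z) =
      (-1) ^ (k + 1) * (iteratedDeriv k f p / k.factorial) := by
  have h0 : 0 < θ₀ := by linarith [Real.pi_pos]
  obtain ⟨K, -, hK⟩ := exists_norm_inv_sub_le hr₀ h1 h2
  have hne : ∀ z ∈ contour r₀ θ₀, (p : ℂ) - z ≠ 0 := fun z hz =>
    sub_ne_zero.2 (hK p hp z (Or.inl hz)).1.symm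
  have hcpos : ∀ k : ℕ, (0 : ℝ) ≤ k := fun k => Nat.cast_nonneg k
  induction k generalizing f ν with
  | zero =>
    -- Base case: subtracting `f(p) (p + t) / (z + t)` removes the value at `p` and keeps some decay
    -- `ν' > 0`. The quotient by `z - p` then decays faster than first order and integrates to zero;
    -- the subtracted part is explicit. Any `t > r₀` would do.
    set t := r₀ + 1 with htdef
    have ht : r₀ < t := by linarith
    have hpt : (p : ℂ) + t ≠ 0 := by
      have : p + t ≠ 0 := by linarith
      exact_mod_cast this
    have hd := decaysOn_inv_add hr₀ h0.le h2 ht ((p : ℂ) + t)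
    set ν' := min ν 1
    have hF : DecaysOn r₀ θ₀ ν' (fun z => f z - f p * ((p + t) * (z + t)⁻¹)) := by
      refine (hf.mono (min_le_left _ _)).sub ?_
      have := decaysOn_inv_add hr₀ h0.le h2 ht (f p * (p + t))
      simp only [mul_assoc] at this
      exact this.mono (min_le_right _ _)
    have hdF := hF.dslope_of_eq_zero hr₀ h1 h2 hp (by rw [mul_inv_cancel₀ hpt]; ring)
    have hν' : 0 < ν' := lt_min hν one_pos
    have hi1 := contourIntegrable_inv_pow_mul hr₀ h1 h2 hdF hp (n := 0) (by push_cast; linarith)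
    have hi2 := contourIntegrable_inv_pow_mul hr₀ h1 h2 hd hp (n := 1) (by norm_num)
    rw [contourInt_congr (G := fun z => f p * (((p : ℂ) - z)⁻¹ ^ 1 * (((p : ℂ) + t) * (z + t)⁻¹)) +
      (-1) * (((p : ℂ) - z)⁻¹ ^ 0 * dslope (fun z => f z - f p * ((p + t) * (z + t)⁻¹)) p z)) ?_ h2,
      contourInt_add (hi2.const_mul _) (hi1.const_mul _), contourInt_const_mul,
      contourInt_const_mul, contourInt_inv_mul_inv hr₀ h1 h2 hp ht]
    · simp only [pow_zero, one_mul]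
      rw [hdF.contourInt_eq_zero hr₀ h1 h2 (by linarith)]
      simp
    · intro z hz
      have hz' := hne z hz
      simp only [zero_add, pow_one, pow_zero, one_mul]
      rw [dslope_of_ne _ (sub_ne_zero.1 hz').symm, slope_def_field, mul_inv_cancel₀ hpt, mul_one,
        sub_self, sub_zero, ← neg_sub (p : ℂ) z, div_neg, div_eq_mul_inv]
      ring
  | succ k ih =>
    -- Inductive step: `f(z) = f(p) - (p - z) dslope f p z` lowers the order of the pole by one, and
    -- the induction hypothesis applies to the difference quotient, whose decay exponent is `1`.
    have hd := hf.dslope hr₀ h1 h2 hν.le hp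
    have hi1 := contourIntegrable_inv_pow_mul hr₀ h1 h2 hd hp (n := k + 1)
      (by push_cast; linarith [hcpos k])
    have hi2 := contourIntegrable_inv_pow_mul hr₀ h1 h2 (decaysOn_const 1) hp (n := k + 2)
      (by push_cast; linarith [hcpos k])
    simp only [mul_one] at hi2
    rw [contourInt_congr (G := fun z => f p * ((p : ℂ) - z)⁻¹ ^ (k + 2) +
      (-1) * (((p : ℂ) - z)⁻¹ ^ (k + 1) * dslope f p z)) ?_ h2,
      contourInt_add (hi2.const_mul _) (hi1.const_mul _), contourInt_const_mul,
      contourInt_const_mul, contourInt_inv_pow hr₀ h1 h2 hp, ih hd one_pos,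
      iteratedDeriv_dslope (hf.analytic _ (ofReal_mem_region h0.le hp))]
    · ring
    · intro z hz
      have hz' := hne z hz
      simp only
      rw [dslope_of_ne _ (sub_ne_zero.1 hz').symm, slope_def_field, ← neg_sub (p : ℂ) z, div_neg, div_eq_mul_inv]
      ring

end Cauchy

end QuadraticPencil

namespace QuadraticPencil

/-! ### The density of `C_4` -/

section Density

variable {d : ℕ} {r₀ θ₀ ν : ℝ} {f : ℂ → ℂ}

lemma symbL_ne_zero_of_re_pos {P : MvPolynomial (Fin d) ℝ} {z : ℂ}
    (h : ∀ x, 0 < (((MvPolynomial.eval x P : ℝ) : ℂ) - z).re) (x ξ : Fin d → ℝ) :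
    symbL P z x ξ ≠ 0 := by
  have := (norm_inv_polyXi_le (h x) ξ).1
  rwa [pe_polyXi] at this

lemma DecaysOn.sub_mul (hf : DecaysOn r₀ θ₀ ν f) (p : ℝ) :
    DecaysOn r₀ θ₀ (ν - 1) (fun z => ((p : ℂ) - z) * f z) := by
  obtain ⟨ha, C, R, hC⟩ := hf
  refine ⟨(analyticOnNhd_const.sub analyticOnNhd_id).mul ha, (1 + |p|) * C, R, fun z hz hz' => ?_⟩
  have b1 := hC z hz hz'
  have b2 : ‖(p : ℂ) - z‖ ≤ (1 + |p|) * (1 + ‖z‖) := by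
    refine (norm_sub_le _ _).trans ?_
    rw [Complex.norm_real, Real.norm_eq_abs]
    nlinarith [abs_nonneg p, norm_nonneg z]
  rw [norm_mul, show -(ν - 1) = 1 + -ν by ring, Real.rpow_add (by positivity), Real.rpow_one]
  calc _ ≤ ((1 + |p|) * (1 + ‖z‖)) * (C * (1 + ‖z‖) ^ (-ν)) :=
        mul_le_mul b2 b1 (norm_nonneg _) (by positivity)
    _ = _ := by ring

/-- The coefficient of `Q^{-(k+1)}` in `Q ∫ K_4 dξ` is multiplied by `-2 (-1)^{k+1} / k!` and
attached to `f^{(k)}(P(x))`. -/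
lemma C4density_five {P : MvPolynomial (Fin 5) ℝ} (hP : ∀ x, 0 ≤ MvPolynomial.eval x P)
    (hr₀ : 0 < r₀) (h1 : Real.pi / 2 < θ₀) (h2 : θ₀ < Real.pi) (hf : DecaysOn r₀ θ₀ ν f)
    (hν : 0 < ν) (x : Fin 5 → ℝ) :
    (∀ z ∈ contour r₀ θ₀, Integrable (K4 P z x)) ∧
    ContourIntegrable r₀ θ₀ (C4integrand P f x) ∧
    C4density P r₀ θ₀ f x =
      ((-(Real.pi ^ 3 / 30) * MvPolynomial.eval x (polyLap (polyLap P)) : ℝ) : ℂ) * fk P f 0 x +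
      ((-(Real.pi ^ 3 / 15) * MvPolynomial.eval x (polyGrad (polyLap P) P) -
        Real.pi ^ 3 / 20 * MvPolynomial.eval x (polyLap P) ^ 2 : ℝ) : ℂ) * fk P f 1 x +
      ((-(Real.pi ^ 3 / 40) * (MvPolynomial.eval x (polyLap P) *
        MvPolynomial.eval x (polyGrad P P)) +
        Real.pi ^ 3 / 60 * MvPolynomial.eval x (polyHessGrad P) : ℝ) : ℂ) * fk P f 2 x +
      ((Real.pi ^ 3 / 160 * MvPolynomial.eval x (polyGrad P P) ^ 2 : ℝ) : ℂ) * fk P f 3 x := by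
  have hre : ∀ z ∈ contour r₀ θ₀, ∀ x, 0 < (((MvPolynomial.eval x P : ℝ) : ℂ) - z).re :=
    fun z hz x => sub_re_pos_of_mem_contour hr₀ h1 h2 hz (hP x)
  have hL : ∀ z ∈ contour r₀ θ₀, ∀ x ξ, symbL P z x ξ ≠ 0 := fun z hz =>
    symbL_ne_zero_of_re_pos (hre z hz)
  have hi : ∀ k : ℕ, ContourIntegrable r₀ θ₀
      (fun z => (((MvPolynomial.eval x P : ℝ) : ℂ) - z)⁻¹ ^ (k + 1) * f z) := fun k =>
    contourIntegrable_inv_pow_mul hr₀ h1 h2 hf (hP x)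
      (by push_cast; linarith [(Nat.cast_nonneg k : (0 : ℝ) ≤ k)])
  have hc := contourInt_inv_pow_mul hr₀ h1 h2 hf hν (hP x)
  have heq : Set.EqOn (fun z => ((
      ((-(Real.pi ^ 3 / 60) * MvPolynomial.eval x (polyLap (polyLap P)) : ℝ) : ℂ) *
        ((((MvPolynomial.eval x P : ℝ) : ℂ) - z)⁻¹ ^ (0 + 1) * f z) +
      ((Real.pi ^ 3 / 30 * MvPolynomial.eval x (polyGrad (polyLap P) P) +
        Real.pi ^ 3 / 40 * MvPolynomial.eval x (polyLap P) ^ 2 : ℝ) : ℂ) *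
        ((((MvPolynomial.eval x P : ℝ) : ℂ) - z)⁻¹ ^ (1 + 1) * f z)) +
      ((-(Real.pi ^ 3 / 40) * (MvPolynomial.eval x (polyLap P) *
        MvPolynomial.eval x (polyGrad P P)) +
        Real.pi ^ 3 / 60 * MvPolynomial.eval x (polyHessGrad P) : ℝ) : ℂ) *
        ((((MvPolynomial.eval x P : ℝ) : ℂ) - z)⁻¹ ^ (2 + 1) * f z)) +
      ((-(3 * Real.pi ^ 3 / 160) * MvPolynomial.eval x (polyGrad P P) ^ 2 : ℝ) : ℂ) *
        ((((MvPolynomial.eval x P : ℝ) : ℂ) - z)⁻¹ ^ (3 + 1) * f z))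
      (C4integrand P f x) (contour r₀ θ₀) := by
    intro z hz
    simp only [C4integrand]
    rw [mul_integral_K4_five (hL z hz) x (hre z hz x) rfl]
    ring
  have i0 := (hi 0).const_mul
    ((-(Real.pi ^ 3 / 60) * MvPolynomial.eval x (polyLap (polyLap P)) : ℝ) : ℂ)
  have i1 := (hi 1).const_mul ((Real.pi ^ 3 / 30 * MvPolynomial.eval x (polyGrad (polyLap P) P) +
        Real.pi ^ 3 / 40 * MvPolynomial.eval x (polyLap P) ^ 2 : ℝ) : ℂ)
  have i2 := (hi 2).const_mul ((-(Real.pi ^ 3 / 40) * (MvPolynomial.eval x (polyLap P) *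
        MvPolynomial.eval x (polyGrad P P)) +
        Real.pi ^ 3 / 60 * MvPolynomial.eval x (polyHessGrad P) : ℝ) : ℂ)
  have i3 := (hi 3).const_mul
    ((-(3 * Real.pi ^ 3 / 160) * MvPolynomial.eval x (polyGrad P P) ^ 2 : ℝ) : ℂ)
  refine ⟨fun z hz => (integral_K4_eval (hL z hz) (by norm_num) x (hre z hz x)
    rfl rfl rfl rfl rfl rfl rfl).1, (((i0.add i1).add i2).add i3).congr heq h2, ?_⟩
  rw [C4density, ← contourInt_congr heq h2, contourInt_add ((i0.add i1).add i2) i3,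
    contourInt_add (i0.add i1) i2, contourInt_add i0 i1, contourInt_const_mul,
    contourInt_const_mul, contourInt_const_mul, contourInt_const_mul, hc 0, hc 1, hc 2, hc 3]
  simp only [fk, Nat.factorial]
  push_cast
  ring

/-- The terms in `Q` and `1` lead to holomorphic integrands without pole and integrate to zero; with
them go `Δ²P`, `∇ΔP·∇P`, `(ΔP)²` and `|D²P|²`. The condition `ν > 2` is what `Q f` needs. -/
lemma C4density_seven {P : MvPolynomial (Fin 7) ℝ} (hP : ∀ x, 0 ≤ MvPolynomial.eval x P)
    (hr₀ : 0 < r₀) (h1 : Real.pi / 2 < θ₀) (h2 : θ₀ < Real.pi) (hf : DecaysOn r₀ θ₀ ν f)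
    (hν : 2 < ν) (x : Fin 7 → ℝ) :
    (∀ z ∈ contour r₀ θ₀, Integrable (K4 P z x)) ∧
    ContourIntegrable r₀ θ₀ (C4integrand P f x) ∧
    C4density P r₀ θ₀ f x =
      ((7 * Real.pi ^ 4 / 90 * (MvPolynomial.eval x (polyLap P) *
        MvPolynomial.eval x (polyGrad P P)) +
        7 * Real.pi ^ 4 / 45 * MvPolynomial.eval x (polyHessGrad P) : ℝ) : ℂ) * fk P f 0 x +
      ((7 * Real.pi ^ 4 / 120 * MvPolynomial.eval x (polyGrad P P) ^ 2 : ℝ) : ℂ) * fk P f 1 x := by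
  have hre : ∀ z ∈ contour r₀ θ₀, ∀ x, 0 < (((MvPolynomial.eval x P : ℝ) : ℂ) - z).re :=
    fun z hz x => sub_re_pos_of_mem_contour hr₀ h1 h2 hz (hP x)
  have hL : ∀ z ∈ contour r₀ θ₀, ∀ x ξ, symbL P z x ξ ≠ 0 := fun z hz =>
    symbL_ne_zero_of_re_pos (hre z hz)
  have hi : ∀ k : ℕ, ContourIntegrable r₀ θ₀
      (fun z => (((MvPolynomial.eval x P : ℝ) : ℂ) - z)⁻¹ ^ k * f z) := fun k =>
    contourIntegrable_inv_pow_mul hr₀ h1 h2 hf (hP x)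
      (by linarith [(Nat.cast_nonneg k : (0 : ℝ) ≤ k)])
  have hQ := hf.sub_mul (MvPolynomial.eval x P)
  have hiQ := contourIntegrable_inv_pow_mul hr₀ h1 h2 hQ (hP x) (n := 0)
    (by push_cast; linarith)
  have hc := contourInt_inv_pow_mul hr₀ h1 h2 hf (by linarith) (hP x)
  have hi0 := hi 0
  simp only [pow_zero, one_mul] at hiQ hi0
  set c0 := ((-(Real.pi ^ 4 / 30) * MvPolynomial.eval x (polyLap (polyLap P)) : ℝ) : ℂ) with hc0
  set c1 := ((-(Real.pi ^ 4 / 15) * MvPolynomial.eval x (polyGrad (polyLap P) P) -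
        Real.pi ^ 4 / 180 * MvPolynomial.eval x (polyLap P) ^ 2 -
        2 * Real.pi ^ 4 / 45 * MvPolynomial.eval x (polyHessSq P) : ℝ) : ℂ) with hc1
  have heq : Set.EqOn (fun z => ((
      c0 * ((((MvPolynomial.eval x P : ℝ) : ℂ) - z) * f z) + c1 * f z) +
      ((7 * Real.pi ^ 4 / 180 * (MvPolynomial.eval x (polyLap P) *
        MvPolynomial.eval x (polyGrad P P)) +
        7 * Real.pi ^ 4 / 90 * MvPolynomial.eval x (polyHessGrad P) : ℝ) : ℂ) *
        ((((MvPolynomial.eval x P : ℝ) : ℂ) - z)⁻¹ ^ (0 + 1) * f z)) +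
      ((-(7 * Real.pi ^ 4 / 240) * MvPolynomial.eval x (polyGrad P P) ^ 2 : ℝ) : ℂ) *
        ((((MvPolynomial.eval x P : ℝ) : ℂ) - z)⁻¹ ^ (1 + 1) * f z))
      (C4integrand P f x) (contour r₀ θ₀) := by
    intro z hz
    simp only [C4integrand]
    rw [mul_integral_K4_seven (hL z hz) x (hre z hz x) rfl, ← hc0, ← hc1]
    ring
  have i0 := hiQ.const_mul c0
  have i1 := hi0.const_mul c1
  have i2 := (hi (0 + 1)).const_mul ((7 * Real.pi ^ 4 / 180 * (MvPolynomial.eval x (polyLap P) *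
        MvPolynomial.eval x (polyGrad P P)) +
        7 * Real.pi ^ 4 / 90 * MvPolynomial.eval x (polyHessGrad P) : ℝ) : ℂ)
  have i3 := (hi (1 + 1)).const_mul
    ((-(7 * Real.pi ^ 4 / 240) * MvPolynomial.eval x (polyGrad P P) ^ 2 : ℝ) : ℂ)
  refine ⟨fun z hz => (integral_K4_eval (hL z hz) (by norm_num) x (hre z hz x)
    rfl rfl rfl rfl rfl rfl rfl).1, (((i0.add i1).add i2).add i3).congr heq h2, ?_⟩
  rw [C4density, ← contourInt_congr heq h2, contourInt_add ((i0.add i1).add i2) i3,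
    contourInt_add (i0.add i1) i2, contourInt_add i0 i1, contourInt_const_mul,
    contourInt_const_mul, contourInt_const_mul, contourInt_const_mul, hc 0, hc 1,
    hQ.contourInt_eq_zero hr₀ h1 h2 (by linarith), hf.contourInt_eq_zero hr₀ h1 h2 (by linarith)]
  simp only [fk, Nat.factorial]
  push_cast
  ring

end Density

end QuadraticPencil

namespace QuadraticPencil

/-! ### Growth of elliptic polynomials -/

section Elliptic

variable {d : ℕ}

lemma eval_smul_of_isHomogeneous {q : MvPolynomial (Fin d) ℝ} {n : ℕ} (hq : q.IsHomogeneous n)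
    (c : ℝ) (x : Fin d → ℝ) :
    MvPolynomial.eval (c • x) q = c ^ n * MvPolynomial.eval x q := by
  rw [MvPolynomial.eval_eq', MvPolynomial.eval_eq', Finset.mul_sum]
  refine Finset.sum_congr rfl fun s hs => ?_
  have h1 : ∑ i, s i = n := by
    have := hq (MvPolynomial.mem_support_iff.1 hs)
    rw [Finsupp.weight_apply, Finsupp.sum_fintype _ _ fun _ => by simp] at this
    simpa using this
  simp only [Pi.smul_apply, smul_eq_mul, mul_pow, Finset.prod_mul_distrib,
    Finset.prod_pow_eq_pow_sum, h1]
  ring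

lemma totalDegree_sub_homogeneousComponent (P : MvPolynomial (Fin d) ℝ) {m : ℕ}
    (hm : P.totalDegree ≤ m) :
    (P - MvPolynomial.homogeneousComponent m P).totalDegree ≤ m - 1 := by
  refine Finset.sup_le fun s hs => ?_
  rw [MvPolynomial.mem_support_iff, MvPolynomial.coeff_sub,
    MvPolynomial.coeff_homogeneousComponent] at hs
  have h1 : s.degree ≠ m := fun h => by simp [h] at hs
  rw [if_neg h1, sub_zero] at hs
  have h2 := MvPolynomial.le_totalDegree (MvPolynomial.mem_support_iff.2 hs)
  have h3 : s.degree = s.sum fun _ e => e := rfl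
  omega

lemma norm_eval_le (p : MvPolynomial (Fin d) ℝ) {k : ℕ} (hk : p.totalDegree ≤ k) :
    ∃ C : ℝ, 0 ≤ C ∧ ∀ y : Fin d → ℝ, |MvPolynomial.eval y p| ≤ C * (1 + ‖y‖) ^ k := by
  obtain ⟨C, hC0, hC⟩ := norm_pe_le (MvPolynomial.map Complex.ofRealHom p) (k := k)
    ((Finset.sup_mono (MvPolynomial.support_map_subset _ _)).trans hk)
  refine ⟨C, hC0, fun y => ?_⟩
  have := hC y
  rwa [pe_map, Complex.norm_real, Real.norm_eq_abs] at this

/-- By homogeneity and compactness of the sphere, the leading part is at least `a ‖x‖^m`, and it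
absorbs the lower-order terms for large `x`. For bounded `x`, the assumption `P ≥ 0` is enough. -/
lemma exists_le_one_add_eval (hd : 0 < d) {P : MvPolynomial (Fin d) ℝ} {m : ℕ}
    (hP : IsPositiveElliptic P m) (h0 : ∀ x, 0 ≤ MvPolynomial.eval x P) :
    ∃ c > 0, ∀ x : Fin d → ℝ, c * (1 + ‖x‖) ^ m ≤ 1 + MvPolynomial.eval x P := by
  have : Nonempty (Fin d) := ⟨⟨0, hd⟩⟩
  have hcomp : IsCompact (Metric.sphere (0 : Fin d → ℝ) 1) := isCompact_sphere _ _
  have hne : (Metric.sphere (0 : Fin d → ℝ) 1).Nonempty := NormedSpace.sphere_nonempty.2 zero_le_one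
  obtain ⟨u, hu, hmin⟩ := hcomp.exists_isMinOn hne (MvPolynomial.continuous_eval
    (MvPolynomial.homogeneousComponent m P)).continuousOn
  set a := MvPolynomial.eval u (MvPolynomial.homogeneousComponent m P)
  have ha : 0 < a := hP.leading_pos u fun h => by simp [h] at hu
  have hlead : ∀ x : Fin d → ℝ,
      a * ‖x‖ ^ m ≤ MvPolynomial.eval x (MvPolynomial.homogeneousComponent m P) := by
    intro x
    rcases eq_or_ne x 0 with rfl | hx
    · have := eval_smul_of_isHomogeneous (MvPolynomial.homogeneousComponent_isHomogeneous m P) 0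
        (0 : Fin d → ℝ)
      have hm := hP.two_le
      rw [smul_zero, zero_pow (by omega), zero_mul] at this
      rw [this, norm_zero, zero_pow (by omega), mul_zero]
    · have hx' : 0 < ‖x‖ := norm_pos_iff.2 hx
      have h1 : ‖x‖⁻¹ • x ∈ Metric.sphere (0 : Fin d → ℝ) 1 := by
        rw [mem_sphere_zero_iff_norm, norm_smul, norm_inv, norm_norm, inv_mul_cancel₀ hx'.ne']
      have h2 := isMinOn_iff.1 hmin _ h1
      rw [eval_smul_of_isHomogeneous (MvPolynomial.homogeneousComponent_isHomogeneous m P)] at h2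
      have h3 := mul_le_mul_of_nonneg_right h2 (pow_nonneg hx'.le m)
      rwa [mul_right_comm, ← mul_pow, inv_mul_cancel₀ hx'.ne', one_pow, one_mul] at h3
  obtain ⟨C, hC0, hC⟩ := norm_eval_le _
    (totalDegree_sub_homogeneousComponent P hP.totalDegree_eq.le)
  -- Beyond `M`, the bound `M ≥ 2` gives `‖x‖ ≥ (1 + ‖x‖) / 2`, and the other entry makes the
  -- remainder at most half of the leading term.
  set M := max 2 (2 * C * 2 ^ m / a) with hM
  have hM2 : 2 ≤ M := le_max_left _ _
  refine ⟨min (a / 2 ^ m / 2) (M ^ m)⁻¹, lt_min (by positivity) (by positivity), fun x => ?_⟩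
  set s := 1 + ‖x‖ with hs
  have hs1 : 1 ≤ s := by linarith [norm_nonneg x]
  by_cases hsM : s ≤ M
  · calc _ ≤ (M ^ m)⁻¹ * M ^ m := mul_le_mul (min_le_right _ _)
          (pow_le_pow_left₀ (by linarith) hsM m) (by positivity) (by positivity)
      _ = 1 := inv_mul_cancel₀ (by positivity)
      _ ≤ _ := by linarith [h0 x]
  · push Not at hsM
    have h1 : s / 2 ≤ ‖x‖ := by linarith
    have h2 : a / 2 ^ m * s ^ m ≤ a * ‖x‖ ^ m := by
      rw [div_mul_eq_mul_div, mul_div_assoc, ← div_pow]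
      exact mul_le_mul_of_nonneg_left (pow_le_pow_left₀ (by linarith) h1 m) ha.le
    have h3 : C * s ^ (m - 1) ≤ a / 2 ^ m / 2 * s ^ m := by
      have h4 : 2 * C * 2 ^ m / a ≤ s := (le_max_right _ _).trans hsM.le
      rw [div_le_iff₀ ha] at h4
      have h5 : C ≤ a / 2 ^ m / 2 * s := by
        rw [div_div, div_mul_eq_mul_div, le_div_iff₀ (by positivity)]
        linarith
      have h6 : s ^ m = s * s ^ (m - 1) := by
        rw [← pow_succ', Nat.sub_add_cancel (by have := hP.two_le; omega)]
      rw [h6, ← mul_assoc]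
      exact mul_le_mul_of_nonneg_right h5 (by positivity)
    have h7 := hC x
    rw [map_sub] at h7
    have h8 := neg_le_of_abs_le h7
    have h9 := hlead x
    calc _ ≤ a / 2 ^ m / 2 * s ^ m :=
          mul_le_mul_of_nonneg_right (min_le_left _ _) (by positivity)
      _ = a / 2 ^ m * s ^ m - a / 2 ^ m / 2 * s ^ m := by ring
      _ ≤ 1 + MvPolynomial.eval x P := by linarith

end Elliptic

/-! ### Derivatives of admissible functions -/

section Derivatives

variable {r₀ θ₀ μ : ℝ} {f : ℂ → ℂ}

lemma ball_subset_region (h1 : Real.pi / 2 < θ₀) {p : ℝ} (hp : 0 ≤ p) {z : ℂ}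
    (hz : ‖z - p‖ ≤ r₀ / 2) : z ∈ region r₀ θ₀ := by
  have h3 : |z.re - p| ≤ r₀ / 2 := by
    have := (Complex.abs_re_le_norm (z - p)).trans hz
    simpa using this
  rcases le_or_gt 0 z.re with h | h
  · exact Or.inr ((Complex.abs_arg_le_pi_div_two_iff.2 h).trans h1.le)
  · left
    have h4 := norm_sub_norm_le z (p : ℂ)
    rw [Complex.norm_real, Real.norm_of_nonneg hp] at h4
    have h5 := neg_le_of_abs_le h3
    linarith

/-- Cauchy's estimates on discs of a fixed radius around the points of `[0, ∞)`: the derivatives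
inherit the decay exponent of `f`. -/
lemma Admissible.exists_norm_iteratedDeriv_le (hf : Admissible r₀ θ₀ μ f) (hr₀ : 0 < r₀)
    (h1 : Real.pi / 2 < θ₀) (hμ : 0 ≤ μ) (k : ℕ) :
    ∃ C : ℝ, 0 ≤ C ∧ ∀ p : ℝ, 0 ≤ p → ‖iteratedDeriv k f p‖ ≤ C * (1 + p) ^ (-μ) := by
  obtain ⟨ha, C, hC⟩ := hf
  -- Radius at most `r₀ / 2` keeps the disc in the region, also near the origin; radius at most `1 /
  -- 2` gives `1 + |z| ≥ (1 + p) / 2` on it.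
  set ρ := min (r₀ / 2) (1 / 2) with hρ
  have hρ0 : 0 < ρ := lt_min (by positivity) (by norm_num)
  refine ⟨k.factorial * (|C| * 2 ^ μ) / ρ ^ k, by positivity, fun p hp => ?_⟩
  have hball : ∀ z ∈ Metric.closedBall (p : ℂ) ρ, z ∈ region r₀ θ₀ := fun z hz =>
    ball_subset_region h1 hp ((mem_closedBall_iff_norm.1 hz).trans (min_le_left _ _))
  have h := Complex.norm_iteratedDeriv_le_of_forall_mem_sphere_norm_le (f := f) (c := (p : ℂ))
    (R := ρ) (C := |C| * 2 ^ μ * (1 + p) ^ (-μ)) k hρ0 ?_ ?_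
  · refine h.trans (le_of_eq ?_)
    ring
  · refine DifferentiableOn.diffContOnCl fun z hz => ?_
    rw [closure_ball _ hρ0.ne'] at hz
    exact (ha z (hball z hz)).differentiableAt.differentiableWithinAt
  · intro z hz
    have hz' := Metric.sphere_subset_closedBall hz
    refine (hC z (hball z hz')).trans ?_
    have h3 : (1 + p) / 2 ≤ 1 + ‖z‖ := by
      have h4 := norm_sub_norm_le (p : ℂ) z
      rw [Complex.norm_real, Real.norm_of_nonneg hp, norm_sub_rev] at h4
      have h5 := (mem_closedBall_iff_norm.1 hz').trans (min_le_right _ _)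
      linarith
    have h4 : (1 + ‖z‖) ^ (-μ) ≤ ((1 + p) / 2) ^ (-μ) :=
      Real.rpow_le_rpow_of_nonpos (by positivity) h3 (by linarith)
    rw [Real.div_rpow (by positivity) (by norm_num), Real.rpow_neg two_pos.le, div_inv_eq_mul] at h4
    calc _ ≤ |C| * ((1 + p) ^ (-μ) * 2 ^ μ) :=
          mul_le_mul (le_abs_self C) h4 (by positivity) (abs_nonneg C)
      _ = _ := by ring

lemma hasDerivAt_iteratedDeriv {z : ℂ} (hf : AnalyticAt ℂ f z) (k : ℕ) :
    HasDerivAt (iteratedDeriv k f) (iteratedDeriv (k + 1) f z) z := by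
  rw [iteratedDeriv_succ]
  refine DifferentiableAt.hasDerivAt ?_
  rw [iteratedDeriv_eq_iterate]
  exact (hf.iterated_deriv k).differentiableAt

end Derivatives

/-! ### Integration by parts against `f^{(k)}(P)` -/

section IBP

variable {d : ℕ} {P : MvPolynomial (Fin d) ℝ} {m : ℕ} {r₀ θ₀ μ : ℝ} {f : ℂ → ℂ}

/-- `∫ f^{(k)}(P(x)) q(x) dx`. -/
noncomputable def fkInt (P : MvPolynomial (Fin d) ℝ) (f : ℂ → ℂ) (k : ℕ)
    (q : MvPolynomial (Fin d) ℝ) : ℂ :=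
  ∫ x : Fin d → ℝ, ((MvPolynomial.eval x q : ℝ) : ℂ) * fk P f k x

/-- The hypotheses on `P` and `f` under which the coefficient `C_4` is computed. -/
structure Setting (P : MvPolynomial (Fin d) ℝ) (m : ℕ) (r₀ θ₀ μ : ℝ) (f : ℂ → ℂ) : Prop where
  four_le : 4 ≤ d
  elliptic : IsPositiveElliptic P m
  nonneg : ∀ x, 0 ≤ MvPolynomial.eval x P
  pos : 0 < r₀
  lt : Real.pi / 2 < θ₀
  lt_pi : θ₀ < Real.pi
  decay : (d : ℝ) * ((m : ℝ) + 1) / m < μ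
  admissible : Admissible r₀ θ₀ μ f

lemma Setting.lt_mul (h : Setting P m r₀ θ₀ μ f) : (d : ℝ) * m + d < m * μ := by
  have hm : (0 : ℝ) < m := by
    have := h.elliptic.two_le
    exact_mod_cast (by omega : 0 < m)
  have := h.decay
  rw [div_lt_iff₀ hm] at this
  linarith

lemma Setting.four_lt (h : Setting P m r₀ θ₀ μ f) : 4 < μ := by
  have hm : (2 : ℝ) ≤ m := by exact_mod_cast h.elliptic.two_le
  have hd : (4 : ℝ) ≤ d := by exact_mod_cast h.four_le
  by_contra! hμ
  nlinarith [h.lt_mul]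

lemma Setting.hasLineDerivAt_fk (h : Setting P m r₀ θ₀ μ f) (k : ℕ) (j : Fin d) (x : Fin d → ℝ) :
    HasLineDerivAt ℝ (fk P f k)
      (((MvPolynomial.eval x (MvPolynomial.pderiv j P) : ℝ) : ℂ) * fk P f (k + 1) x) x
      (Pi.single j 1) := by
  have h1 := hasLineDerivAt_pe (MvPolynomial.map Complex.ofRealHom P) j x
  rw [MvPolynomial.pderiv_map, pe_map] at h1
  have h2 := hasDerivAt_iteratedDeriv (h.admissible.1 _ (ofReal_mem_region (r₀ := r₀) (θ₀ := θ₀)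
    (by linarith [Real.pi_pos, h.lt]) (h.nonneg x))) k
  unfold HasLineDerivAt at h1 ⊢
  simp only [pe_map] at h1
  have e : ((MvPolynomial.eval x P : ℝ) : ℂ) =
    ((MvPolynomial.eval (x + (0 : ℝ) • Pi.single j 1) P : ℝ) : ℂ) := by simp
  have h3 : HasDerivAt (iteratedDeriv k f) (iteratedDeriv (k + 1) f (MvPolynomial.eval x P : ℝ))
    ((MvPolynomial.eval (x + (0 : ℝ) • Pi.single j 1) P : ℝ) : ℂ) := by rwa [← e]
  exact HasDerivAt.congr_deriv (HasDerivAt.comp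
    (h := fun t : ℝ => ((MvPolynomial.eval (x + t • Pi.single j 1) P : ℝ) : ℂ)) (0 : ℝ) h3 h1)
    (mul_comm _ _)

lemma Setting.continuous_fk (h : Setting P m r₀ θ₀ μ f) (k : ℕ) : Continuous (fk P f k) := by
  rw [continuous_iff_continuousAt]
  intro x
  have h2 := hasDerivAt_iteratedDeriv (h.admissible.1 _ (ofReal_mem_region (r₀ := r₀) (θ₀ := θ₀)
    (by linarith [Real.pi_pos, h.lt]) (h.nonneg x))) k
  exact ContinuousAt.comp (g := iteratedDeriv k f)
    (f := fun x => ((MvPolynomial.eval x P : ℝ) : ℂ)) h2.continuousAt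
    (Complex.continuous_ofReal.comp (MvPolynomial.continuous_eval P)).continuousAt

lemma Setting.exists_norm_fk_mul_le (h : Setting P m r₀ θ₀ μ f) (k : ℕ)
    (q : MvPolynomial (Fin d) ℝ) {N : ℕ} (hq : q.totalDegree ≤ N) :
    ∃ C : ℝ, 0 ≤ C ∧ ∀ x, ‖((MvPolynomial.eval x q : ℝ) : ℂ) * fk P f k x‖ ≤
      C * (1 + ‖x‖) ^ (-(m * μ - N)) := by
  obtain ⟨c, hc, hcP⟩ := exists_le_one_add_eval (by have := h.four_le; omega) h.elliptic h.nonneg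
  have hμ : 0 ≤ μ := by linarith [h.four_lt]
  obtain ⟨C, hC0, hC⟩ := h.admissible.exists_norm_iteratedDeriv_le h.pos h.lt hμ k
  obtain ⟨K, hK0, hK⟩ := norm_eval_le q hq
  refine ⟨K * (C * c ^ (-μ)), by positivity, fun x => ?_⟩
  have hx : 0 < 1 + ‖x‖ := by positivity
  have h2 : (1 + MvPolynomial.eval x P) ^ (-μ) ≤ c ^ (-μ) * (1 + ‖x‖) ^ (-(m * μ)) := by
    have := Real.rpow_le_rpow_of_nonpos (by positivity) (hcP x) (neg_nonpos.2 hμ)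
    rwa [Real.mul_rpow hc.le (by positivity), ← Real.rpow_natCast, ← Real.rpow_mul hx.le,
      mul_neg] at this
  have h3 : (1 + ‖x‖) ^ (-(m * μ - N)) = (1 + ‖x‖) ^ N * (1 + ‖x‖) ^ (-(m * μ)) := by
    rw [neg_sub, sub_eq_add_neg, Real.rpow_add hx, Real.rpow_natCast]
  rw [norm_mul, Complex.norm_real, Real.norm_eq_abs, h3]
  calc _ ≤ K * (1 + ‖x‖) ^ N * (C * (1 + MvPolynomial.eval x P) ^ (-μ)) :=
        mul_le_mul (hK x) (hC _ (h.nonneg x)) (norm_nonneg _) (by positivity)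
    _ ≤ K * (1 + ‖x‖) ^ N * (C * (c ^ (-μ) * (1 + ‖x‖) ^ (-(m * μ)))) := by
        refine mul_le_mul_of_nonneg_left (mul_le_mul_of_nonneg_left h2 hC0) (by positivity)
    _ = _ := by ring

/-- Degree `4m` suffices for all coefficients that occur, such as `|∇P|⁴`. The integrand is `O((1 +
‖x‖)^{-(mμ - 4m)})`, and `mμ > dm + d ≥ 4m + d`. -/
lemma Setting.integrable_fk (h : Setting P m r₀ θ₀ μ f) (k : ℕ) {q : MvPolynomial (Fin d) ℝ}
    (hq : q.totalDegree ≤ 4 * m) :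
    Integrable fun x => ((MvPolynomial.eval x q : ℝ) : ℂ) * fk P f k x := by
  obtain ⟨C, -, hC⟩ := h.exists_norm_fk_mul_le k q hq
  refine integrable_of_norm_le ((Complex.continuous_ofReal.comp
    (MvPolynomial.continuous_eval q)).mul (h.continuous_fk k)) ?_ hC
  have hd : (4 : ℝ) ≤ d := by exact_mod_cast h.four_le
  have := h.lt_mul
  push_cast
  nlinarith [(Nat.cast_nonneg m : (0 : ℝ) ≤ m)]

lemma Setting.fkInt_add (h : Setting P m r₀ θ₀ μ f) (k : ℕ) {p q : MvPolynomial (Fin d) ℝ}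
    (hp : p.totalDegree ≤ 4 * m) (hq : q.totalDegree ≤ 4 * m) :
    fkInt P f k (p + q) = fkInt P f k p + fkInt P f k q := by
  unfold fkInt
  rw [← integral_add (h.integrable_fk k hp) (h.integrable_fk k hq)]
  simp [add_mul]

lemma Setting.fkInt_sum (h : Setting P m r₀ θ₀ μ f) (k : ℕ) {V : Fin d → MvPolynomial (Fin d) ℝ}
    (hV : ∀ j, (V j).totalDegree ≤ 4 * m) :
    fkInt P f k (∑ j, V j) = ∑ j, fkInt P f k (V j) := by
  unfold fkInt
  rw [← integral_finsetSum _ fun j _ => h.integrable_fk k (hV j)]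
  simp [Finset.sum_mul]

lemma fkInt_ofNat_mul (k n : ℕ) [n.AtLeastTwo] (q : MvPolynomial (Fin d) ℝ) :
    fkInt P f k (ofNat(n) * q) = ofNat(n) * fkInt P f k q := by
  unfold fkInt
  rw [← integral_const_mul]
  simp [mul_assoc]

/-- The chain rule gives `∂_j (q f^{(k)}(P)) = q ∂_j P f^{(k+1)}(P) + ∂_j q f^{(k)}(P)`, whose
integral is zero. -/
lemma Setting.fkInt_pderiv_mul (h : Setting P m r₀ θ₀ μ f) (k : ℕ) (j : Fin d)
    {q : MvPolynomial (Fin d) ℝ} (hq : q.totalDegree ≤ 3 * m) :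
    fkInt P f (k + 1) (MvPolynomial.pderiv j P * q) = -fkInt P f k (MvPolynomial.pderiv j q) := by
  have d1 : (MvPolynomial.pderiv j P * q).totalDegree ≤ 4 * m := by
    have := MvPolynomial.totalDegree_mul (MvPolynomial.pderiv j P) q
    have := totalDegree_pderiv_le P j
    have := h.elliptic.totalDegree_eq
    omega
  have d2 : (MvPolynomial.pderiv j q).totalDegree ≤ 4 * m := by
    have := totalDegree_pderiv_le q j
    omega
  obtain ⟨C, hC0, hC⟩ := h.exists_norm_fk_mul_le k q hq
  have hder : ∀ x, HasLineDerivAt ℝ (fun x => ((MvPolynomial.eval x q : ℝ) : ℂ) * fk P f k x)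
      (((MvPolynomial.eval x (MvPolynomial.pderiv j P * q) : ℝ) : ℂ) * fk P f (k + 1) x +
        ((MvPolynomial.eval x (MvPolynomial.pderiv j q) : ℝ) : ℂ) * fk P f k x) x
      (Pi.single j 1) := by
    intro x
    have h1 := hasLineDerivAt_pe (MvPolynomial.map Complex.ofRealHom q) j x
    rw [MvPolynomial.pderiv_map, pe_map] at h1
    have h2 := h.hasLineDerivAt_fk k j x
    unfold HasLineDerivAt at h1 h2 ⊢
    simp only [pe_map] at h1
    refine (h1.mul h2).congr_deriv ?_
    simp only [zero_smul, add_zero, map_mul]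
    push_cast
    ring
  have h0 := integral_hasLineDerivAt_eq_zero hder
    ((h.integrable_fk (k + 1) d1).add (h.integrable_fk k d2)) (C := C) fun x => by
      refine (hC x).trans (mul_le_mul_of_nonneg_left ?_ hC0)
      rw [← Real.rpow_neg_one]
      refine Real.rpow_le_rpow_of_exponent_le (by linarith [norm_nonneg x]) ?_
      have hd : (4 : ℝ) ≤ d := by exact_mod_cast h.four_le
      have := h.lt_mul
      push_cast
      nlinarith [(Nat.cast_nonneg m : (0 : ℝ) ≤ m)]
  rw [integral_add (h.integrable_fk (k + 1) d1) (h.integrable_fk k d2)] at h0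
  exact eq_neg_of_add_eq_zero_left h0

lemma Setting.fkInt_divergence (h : Setting P m r₀ θ₀ μ f) (k : ℕ)
    {V : Fin d → MvPolynomial (Fin d) ℝ} (hV : ∀ j, (V j).totalDegree ≤ 3 * m) :
    fkInt P f (k + 1) (∑ j, MvPolynomial.pderiv j P * V j) =
      -fkInt P f k (∑ j, MvPolynomial.pderiv j (V j)) := by
  rw [h.fkInt_sum, h.fkInt_sum, ← Finset.sum_neg_distrib]
  · exact Finset.sum_congr rfl fun j _ => h.fkInt_pderiv_mul k j (hV j)
  · intro j
    have := totalDegree_pderiv_le (V j) j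
    have := hV j
    omega
  · intro j
    have := MvPolynomial.totalDegree_mul (MvPolynomial.pderiv j P) (V j)
    have := totalDegree_pderiv_le P j
    have := h.elliptic.totalDegree_eq
    have := hV j
    omega

end IBP

end QuadraticPencil

namespace QuadraticPencil

/-! ### The formulas for `C_4` -/

section Degrees

variable {d m : ℕ}

lemma totalDegree_polyLap_le {p : MvPolynomial (Fin d) ℝ} (hp : p.totalDegree ≤ m) :
    (polyLap p).totalDegree ≤ m :=
  MvPolynomial.totalDegree_finsetSum_le fun j _ => by
    have := totalDegree_pderiv_le p j
    have := totalDegree_pderiv_le (MvPolynomial.pderiv j p) j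
    omega

lemma totalDegree_polyGrad_le {n : ℕ} {p q : MvPolynomial (Fin d) ℝ} (hp : p.totalDegree ≤ m)
    (hq : q.totalDegree ≤ n) : (polyGrad p q).totalDegree ≤ m + n :=
  MvPolynomial.totalDegree_finsetSum_le fun j _ => by
    have := totalDegree_pderiv_le p j
    have := totalDegree_pderiv_le q j
    refine (MvPolynomial.totalDegree_mul _ _).trans (by omega)

lemma totalDegree_polyHessGrad_le {p : MvPolynomial (Fin d) ℝ} (hp : p.totalDegree ≤ m) :
    (polyHessGrad p).totalDegree ≤ 3 * m :=
  MvPolynomial.totalDegree_finsetSum_le fun j _ =>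
    MvPolynomial.totalDegree_finsetSum_le fun k _ => by
      have h1 := totalDegree_pderiv_le p j
      have h2 := totalDegree_pderiv_le p k
      have h3 := totalDegree_pderiv_le (MvPolynomial.pderiv k p) j
      have h4 := totalDegree_pderiv_le (MvPolynomial.pderiv j p) k
      refine (MvPolynomial.totalDegree_mul _ _).trans ?_
      refine (Nat.add_le_add_right (MvPolynomial.totalDegree_mul _ _) _).trans ?_
      omega

lemma totalDegree_mul_le {n k : ℕ} {p q : MvPolynomial (Fin d) ℝ} (hp : p.totalDegree ≤ m)
    (hq : q.totalDegree ≤ n) (h : m + n ≤ k) : (p * q).totalDegree ≤ k :=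
  (MvPolynomial.totalDegree_mul _ _).trans ((Nat.add_le_add hp hq).trans h)

end Degrees

section Relations

variable {d : ℕ} {P : MvPolynomial (Fin d) ℝ} {m : ℕ} {r₀ θ₀ μ : ℝ} {f : ℂ → ℂ}

lemma Setting.degree_lap (h : Setting P m r₀ θ₀ μ f) : (polyLap P).totalDegree ≤ m :=
  totalDegree_polyLap_le h.elliptic.totalDegree_eq.le

lemma Setting.degree_grad (h : Setting P m r₀ θ₀ μ f) : (polyGrad P P).totalDegree ≤ 2 * m := by
  rw [two_mul]
  exact totalDegree_polyGrad_le h.elliptic.totalDegree_eq.le h.elliptic.totalDegree_eq.le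

lemma Setting.degree_hessGrad (h : Setting P m r₀ θ₀ μ f) :
    (polyHessGrad P).totalDegree ≤ 4 * m :=
  (totalDegree_polyHessGrad_le h.elliptic.totalDegree_eq.le).trans (by omega)

lemma Setting.degree_bilap (h : Setting P m r₀ θ₀ μ f) :
    (polyLap (polyLap P)).totalDegree ≤ 4 * m :=
  (totalDegree_polyLap_le h.degree_lap).trans (by omega)

lemma Setting.degree_grad_lap (h : Setting P m r₀ θ₀ μ f) :
    (polyGrad (polyLap P) P).totalDegree ≤ 4 * m :=
  (totalDegree_polyGrad_le h.degree_lap h.elliptic.totalDegree_eq.le).trans (by omega)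

lemma Setting.degree_lap_sq (h : Setting P m r₀ θ₀ μ f) :
    (polyLap P * polyLap P).totalDegree ≤ 4 * m :=
  totalDegree_mul_le h.degree_lap h.degree_lap (by omega)

lemma Setting.degree_lap_grad (h : Setting P m r₀ θ₀ μ f) :
    (polyLap P * polyGrad P P).totalDegree ≤ 4 * m :=
  totalDegree_mul_le h.degree_lap h.degree_grad (by omega)

lemma Setting.degree_grad_sq (h : Setting P m r₀ θ₀ μ f) :
    (polyGrad P P * polyGrad P P).totalDegree ≤ 4 * m :=
  totalDegree_mul_le h.degree_grad h.degree_grad (by omega)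

/-- The divergence identity for the field `v ∇P`, with `div (v ∇P) = ∇v·∇P + v ΔP`. Taking `v = ΔP`
and `v = |∇P|²` yields the relations below. -/
lemma Setting.fkInt_grad_mul (h : Setting P m r₀ θ₀ μ f) (k : ℕ) {v : MvPolynomial (Fin d) ℝ}
    (hv : v.totalDegree ≤ 2 * m) :
    fkInt P f (k + 1) (v * polyGrad P P) = -fkInt P f k (polyGrad v P + v * polyLap P) := by
  have e1 : v * polyGrad P P =
      ∑ j, MvPolynomial.pderiv j P * (v * MvPolynomial.pderiv j P) := by
    rw [polyGrad, Finset.mul_sum]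
    exact Finset.sum_congr rfl fun j _ => by ring
  have e2 : polyGrad v P + v * polyLap P =
      ∑ j, MvPolynomial.pderiv j (v * MvPolynomial.pderiv j P) := by
    rw [polyGrad, polyLap, Finset.mul_sum, ← Finset.sum_add_distrib]
    refine Finset.sum_congr rfl fun j _ => ?_
    rw [Derivation.leibniz]
    simp only [smul_eq_mul]
    ring
  rw [e1, e2]
  refine h.fkInt_divergence k fun j => ?_
  have := totalDegree_pderiv_le P j
  have := h.elliptic.totalDegree_eq
  exact totalDegree_mul_le hv (n := m) (by omega) (by omega)

lemma Setting.fkInt_grad_lap (h : Setting P m r₀ θ₀ μ f) (k : ℕ) :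
    fkInt P f (k + 1) (polyGrad (polyLap P) P) = -fkInt P f k (polyLap (polyLap P)) := by
  rw [polyGrad_comm]
  refine h.fkInt_divergence k fun j => ?_
  have := totalDegree_pderiv_le (polyLap P) j
  have := h.degree_lap
  omega

lemma Setting.fkInt_lap_grad (h : Setting P m r₀ θ₀ μ f) (k : ℕ) :
    fkInt P f (k + 2) (polyLap P * polyGrad P P) =
      fkInt P f k (polyLap (polyLap P)) - fkInt P f (k + 1) (polyLap P * polyLap P) := by
  rw [h.fkInt_grad_mul (k + 1) (h.degree_lap.trans (by omega)),
    h.fkInt_add (k + 1) h.degree_grad_lap h.degree_lap_sq, h.fkInt_grad_lap k]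
  ring

lemma Setting.fkInt_grad_sq (h : Setting P m r₀ θ₀ μ f) (k : ℕ) :
    fkInt P f (k + 1) (polyGrad P P * polyGrad P P) =
      -(2 * fkInt P f k (polyHessGrad P) + fkInt P f k (polyLap P * polyGrad P P)) := by
  rw [h.fkInt_grad_mul k h.degree_grad, polyGrad_polyGrad_self, mul_comm (polyGrad P P),
    h.fkInt_add k ?_ h.degree_lap_grad, fkInt_ofNat_mul]
  have : (2 : MvPolynomial (Fin d) ℝ) = MvPolynomial.C 2 := rfl
  rw [this]
  exact totalDegree_mul_le (MvPolynomial.totalDegree_C _).le h.degree_hessGrad (by omega)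

lemma Setting.integral_linear_combination (h : Setting P m r₀ θ₀ μ f) {n : ℕ} (c : Fin n → ℂ)
    (k : Fin n → ℕ) (q : Fin n → MvPolynomial (Fin d) ℝ) (hq : ∀ i, (q i).totalDegree ≤ 4 * m)
    {F : (Fin d → ℝ) → ℂ} (hF : ∀ x, F x =
      ∑ i, c i * (((MvPolynomial.eval x (q i) : ℝ) : ℂ) * fk P f (k i) x)) :
    Integrable F ∧ ∫ x, F x = ∑ i, c i * fkInt P f (k i) (q i) := by
  have hi := fun i : Fin n => (h.integrable_fk (k i) (hq i)).const_mul (c i)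
  obtain rfl := funext hF
  refine ⟨integrable_finsetSum _ fun i _ => hi i, ?_⟩
  rw [integral_finsetSum _ fun i _ => hi i]
  exact Finset.sum_congr rfl fun i _ => integral_const_mul _ _

end Relations

section Formula

variable {m : ℕ} {r₀ θ₀ μ : ℝ} {f : ℂ → ℂ}

/-- The six integrals of the density are not independent: `∇ΔP·∇P`, `|∇P|⁴` and `Δ²P` are
eliminated. The three left have a definite sign when `P` is convex, `f' < 0` and `f'' > 0`. -/
lemma Setting.integral_C4density_five {P : MvPolynomial (Fin 5) ℝ} (h : Setting P m r₀ θ₀ μ f) :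
    Integrable (C4density P r₀ θ₀ f) ∧ ∫ x, C4density P r₀ θ₀ f x =
      (Real.pi : ℂ) ^ 3 * (fkInt P f 2 (polyLap P * polyGrad P P) / 480 +
        fkInt P f 2 (polyHessGrad P) / 240 - fkInt P f 1 (polyLap P * polyLap P) / 60) := by
  obtain ⟨h1, h2⟩ := h.integral_linear_combination (F := C4density P r₀ θ₀ f)
    ![-((Real.pi : ℂ) ^ 3 / 30), -((Real.pi : ℂ) ^ 3 / 15), -((Real.pi : ℂ) ^ 3 / 20),
      -((Real.pi : ℂ) ^ 3 / 40), (Real.pi : ℂ) ^ 3 / 60, (Real.pi : ℂ) ^ 3 / 160]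
    ![0, 1, 1, 2, 2, 3]
    ![polyLap (polyLap P), polyGrad (polyLap P) P, polyLap P * polyLap P,
      polyLap P * polyGrad P P, polyHessGrad P, polyGrad P P * polyGrad P P]
    (by
      intro i
      fin_cases i
      exacts [h.degree_bilap, h.degree_grad_lap, h.degree_lap_sq, h.degree_lap_grad,
        h.degree_hessGrad, h.degree_grad_sq])
    (by
      intro x
      rw [(C4density_five h.nonneg h.pos h.lt h.lt_pi h.admissible.decaysOn
        (by linarith [h.four_lt]) x).2.2]
      simp [Fin.sum_univ_succ]
      ring)
  refine ⟨h1, h2.trans ?_⟩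
  simp only [Fin.sum_univ_succ, Fin.sum_univ_zero, Matrix.cons_val_zero, Matrix.cons_val_succ]
  rw [h.fkInt_grad_lap 0, h.fkInt_grad_sq 2, h.fkInt_lap_grad 0]
  ring

/-- The terms in `ΔP |∇P|²` and `D²P∇P·∇P` occur in exactly the ratio that integration by parts
converts into `|∇P|⁴`, so a single integral remains. -/
lemma Setting.integral_C4density_seven {P : MvPolynomial (Fin 7) ℝ} (h : Setting P m r₀ θ₀ μ f) :
    Integrable (C4density P r₀ θ₀ f) ∧ ∫ x, C4density P r₀ θ₀ f x =
      -(7 * (Real.pi : ℂ) ^ 4 / 360) * fkInt P f 1 (polyGrad P P * polyGrad P P) := by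
  obtain ⟨h1, h2⟩ := h.integral_linear_combination (F := C4density P r₀ θ₀ f)
    ![7 * (Real.pi : ℂ) ^ 4 / 90, 7 * (Real.pi : ℂ) ^ 4 / 45, 7 * (Real.pi : ℂ) ^ 4 / 120]
    ![0, 0, 1]
    ![polyLap P * polyGrad P P, polyHessGrad P, polyGrad P P * polyGrad P P]
    (by
      intro i
      fin_cases i
      exacts [h.degree_lap_grad, h.degree_hessGrad, h.degree_grad_sq])
    (by
      intro x
      rw [(C4density_seven h.nonneg h.pos h.lt h.lt_pi h.admissible.decaysOn
        (by linarith [h.four_lt]) x).2.2]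
      simp [Fin.sum_univ_succ]
      ring)
  refine ⟨h1, h2.trans ?_⟩
  simp only [Fin.sum_univ_succ, Fin.sum_univ_zero, Matrix.cons_val_zero, Matrix.cons_val_succ]
  rw [h.fkInt_grad_sq 0]
  ring

/-- The stated integrand and the density from the contour are different functions of `x`; their
integrals agree because both reduce to the same normal form. -/
theorem Setting.hasC4Formula_five {P : MvPolynomial (Fin 5) ℝ} (h : Setting P m r₀ θ₀ μ f) :
    HasC4Formula P r₀ θ₀ f (fun x =>
      ((-(Real.pi ^ 3 / 96) * bilap P x : ℝ) : ℂ) * fk P f 0 x +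
        ((-(Real.pi ^ 3 / 160) * lap P x ^ 2 : ℝ) : ℂ) * fk P f 1 x +
        ((Real.pi ^ 3 / 80 * (gradSq P x * lap P x) +
          Real.pi ^ 3 / 240 * hessGrad P x : ℝ) : ℂ) * fk P f 2 x) := by
  have hν : 0 < μ := by linarith [h.four_lt]
  obtain ⟨g1, g2⟩ := h.integral_linear_combination
    (F := fun x => ((-(Real.pi ^ 3 / 96) * bilap P x : ℝ) : ℂ) * fk P f 0 x +
        ((-(Real.pi ^ 3 / 160) * lap P x ^ 2 : ℝ) : ℂ) * fk P f 1 x +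
        ((Real.pi ^ 3 / 80 * (gradSq P x * lap P x) +
          Real.pi ^ 3 / 240 * hessGrad P x : ℝ) : ℂ) * fk P f 2 x)
    ![-((Real.pi : ℂ) ^ 3 / 96), -((Real.pi : ℂ) ^ 3 / 160),
      (Real.pi : ℂ) ^ 3 / 80, (Real.pi : ℂ) ^ 3 / 240]
    ![0, 1, 2, 2]
    ![polyLap (polyLap P), polyLap P * polyLap P, polyLap P * polyGrad P P, polyHessGrad P]
    (by
      intro i
      fin_cases i
      exacts [h.degree_bilap, h.degree_lap_sq, h.degree_lap_grad, h.degree_hessGrad])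
    (by
      intro x
      rw [bilap_eq, lap_eq, gradSq_eq, hessGrad_eq]
      simp [Fin.sum_univ_succ]
      ring)
  refine ⟨fun x => (C4density_five h.nonneg h.pos h.lt h.lt_pi h.admissible.decaysOn hν x).1,
    fun x => (C4density_five h.nonneg h.pos h.lt h.lt_pi h.admissible.decaysOn hν x).2.1,
    h.integral_C4density_five.1, g1, ?_⟩
  rw [C4, integral_mul_const, integral_mul_const, h.integral_C4density_five.2, g2]
  congr 1
  simp only [Fin.sum_univ_succ, Fin.sum_univ_zero, Matrix.cons_val_zero, Matrix.cons_val_succ]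
  rw [h.fkInt_lap_grad 0]
  ring

theorem Setting.hasC4Formula_seven {P : MvPolynomial (Fin 7) ℝ} (h : Setting P m r₀ θ₀ μ f) :
    HasC4Formula P r₀ θ₀ f (fun x =>
      ((Real.pi ^ 4 / 360 * (gradSq P x * lap P x) +
          Real.pi ^ 4 / 180 * hessGrad P x : ℝ) : ℂ) * fk P f 0 x +
        ((-(Real.pi ^ 4 / 60) * gradSq P x ^ 2 : ℝ) : ℂ) * fk P f 1 x) := by
  have hν : 2 < μ := by linarith [h.four_lt]
  obtain ⟨g1, g2⟩ := h.integral_linear_combination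
    (F := fun x => ((Real.pi ^ 4 / 360 * (gradSq P x * lap P x) +
          Real.pi ^ 4 / 180 * hessGrad P x : ℝ) : ℂ) * fk P f 0 x +
        ((-(Real.pi ^ 4 / 60) * gradSq P x ^ 2 : ℝ) : ℂ) * fk P f 1 x)
    ![(Real.pi : ℂ) ^ 4 / 360, (Real.pi : ℂ) ^ 4 / 180, -((Real.pi : ℂ) ^ 4 / 60)]
    ![0, 0, 1]
    ![polyLap P * polyGrad P P, polyHessGrad P, polyGrad P P * polyGrad P P]
    (by
      intro i
      fin_cases i
      exacts [h.degree_lap_grad, h.degree_hessGrad, h.degree_grad_sq])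
    (by
      intro x
      rw [lap_eq, gradSq_eq, hessGrad_eq]
      simp [Fin.sum_univ_succ]
      ring)
  refine ⟨fun x => (C4density_seven h.nonneg h.pos h.lt h.lt_pi h.admissible.decaysOn hν x).1,
    fun x => (C4density_seven h.nonneg h.pos h.lt h.lt_pi h.admissible.decaysOn hν x).2.1,
    h.integral_C4density_seven.1, g1, ?_⟩
  rw [C4, integral_mul_const, integral_mul_const, h.integral_C4density_seven.2, g2]
  congr 1
  simp only [Fin.sum_univ_succ, Fin.sum_univ_zero, Matrix.cons_val_zero, Matrix.cons_val_succ]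
  rw [h.fkInt_grad_sq 0]
  ring

end Formula

end QuadraticPencil

namespace QuadraticPencil

/-! ### Convexity -/

section Convexity

variable {d : ℕ} {P : MvPolynomial (Fin d) ℝ}

lemma hasDerivAt_eval_line (q : MvPolynomial (Fin d) ℝ) (x v : Fin d → ℝ) (t : ℝ) :
    HasDerivAt (fun t : ℝ => MvPolynomial.eval (x + t • v) q)
      (∑ j, v j * MvPolynomial.eval (x + t • v) (MvPolynomial.pderiv j q)) t := by
  induction q using MvPolynomial.induction_on with
  | C a => simpa using hasDerivAt_const t a
  | add p q hp hq =>
    simp only [map_add, mul_add, Finset.sum_add_distrib]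
    exact hp.add hq
  | mul_X p i hp =>
    have h1 : HasDerivAt (fun t : ℝ => (x + t • v) i) (v i) t := by
      simpa using ((hasDerivAt_id' t).mul_const (v i)).const_add (x i)
    have h2 := hp.mul h1
    simp only [map_mul, MvPolynomial.eval_X]
    refine h2.congr_deriv ?_
    classical
    simp only [Derivation.leibniz, MvPolynomial.pderiv_X, smul_eq_mul, map_add, map_mul,
      MvPolynomial.eval_X, mul_add, Finset.sum_add_distrib]
    rw [add_comm, Finset.sum_mul]
    congr 1
    · rw [Finset.sum_eq_single i]
      · simp [mul_comm]
      · intro j _ hj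
        simp [hj]
      · simp
    · exact Finset.sum_congr rfl fun j _ => by ring

/-- On the line through `x` with direction `v` the restriction is convex, so its derivative is
monotone and its second derivative at `0`, which is this quadratic form, is nonnegative. -/
lemma IsConvexPoly.hessian_nonneg (hP : IsConvexPoly P) (x v : Fin d → ℝ) :
    0 ≤ ∑ j, ∑ k, D2 P j k x * v j * v k := by
  have hc : ConvexOn ℝ Set.univ (fun t : ℝ => MvPolynomial.eval (x + t • v) P) := by
    refine ⟨convex_univ, fun s _ t _ a b ha hb hab => ?_⟩
    have := hP.2 (Set.mem_univ (x + s • v)) (Set.mem_univ (x + t • v)) ha hb hab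
    convert this using 2
    simp only [smul_add, smul_smul, smul_eq_mul]
    rw [add_add_add_comm, ← add_smul, ← add_smul, hab, one_smul]
  have hd1 := hasDerivAt_eval_line P x v
  have hmono := hc.monotoneOn_deriv fun t _ => (hd1 t).differentiableAt
  rw [funext fun t => (hd1 t).deriv] at hmono
  have hd2 := HasDerivAt.fun_sum (u := Finset.univ) fun j (_ : j ∈ Finset.univ) =>
    (hasDerivAt_eval_line (MvPolynomial.pderiv j P) x v 0).const_mul (v j)
  have h := hmono.derivWithin_nonneg (x := 0)
  rw [derivWithin_univ, hd2.deriv] at h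
  refine h.trans_eq ?_
  rw [Finset.sum_comm]
  refine Finset.sum_congr rfl fun j _ => ?_
  rw [Finset.mul_sum]
  refine Finset.sum_congr rfl fun k _ => ?_
  rw [zero_smul, add_zero, D2]
  ring

lemma IsConvexPoly.hessGrad_nonneg (hP : IsConvexPoly P) (x : Fin d → ℝ) :
    0 ≤ MvPolynomial.eval x (polyHessGrad P) := by
  rw [← hessGrad_eq]
  exact hP.hessian_nonneg x fun j => D1 P j x

lemma IsConvexPoly.D2_nonneg (hP : IsConvexPoly P) (j : Fin d) (x : Fin d → ℝ) :
    0 ≤ D2 P j j x := by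
  have := hP.hessian_nonneg x (Pi.single j 1)
  simpa [Pi.single_apply] using this

lemma IsPosDefQuadratic.isConvexPoly (hP : IsPosDefQuadratic P) : IsConvexPoly P := by
  obtain ⟨A, hA, rfl⟩ := hP
  refine ⟨convex_univ, fun x _ y _ a b ha hb hab => ?_⟩
  have h0 : 0 ≤ ∑ j, ∑ k, A j k * (x - y) j * (x - y) k := by
    rcases eq_or_ne (x - y) 0 with h | h
    · rw [h]; simp
    · exact (hA _ h).le
  have h1 := mul_nonneg (mul_nonneg ha hb) h0
  have hb' : b = 1 - a := by linarith
  rw [← sub_nonneg]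
  refine h1.trans_eq ?_
  simp only [map_sum, map_mul, MvPolynomial.eval_C, MvPolynomial.eval_X, smul_eq_mul,
    Finset.mul_sum, Pi.add_apply, Pi.smul_apply, Pi.sub_apply, ← Finset.sum_add_distrib,
    ← Finset.sum_sub_distrib]
  refine Finset.sum_congr rfl fun j _ => Finset.sum_congr rfl fun k _ => ?_
  rw [hb']
  ring

/-- Nonnegativity at the point `(-1, …, -1)` forces `m` to be even, and even powers are convex. -/
lemma IsSumOfPowers.isConvexPoly {m : ℕ} (hd : 0 < d) (hP : IsSumOfPowers P m)
    (h0 : ∀ x, 0 ≤ MvPolynomial.eval x P) : IsConvexPoly P := by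
  obtain ⟨α, hα, rfl⟩ := hP
  have heven : Even m := by
    by_contra hodd
    rw [Nat.not_even_iff_odd] at hodd
    have h := h0 (fun _ => -1)
    simp only [map_sum, map_mul, map_pow, MvPolynomial.eval_C, MvPolynomial.eval_X,
      hodd.neg_one_pow] at h
    have : Nonempty (Fin d) := ⟨⟨0, hd⟩⟩
    have h1 : 0 < ∑ j, α j := Finset.sum_pos (fun j _ => hα j) Finset.univ_nonempty
    rw [← Finset.sum_mul] at h
    linarith
  refine ⟨convex_univ, fun x _ y _ a b ha hb hab => ?_⟩
  simp only [map_sum, map_mul, map_pow, MvPolynomial.eval_C, MvPolynomial.eval_X, smul_eq_mul,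
    Finset.mul_sum, ← Finset.sum_add_distrib, Pi.add_apply, Pi.smul_apply]
  refine Finset.sum_le_sum fun j _ => ?_
  have h1 := heven.convexOn_pow.2 (Set.mem_univ (x j)) (Set.mem_univ (y j)) ha hb hab
  simp only [smul_eq_mul] at h1
  have h2 := mul_le_mul_of_nonneg_left h1 (hα j).le
  linarith

/-- Otherwise `P` would be affine along the `j`-th axis, whereas ellipticity with `m ≥ 2` makes it
grow at least quadratically there. -/
lemma IsPositiveElliptic.pderiv_pderiv_ne_zero {m : ℕ} (hP : IsPositiveElliptic P m)
    (h0 : ∀ x, 0 ≤ MvPolynomial.eval x P) (j : Fin d) :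
    MvPolynomial.pderiv j (MvPolynomial.pderiv j P) ≠ 0 := by
  intro hzero
  obtain ⟨c, hc, hgrowth⟩ := exists_le_one_add_eval j.pos hP h0
  set v : Fin d → ℝ := Pi.single j 1 with hv
  have hsum : ∀ q : MvPolynomial (Fin d) ℝ, ∀ t : ℝ,
      HasDerivAt (fun t : ℝ => MvPolynomial.eval (0 + t • v) q)
        (MvPolynomial.eval (0 + t • v) (MvPolynomial.pderiv j q)) t := fun q t => by
    simpa [hv, Pi.single_apply] using hasDerivAt_eval_line q 0 v t
  have e1 : ∀ t : ℝ, MvPolynomial.eval (0 + t • v) (MvPolynomial.pderiv j P) =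
      MvPolynomial.eval (0 + (0 : ℝ) • v) (MvPolynomial.pderiv j P) := fun t => by
    refine is_const_of_deriv_eq_zero (fun s => (hsum _ s).differentiableAt) (fun s => ?_) t 0
    rw [(hsum _ s).deriv, hzero, map_zero]
  set b := MvPolynomial.eval (0 + (0 : ℝ) • v) (MvPolynomial.pderiv j P)
  have e2 : ∀ t : ℝ, MvPolynomial.eval (0 + t • v) P - t * b =
      MvPolynomial.eval (0 + (0 : ℝ) • v) P - 0 * b := fun t => by
    have hd : ∀ s : ℝ, HasDerivAt (fun t : ℝ => MvPolynomial.eval (0 + t • v) P - t * b) 0 s :=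
      fun s => by
        have := (hsum P s).sub ((hasDerivAt_id' s).mul_const b)
        rwa [e1 s, one_mul, sub_self] at this
    exact is_const_of_deriv_eq_zero (fun s => (hd s).differentiableAt) (fun s => (hd s).deriv) t 0
  set a := MvPolynomial.eval (0 + (0 : ℝ) • v) P
  have e3 : ∀ t : ℝ, 0 ≤ t → c * (1 + t) ^ 2 ≤ 1 + a + t * b := fun t ht => by
    have h1 := hgrowth (0 + t • v)
    have h2 : ‖(0 : Fin d → ℝ) + t • v‖ = t := by
      rw [zero_add, norm_smul, hv, Pi.norm_single, norm_one, mul_one, Real.norm_of_nonneg ht]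
    rw [h2] at h1
    have h3 : (1 + t) ^ 2 ≤ (1 + t) ^ m := pow_le_pow_right₀ (by linarith) hP.two_le
    have h4 := e2 t
    nlinarith
  -- At `s = (1 + |a| + |b|) / c`, the quadratic side `c (1 + s)²` contains `2cs = 2 (1 + |a| +
  -- |b|)` and `c s² = s (1 + |a| + |b|)`, and so exceeds `1 + a + s b`.
  have h5 := e3 ((1 + |a| + |b|) / c) (by positivity)
  have h6 := le_abs_self a
  have h7 := le_abs_self b
  have ha := abs_nonneg a
  have hb := abs_nonneg b
  set s := (1 + |a| + |b|) / c with hs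
  have hs0 : 0 ≤ s := by positivity
  have h8 : c * s = 1 + |a| + |b| := by rw [hs]; field_simp
  nlinarith [mul_nonneg hs0 ha, mul_nonneg hs0 hb, mul_nonneg hs0 (sub_nonneg.2 h7)]

end Convexity

/-! ### Nonvanishing of `C_4` for `f(λ) = (λ + t)^{-μ}` -/

section PowF

variable {d : ℕ} {P : MvPolynomial (Fin d) ℝ} {m : ℕ} {r₀ θ₀ μ t : ℝ}

lemma admissible_powF (hr₀ : 0 < r₀) (h0 : 0 ≤ θ₀) (h2 : θ₀ < Real.pi) (ht : r₀ < t)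
    (hμ : 0 ≤ μ) : Admissible r₀ θ₀ μ (powF t μ) := by
  obtain ⟨c, hc, hb⟩ := exists_le_norm_add h0 h2 ht hr₀
  refine ⟨fun z hz => (analyticAt_id.add analyticAt_const).cpow analyticAt_const
    (add_mem_slitPlane hr₀ h2 ht hz), c ^ (-μ), fun z hz => ?_⟩
  rw [powF, ← Complex.ofReal_neg, Complex.norm_cpow_real, ← Real.mul_rpow hc.le (by positivity)]
  exact Real.rpow_le_rpow_of_nonpos (by positivity) (hb z hz) (by linarith)

lemma powF_ofReal {p : ℝ} (hp : 0 < p + t) : powF t μ p = ((p + t) ^ (-μ) : ℝ) := by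
  rw [powF, ← Complex.ofReal_add, ← Complex.ofReal_neg, Complex.ofReal_cpow hp.le]

lemma iteratedDeriv_succ_powF {p : ℝ} (hp : 0 < p + t) (k : ℕ) :
    iteratedDeriv (k + 1) (powF t μ) p = -(μ : ℂ) * iteratedDeriv k (powF t (μ + 1)) p := by
  have hslit : ∀ᶠ z : ℂ in nhds (p : ℂ), z + t ∈ Complex.slitPlane := by
    have hcont : ContinuousAt (fun z : ℂ => z + t) (p : ℂ) := by fun_prop
    refine hcont.eventually_mem (Complex.isOpen_slitPlane.mem_nhds (Or.inl ?_))
    simpa using hp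
  have h : deriv (powF t μ) =ᶠ[nhds (p : ℂ)] fun z => -(μ : ℂ) * powF t (μ + 1) z := by
    filter_upwards [hslit] with z hz
    have := (((hasDerivAt_id' z).add_const (t : ℂ)).cpow_const (c := -(μ : ℂ)) hz).deriv
    rw [show powF t μ = fun z => (z + (t : ℂ)) ^ (-(μ : ℂ)) from rfl, this, powF]
    push_cast
    rw [mul_one, neg_add, sub_eq_add_neg]
  rw [iteratedDeriv_succ', h.iteratedDeriv_eq]
  exact iteratedDeriv_const_mul_field _ _

lemma fk_powF_one {x : Fin d → ℝ} (hp : 0 < MvPolynomial.eval x P + t) :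
    fk P (powF t μ) 1 x = ((-μ * (MvPolynomial.eval x P + t) ^ (-(μ + 1)) : ℝ) : ℂ) := by
  rw [fk, iteratedDeriv_succ_powF hp 0, iteratedDeriv_zero, powF_ofReal hp]
  push_cast
  rfl

lemma fk_powF_two {x : Fin d → ℝ} (hp : 0 < MvPolynomial.eval x P + t) :
    fk P (powF t μ) 2 x =
      ((μ * (μ + 1) * (MvPolynomial.eval x P + t) ^ (-(μ + 1 + 1)) : ℝ) : ℂ) := by
  rw [fk, iteratedDeriv_succ_powF hp 1, iteratedDeriv_succ_powF hp 0, iteratedDeriv_zero,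
    powF_ofReal hp]
  push_cast
  ring

/-- Here `f'(P) = -μ (P + t)^{-μ-1} < 0`. The integrand is continuous with a constant sign, so a
zero integral would force `q` to vanish everywhere, hence as a polynomial. -/
lemma Setting.fkInt_one_sq_neg (h : Setting P m r₀ θ₀ μ (powF t μ)) (ht : 0 < t)
    {q : MvPolynomial (Fin d) ℝ} (hq : q ≠ 0) (hdeg : (q * q).totalDegree ≤ 4 * m) :
    ∃ s : ℝ, s < 0 ∧ fkInt P (powF t μ) 1 (q * q) = s := by
  have hμ : 0 < μ := by linarith [h.four_lt]
  have hpos : ∀ x, 0 < MvPolynomial.eval x P + t := fun x => by linarith [h.nonneg x]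
  set F : (Fin d → ℝ) → ℝ := fun x =>
    MvPolynomial.eval x q ^ 2 * (μ * (MvPolynomial.eval x P + t) ^ (-(μ + 1))) with hF
  have heq : ∀ x, ((MvPolynomial.eval x (q * q) : ℝ) : ℂ) * fk P (powF t μ) 1 x =
      ((-F x : ℝ) : ℂ) := fun x => by
    rw [fk_powF_one (hpos x), ← Complex.ofReal_mul, map_mul]
    congr 1
    simp only [hF]
    ring
  have hint : Integrable F := by
    have h1 := h.integrable_fk 1 hdeg
    simp only [heq] at h1
    simpa using h1.re.neg
  have hF0 : ∀ x, 0 ≤ F x := fun x => by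
    have := Real.rpow_nonneg (hpos x).le (-(μ + 1))
    positivity
  have hcont : Continuous F := by
    refine ((MvPolynomial.continuous_eval q).pow 2).mul (continuous_const.mul ?_)
    exact ((MvPolynomial.continuous_eval P).add continuous_const).rpow_const
      fun x => Or.inl (hpos x).ne'
  refine ⟨-∫ x, F x, neg_lt_zero.2 ?_, ?_⟩
  · refine (integral_nonneg hF0).lt_of_ne fun h1 => hq ?_
    have h2 := (integral_eq_zero_iff_of_nonneg hF0 hint).1 h1.symm
    have h3 := (Continuous.ae_eq_iff_eq volume hcont continuous_const).1 h2
    refine MvPolynomial.funext fun x => ?_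
    have h4 := congrFun h3 x
    have h5 := Real.rpow_pos_of_pos (hpos x) (-(μ + 1))
    have h6 : μ * (MvPolynomial.eval x P + t) ^ (-(μ + 1)) ≠ 0 := by positivity
    rw [map_zero]
    exact pow_eq_zero_iff two_ne_zero |>.1 ((mul_eq_zero.1 h4).resolve_right h6)
  · rw [fkInt, ← integral_neg]
    exact (integral_congr_ae (Filter.Eventually.of_forall heq)).trans integral_complex_ofReal

lemma Setting.fkInt_two_nonneg (h : Setting P m r₀ θ₀ μ (powF t μ)) (ht : 0 < t)
    {q : MvPolynomial (Fin d) ℝ} (hq : ∀ x, 0 ≤ MvPolynomial.eval x q) :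
    ∃ s : ℝ, 0 ≤ s ∧ fkInt P (powF t μ) 2 q = s := by
  have hμ : 0 < μ := by linarith [h.four_lt]
  have hpos : ∀ x, 0 < MvPolynomial.eval x P + t := fun x => by linarith [h.nonneg x]
  refine ⟨∫ x, MvPolynomial.eval x q * (μ * (μ + 1) *
    (MvPolynomial.eval x P + t) ^ (-(μ + 1 + 1))), integral_nonneg fun x => ?_, ?_⟩
  · have := Real.rpow_nonneg (hpos x).le (-(μ + 1 + 1))
    have := hq x
    simp only [Pi.zero_apply]
    positivity
  · refine (integral_congr_ae (Filter.Eventually.of_forall fun x => ?_)).trans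
      integral_complex_ofReal
    rw [fk_powF_two (hpos x), ← Complex.ofReal_mul]

lemma Setting.polyGrad_ne_zero {f : ℂ → ℂ} (h : Setting P m r₀ θ₀ μ f) : polyGrad P P ≠ 0 := by
  intro hg
  have hd : 0 < d := by have := h.four_le; omega
  refine h.elliptic.pderiv_pderiv_ne_zero h.nonneg ⟨0, hd⟩ ?_
  have : MvPolynomial.pderiv ⟨0, hd⟩ P = 0 := by
    refine MvPolynomial.funext fun x => ?_
    have h1 := congrArg (MvPolynomial.eval x) hg
    rw [← gradSq_eq, gradSq, map_zero, Finset.sum_eq_zero_iff_of_nonneg fun _ _ => sq_nonneg _] at h1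
    rw [map_zero]
    exact pow_eq_zero_iff two_ne_zero |>.1 (h1 ⟨0, hd⟩ (Finset.mem_univ _))
  rw [this, map_zero]

/-- Convexity makes every `∂_j²P` nonnegative, so `ΔP = 0` would make each of them vanish. -/
lemma Setting.polyLap_ne_zero {f : ℂ → ℂ} (h : Setting P m r₀ θ₀ μ f) (hc : IsConvexPoly P) :
    polyLap P ≠ 0 := by
  intro hl
  have hd : 0 < d := by have := h.four_le; omega
  refine h.elliptic.pderiv_pderiv_ne_zero h.nonneg ⟨0, hd⟩ ?_
  refine MvPolynomial.funext fun x => ?_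
  have h1 := congrArg (MvPolynomial.eval x) hl
  rw [← lap_eq, lap, map_zero,
    Finset.sum_eq_zero_iff_of_nonneg fun j _ => hc.D2_nonneg j x] at h1
  rw [map_zero]
  exact h1 ⟨0, hd⟩ (Finset.mem_univ _)

/-- In the reduced form the two integrals against `f'' > 0` are nonnegative by convexity, and the
one against `f' < 0` enters with a minus sign and is strictly negative since `ΔP` is not zero. -/
theorem Setting.C4_five_ne_zero {P : MvPolynomial (Fin 5) ℝ}
    (h : Setting P m r₀ θ₀ μ (powF t μ)) (ht : 0 < t) (hc : IsConvexPoly P) :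
    C4 P r₀ θ₀ (powF t μ) ≠ 0 := by
  have hlap : ∀ x, 0 ≤ MvPolynomial.eval x (polyLap P) := fun x => by
    rw [← lap_eq]
    exact Finset.sum_nonneg fun j _ => hc.D2_nonneg j x
  have hgrad : ∀ x, 0 ≤ MvPolynomial.eval x (polyGrad P P) := fun x => by
    rw [← gradSq_eq]
    exact Finset.sum_nonneg fun j _ => sq_nonneg _
  obtain ⟨a, ha, ea⟩ := h.fkInt_two_nonneg ht (q := polyLap P * polyGrad P P) fun x => by
    rw [map_mul]
    exact mul_nonneg (hlap x) (hgrad x)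
  obtain ⟨b, hb, eb⟩ := h.fkInt_two_nonneg ht hc.hessGrad_nonneg
  obtain ⟨c, hc', ec⟩ := h.fkInt_one_sq_neg ht (h.polyLap_ne_zero hc) h.degree_lap_sq
  have hpi : (Real.pi : ℂ) ≠ 0 := by exact_mod_cast Real.pi_pos.ne'
  rw [C4, integral_mul_const, h.integral_C4density_five.2, ea, eb, ec]
  refine mul_ne_zero (mul_ne_zero (pow_ne_zero 3 hpi) ?_) (zpow_ne_zero _ ?_)
  · have : a / 480 + b / 240 - c / 60 ≠ 0 := by
      have : 0 < a / 480 + b / 240 - c / 60 := by linarith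
      exact this.ne'
    exact_mod_cast this
  · push_cast
    exact mul_ne_zero two_ne_zero hpi

/-- The single remaining integral pairs `|∇P|⁴` with `f' < 0`, and `∇P` does not vanish identically.
-/
theorem Setting.C4_seven_ne_zero {P : MvPolynomial (Fin 7) ℝ}
    (h : Setting P m r₀ θ₀ μ (powF t μ)) (ht : 0 < t) : C4 P r₀ θ₀ (powF t μ) ≠ 0 := by
  obtain ⟨c, hc, ec⟩ := h.fkInt_one_sq_neg ht h.polyGrad_ne_zero h.degree_grad_sq
  have hpi : (Real.pi : ℂ) ≠ 0 := by exact_mod_cast Real.pi_pos.ne'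
  rw [C4, integral_mul_const, h.integral_C4density_seven.2, ec]
  refine mul_ne_zero (mul_ne_zero (neg_ne_zero.2 (div_ne_zero (mul_ne_zero ?_
    (pow_ne_zero 4 hpi)) ?_)) ?_) (zpow_ne_zero _ ?_)
  · norm_num
  · norm_num
  · exact_mod_cast hc.ne
  · push_cast
    exact mul_ne_zero two_ne_zero hpi

end PowF

end QuadraticPencil
theorem mainTheorem3 :
    -- the formula in dimension 5
    (∀ (P : MvPolynomial (Fin 5) ℝ) (m : ℕ) (r₀ θ₀ μ : ℝ) (f : ℂ → ℂ),
      QuadraticPencil.IsPositiveElliptic P m → (∀ x, 0 ≤ MvPolynomial.eval x P) →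
      0 < r₀ → Real.pi / 2 < θ₀ → θ₀ < Real.pi → 5 * ((m : ℝ) + 1) / m < μ →
      QuadraticPencil.Admissible r₀ θ₀ μ f →
      QuadraticPencil.HasC4Formula P r₀ θ₀ f (fun x =>
        ((-(Real.pi ^ 3 / 96) * QuadraticPencil.bilap P x : ℝ) : ℂ) *
            QuadraticPencil.fk P f 0 x +
          ((-(Real.pi ^ 3 / 160) * QuadraticPencil.lap P x ^ 2 : ℝ) : ℂ) *
            QuadraticPencil.fk P f 1 x +
          ((Real.pi ^ 3 / 80 * (QuadraticPencil.gradSq P x * QuadraticPencil.lap P x) +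
              Real.pi ^ 3 / 240 * QuadraticPencil.hessGrad P x : ℝ) : ℂ) *
            QuadraticPencil.fk P f 2 x)) ∧
    -- the formula in dimension 7
    (∀ (P : MvPolynomial (Fin 7) ℝ) (m : ℕ) (r₀ θ₀ μ : ℝ) (f : ℂ → ℂ),
      QuadraticPencil.IsPositiveElliptic P m → (∀ x, 0 ≤ MvPolynomial.eval x P) →
      0 < r₀ → Real.pi / 2 < θ₀ → θ₀ < Real.pi → 7 * ((m : ℝ) + 1) / m < μ →
      QuadraticPencil.Admissible r₀ θ₀ μ f →
      QuadraticPencil.HasC4Formula P r₀ θ₀ f (fun x =>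
        ((Real.pi ^ 4 / 360 * (QuadraticPencil.gradSq P x * QuadraticPencil.lap P x) +
              Real.pi ^ 4 / 180 * QuadraticPencil.hessGrad P x : ℝ) : ℂ) *
            QuadraticPencil.fk P f 0 x +
          ((-(Real.pi ^ 4 / 60) * QuadraticPencil.gradSq P x ^ 2 : ℝ) : ℂ) *
            QuadraticPencil.fk P f 1 x)) ∧
    -- nonvanishing for the four classes
    (∀ (d : ℕ) (P : MvPolynomial (Fin d) ℝ) (m : ℕ) (r₀ θ₀ μ t : ℝ),
      (d = 5 ∨ d = 7) →
      QuadraticPencil.IsPositiveElliptic P m → (∀ x, 0 ≤ MvPolynomial.eval x P) →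
      0 < r₀ → r₀ < t → Real.pi / 2 < θ₀ → θ₀ < Real.pi → (d : ℝ) * ((m : ℝ) + 1) / m < μ →
      (QuadraticPencil.IsSumOfPowers P m ∨ QuadraticPencil.IsPosDefQuadratic P ∨
        (d = 7 ∧ QuadraticPencil.IsConvexPoly P) ∨
        (d = 5 ∧ QuadraticPencil.IsConvexPoly P ∧ QuadraticPencil.DerivInequalities P)) →
      QuadraticPencil.Admissible r₀ θ₀ μ (QuadraticPencil.powF t μ) ∧
        QuadraticPencil.C4 P r₀ θ₀ (QuadraticPencil.powF t μ) ≠ 0) := by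
  refine ⟨fun P m r₀ θ₀ μ f h1 h2 h3 h4 h5 h6 h7 => ?_,
    fun P m r₀ θ₀ μ f h1 h2 h3 h4 h5 h6 h7 => ?_,
    fun d P m r₀ θ₀ μ t hd h1 h2 h3 ht h4 h5 h6 h7 => ?_⟩
  · exact QuadraticPencil.Setting.hasC4Formula_five
      ⟨by norm_num, h1, h2, h3, h4, h5, by exact_mod_cast h6, h7⟩
  · exact QuadraticPencil.Setting.hasC4Formula_seven
      ⟨by norm_num, h1, h2, h3, h4, h5, by exact_mod_cast h6, h7⟩
  · have hμ : 0 ≤ μ := le_trans (by positivity) h6.le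
    have ha := QuadraticPencil.admissible_powF h3 (by linarith [Real.pi_pos]) h5 ht hμ
    have hs : QuadraticPencil.Setting P m r₀ θ₀ μ (QuadraticPencil.powF t μ) :=
      ⟨by omega, h1, h2, h3, h4, h5, h6, ha⟩
    refine ⟨ha, ?_⟩
    rcases hd with rfl | rfl
    · refine hs.C4_five_ne_zero (h3.trans ht) ?_
      rcases h7 with h7 | h7 | ⟨h7, -⟩ | ⟨-, h7, -⟩
      · exact h7.isConvexPoly (by norm_num) h2
      · exact h7.isConvexPoly
      · norm_num at h7
      · exact h7
    · exact hs.C4_seven_ne_zero (h3.trans ht)
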